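/- **Setting.** Let $L>0$, $V=H^2(0,L;\mathbb R^3)\times H^1(0,L;\mathbb R^3)$, $\|\cdot\|=\|\cdot\|_{L^2(0,L)}$. Let $L_{\rm bc}$ be a bounded linear operator into a normed space which depends only on the boundary values of $y,y',b$, and let $\ell_{\rm bc}$ be given. Put $$\overline Q(\alpha,\beta)=\begin{cases}(\alpha^2+\beta^2)^2/\alpha^2,&|\alpha|\ge|\beta|,\\ 4\beta^2,&|\alpha|\le|\beta|,\end{cases}\qquad E[y,b]=\int_0^L\overline Q(|y''|,|b'|)\,dx,\qquad E_{0,\varepsilon_2}[y,b]=E[y,b]+\frac1{2\varepsilon_2}\int_0^L(y'\cdot b')^2\,dx,$$ $$\mathcal A_{\rm frame}=\{(y,b)\in V:\ [y',b,y'\times b]\in SO(3)\text{ a.e.},\ L_{\rm bc}[y,b]=\ell_{\rm bc}\}.$$ The constrained functional $E$ equals $E[y,b]$ if $(y,b)\in\mathcal A_{\rm frame}$ and $y'\cdot b'=0$ a.e. (such pairs are called admissible), and $+\infty$ otherwise; the constrained functional $E_{0,\varepsilon_2}$ equals $E_{0,\varepsilon_2}[y,b]$ on $\mathcal A_{\rm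 frame}$ and $+\infty$ otherwise. Let $c_0,c_1,c_2,c_{\rm uni}>0$ be constants and let $|\cdot|_\delta:\mathbb R\to\mathbb R_{\ge0}$, $\delta\ge0$, satisfy $|x|_\delta\ge c_0\delta$ and $\big||x|_\delta-|x|\big|\le c_{\rm uni}\delta$ for all $x\in\mathbb R$, $\delta\ge0$, and, for $\delta>0$, $|\cdot|_\delta\in C^2(\mathbb R)$, $|\cdot|_\delta'\le c_1$, $|\cdot|_\delta''\le c_2\delta^{-1}$. Put $$\psi_\delta(r,s)=|r-s|_\delta+\frac{4s^2}{r+s+|r-s|_\delta}$$ (with $0/0=0$, also in $\overline Q$). For a partitioning $\mathcal T_h$: $0=x_0<\dots<x_N=L$ with maximal mesh-size $h$ let $V_h=\mathcal S^{3,1}(\mathcal T_h)^3\times\mathcal S^{1,0}(\mathcal T_h)^3\subset V$ (piecewise cubic $C^1$ and piecewise linear $C^0$ functions). A pair $(y_h,b_h)\in V_h$ is called discretely admissible if $|y_h'(x_j)|^2=|b_h(x_j)|^2=1$ for $j=0,\dots,N$ and $L_{\rm bc}[y_h,b_h]=\ell_{\rm bc}$. Let $\mathcal I_h^{1,0}$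 denote piecewise linear nodal interpolation and, on an element $T=[x_{j-1},x_j]$, $\mathcal A_hf|_T=|T|^{-1}\int_Tf\,dx$ and $\mathcal M_hr|_T=\frac12(r(x_{j-1})+r(x_j))$. For $\varepsilon=(\varepsilon_1,\varepsilon_2)$ with $\varepsilon_1,\varepsilon_2>0$ let $$E^{\rm quad}_{\delta,\varepsilon,h}[y_h,b_h]=\frac12\int_0^L|y_h''|^2+5|b_h'|^2+\psi_\delta(|\mathcal A_hy_h''|^2,|b_h'|^2)\,dx+\frac1{2\varepsilon_1}\int_0^L\mathcal I_h^{1,0}\big[(y_h'\cdot b_h)^2\big]dx+\frac1{2\varepsilon_2}\int_0^L(\mathcal M_hy_h'\cdot b_h')^2\,dx;$$ the constrained functional $E^{\rm quad}_{\delta,\varepsilon,h}$ on $V$ has this value at discretely admissible pairs and the value $+\infty$ elsewhere. For $(y,b)\in V$ and $\sigma>0$ let $[y,b]_\sigma\in[0,\infty]$ be the infimum of $\|y_\sigma\|_{H^3(0,L)}+\|b_\sigma\|_{H^2(0,L)}$ over all $(y_\sigma,b_\sigma)\in\mathcal A_{\rm frame}$ with $y_\sigma,b_\sigma\in C^\infty(0,L;\mathbb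 R^3)$ and $$\|y-y_\sigma\|_{H^2(0,L)}+\|b-b_\sigma\|_{H^1(0,L)}+\|y_\sigma'\cdot b_\sigma'\|\le\sigma$$ ($[y,b]_\sigma=\infty$ if there is none). A sequence of functionals $\Gamma$-converges to $G$ if $G$ is bounded above by the lower limit of the functionals along every sequence that converges weakly in $V$, and every $(y,b)\in V$ is the strong limit of a sequence along which the upper limit of the functionals is at most $G[y,b]$. Consider sequences of quasiuniform partitionings ($\min_T|T|\ge ch$ with $c>0$ independent of $h$) with $h\to0$ and of parameters $\delta\ge0$ and $\varepsilon_1>0$ with $\delta\to0$ and $\varepsilon_1\to0$. In 1–4, let also $\varepsilon_2>0$ be a sequence with $\varepsilon_2\to0$. **Proposition (Quadrature).** Assume, in all items except 2, the condition $h\varepsilon_1^{-1}+h^{1/2}\varepsilon_2^{-1/2}\to0$. 1. Let $(y,b)\in V$. If $\sigma>0$, $\sigma\to0$ and $$h^2\varepsilon_1^{-1}+\sigma^2\varepsilon_2^{-1}+h^2[y,b]_\sigma^2\varepsilon_2^{-1}\to0,\tag{$*$}$$ then there are discretely admissible pairs $(y_h,b_h)$ with $y_h\to y$ in $H^2$,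 $b_h\to b$ in $H^1$ and $E^{\rm quad}_{\delta,\varepsilon,h}[y_h,b_h]\to E[y,b]$. 2. Let $(y_h,b_h)$ be discretely admissible pairs with weak limit $(y,b)\in V$. Then $|y'|^2=|b|^2=1$ on $[0,L]$, $L_{\rm bc}[y,b]=\ell_{\rm bc}$, and $E[y,b]\le\liminf E^{\rm quad}_{\delta,\varepsilon,h}[y_h,b_h]$; if this lower limit is finite, then $(y,b)$ is admissible, i.e. $(y,b)\in\mathcal A_{\rm frame}$ and $y'\cdot b'=0$. 3. Let $(y_h,b_h)$ be discretely admissible pairs that minimize $E^{\rm quad}_{\delta,\varepsilon,h}$ among the discretely admissible pairs up to tolerances $\varepsilon_{\rm tol}\ge0$ with $\varepsilon_{\rm tol}\to0$. If a weak accumulation point of this sequence, or a minimizer of the constrained functional $E$, is such that $(*)$ holds for it with some sequence $\sigma>0$, $\sigma\to0$, then every weak accumulation point $(y,b)\in V$ of $(y_h,b_h)$ is admissible and minimizes the constrained functional $E$. 4. Assume that for every admissible $(y,b)$ and every $\sigma>0$ there is a pair $(y_\sigma,b_\sigma)$ as in the definition of $[y,b]_\sigma$ with the additional property $y_\sigma'\cdot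 b_\sigma'=0$ in $(0,L)$. If $h^2\varepsilon_1^{-1}+h^2\varepsilon_2^{-1}\to0$, then the constrained functionals $E^{\rm quad}_{\delta,\varepsilon,h}$ are $\Gamma$-convergent to the constrained functional $E$. 5. Let $\varepsilon_2>0$ be fixed. If $h^2\varepsilon_1^{-1}\to0$, then the constrained functionals $E^{\rm quad}_{\delta,\varepsilon,h}$ are $\Gamma$-convergent to the constrained functional $E_{0,\varepsilon_2}$. -/

import Mathlib

open MeasureTheory Filter Topology
open scoped ENNReal ContDiff RealInnerProductSpace

noncomputable section

/-! ### Function spaces on the interval `(0, L)` -/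

/-- Values in Euclidean space `ℝ³`. -/
abbrev E3 : Type := EuclideanSpace ℝ (Fin 3)

/-- The derivative of a function on `[0, L]` (one-sided at the end points; values of `u` outside
`[0, L]` play no role). -/
def D (L : ℝ) (u : ℝ → E3) : ℝ → E3 := derivWithin u (Set.Icc 0 L)

/-- Lebesgue measure on `(0, L)` (the end point `L` is a null set). -/
def mu (L : ℝ) : Measure ℝ := volume.restrict (Set.Ioc 0 L)

/-- `u ∈ H¹(0, L; ℝ³)`, with `u` on `[0, L]` the continuous representative: `u` has a derivative in
`L²` and is the integral of it (i.e. `u` is absolutely continuous with derivative in `L²`). -/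
def MemH1 (L : ℝ) (u : ℝ → E3) : Prop :=
  MemLp (D L u) 2 (mu L) ∧ ∀ x ∈ Set.Icc 0 L, u x = u 0 + ∫ t in (0 : ℝ)..x, D L u t

/-- `y ∈ H²(0, L; ℝ³)`: both `y` and `y'` belong to `H¹` (so `y` is the `C¹` representative). -/
def MemH2 (L : ℝ) (y : ℝ → E3) : Prop := MemH1 L y ∧ MemH1 L (D L y)

/-- The norm of `H^k(0, L; ℝ³)`, possibly infinite. -/
def hNorm (L : ℝ) (k : ℕ) (u : ℝ → E3) : ℝ≥0∞ :=
  (∑ i ∈ Finset.range (k + 1), eLpNorm ((D L)^[i] u) 2 (mu L) ^ 2) ^ (1 / 2 : ℝ)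

/-- The space `V = H²(0, L; ℝ³) × H¹(0, L; ℝ³)` of pairs `(y, b)`. -/
structure RibbonSpace (L : ℝ) where
  y : ℝ → E3
  b : ℝ → E3
  memH2_y : MemH2 L y
  memH1_b : MemH1 L b

/-- Norm convergence in `H² × H¹`. -/
def StrongConv {L : ℝ} (w : ℕ → RibbonSpace L) (v : RibbonSpace L) : Prop :=
  Tendsto (fun n => hNorm L 2 (fun x => (w n).y x - v.y x)) atTop (𝓝 0) ∧
  Tendsto (fun n => hNorm L 1 (fun x => (w n).b x - v.b x)) atTop (𝓝 0)

/-- Weak convergence in `L²(0, L; ℝ³)`. -/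
def WeakL2 (L : ℝ) (f : ℕ → ℝ → E3) (g : ℝ → E3) : Prop :=
  ∀ φ : ℝ → E3, MemLp φ 2 (mu L) →
    Tendsto (fun n => ∫ x in (0 : ℝ)..L, ⟪f n x, φ x⟫) atTop (𝓝 (∫ x in (0 : ℝ)..L, ⟪g x, φ x⟫))

/-- Weak convergence in `H² × H¹`: weak convergence in `L²` of the functions and of all their
derivatives up to order two and one, respectively. -/
def WeakConv {L : ℝ} (w : ℕ → RibbonSpace L) (v : RibbonSpace L) : Prop :=
  (∀ i ≤ 2, WeakL2 L (fun n => (D L)^[i] (w n).y) ((D L)^[i] v.y)) ∧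
  (∀ i ≤ 1, WeakL2 L (fun n => (D L)^[i] (w n).b) ((D L)^[i] v.b))

/-- `v` is a weak accumulation point: the weak limit of a subsequence. -/
def IsWeakAccPt {L : ℝ} (w : ℕ → RibbonSpace L) (v : RibbonSpace L) : Prop :=
  ∃ φ : ℕ → ℕ, StrictMono φ ∧ WeakConv (fun n => w (φ n)) v

/-- `Γ`-convergence on `H² × H¹`: lower bound along weakly convergent sequences, attainment along
norm convergent sequences. -/
def GammaConverges {L : ℝ} (F : ℕ → RibbonSpace L → EReal) (G : RibbonSpace L → EReal) : Prop :=
  (∀ (v : RibbonSpace L) (w : ℕ → RibbonSpace L), WeakConv w v →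
    G v ≤ liminf (fun n => F n (w n)) atTop) ∧
  (∀ v : RibbonSpace L, ∃ w : ℕ → RibbonSpace L, StrongConv w v ∧
    limsup (fun n => F n (w n)) atTop ≤ G v)

/-! ### The continuous ribbon energy -/

/-- The corrected Sadowsky density (with `0 / 0 = 0`). -/
def Qbar (α β : ℝ) : ℝ :=
  if |β| ≤ |α| then (α ^ 2 + β ^ 2) ^ 2 / α ^ 2 else 4 * β ^ 2

/-- The energy `E[y, b] = ∫ Q̄(|y''|, |b'|)`. -/
def energy {L : ℝ} (v : RibbonSpace L) : ℝ :=
  ∫ x in (0 : ℝ)..L, Qbar ‖D L (D L v.y) x‖ ‖D L v.b x‖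

/-- The energy `E_{0,ε₂}` with the relation `y' ⬝ b' = 0` penalized. -/
def energyPen {L : ℝ} (ε₂ : ℝ) (v : RibbonSpace L) : ℝ :=
  energy v + 1 / (2 * ε₂) * ∫ x in (0 : ℝ)..L, ⟪D L v.y x, D L v.b x⟫ ^ 2

/-- The matrix with columns `t`, `b`, `t × b`. -/
def frameMatrix (t b : E3) : Matrix (Fin 3) (Fin 3) ℝ :=
  (Matrix.of ![t.ofLp, b.ofLp, crossProduct t.ofLp b.ofLp]).transpose

/-- The boundary values of `y`, `y'` and `b`. -/
def boundaryData {L : ℝ} (v : RibbonSpace L) : Fin 6 → E3 :=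
  ![v.y 0, v.y L, D L v.y 0, D L v.y L, v.b 0, v.b L]

section Constraints

variable {L : ℝ} {F : Type*} [NormedAddCommGroup F] [NormedSpace ℝ F]

/-- The set of admissible frames: `[y', b, y' × b] ∈ SO(3)` almost everywhere and the boundary
conditions `L_bc[y, b] = ℓ_bc`. -/
def IsAdmissibleFrame (Lbc : (Fin 6 → E3) →L[ℝ] F) (lbc : F) (v : RibbonSpace L) : Prop :=
  (∀ᵐ x ∂(mu L), frameMatrix (D L v.y x) (v.b x) ∈ Matrix.specialOrthogonalGroup (Fin 3) ℝ) ∧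
  Lbc (boundaryData v) = lbc

/-- The relation `y' ⬝ b' = 0` in `(0, L)`. -/
def IsUnsheared (v : RibbonSpace L) : Prop :=
  ∀ᵐ x ∂(mu L), ⟪D L v.y x, D L v.b x⟫ = 0

/-- Admissibility for the constrained functional `E`. -/
def IsAdmissible (Lbc : (Fin 6 → E3) →L[ℝ] F) (lbc : F) (v : RibbonSpace L) : Prop :=
  IsAdmissibleFrame Lbc lbc v ∧ IsUnsheared v

/-- `v` minimizes the constrained functional `E`. -/
def IsMinimizer (Lbc : (Fin 6 → E3) →L[ℝ] F) (lbc : F) (v : RibbonSpace L) : Prop :=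
  IsAdmissible Lbc lbc v ∧ ∀ w : RibbonSpace L, IsAdmissible Lbc lbc w → energy v ≤ energy w

open Classical in
/-- The constrained functional `E`, with value `+∞` off the admissible set. -/
def constrainedEnergy (Lbc : (Fin 6 → E3) →L[ℝ] F) (lbc : F) (v : RibbonSpace L) : EReal :=
  if IsAdmissible Lbc lbc v then (energy v : EReal) else ⊤

open Classical in
/-- The constrained functional `E_{0,ε₂}`, with value `+∞` off the set of admissible frames. -/
def constrainedEnergyPen (Lbc : (Fin 6 → E3) →L[ℝ] F) (lbc : F) (ε₂ : ℝ)
    (v : RibbonSpace L) : EReal :=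
  if IsAdmissibleFrame Lbc lbc v then (energyPen ε₂ v : EReal) else ⊤

/-- `z = (y_σ, b_σ)` is a smooth admissible frame with
`‖y - y_σ‖_{H²} + ‖b - b_σ‖_{H¹} + ‖y_σ' ⬝ b_σ'‖ ≤ σ`, where `v = (y, b)`. -/
def IsSmoothApprox (Lbc : (Fin 6 → E3) →L[ℝ] F) (lbc : F) (v : RibbonSpace L) (σ : ℝ)
    (z : RibbonSpace L) : Prop :=
  ContDiffOn ℝ ∞ z.y (Set.Ioo 0 L) ∧ ContDiffOn ℝ ∞ z.b (Set.Ioo 0 L) ∧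
  IsAdmissibleFrame Lbc lbc z ∧
  hNorm L 2 (fun x => v.y x - z.y x) + hNorm L 1 (fun x => v.b x - z.b x)
    + eLpNorm (fun x => ⟪D L z.y x, D L z.b x⟫) 2 (mu L) ≤ ENNReal.ofReal σ

/-- The quantity `[y, b]_σ = ‖y_σ‖_{H³} + ‖b_σ‖_{H²}`, for the best choice of `(y_σ, b_σ)`. -/
def approxNorm (Lbc : (Fin 6 → E3) →L[ℝ] F) (lbc : F) (v : RibbonSpace L) (σ : ℝ) : ℝ≥0∞ :=
  ⨅ (z : RibbonSpace L) (_ : IsSmoothApprox Lbc lbc v σ z), hNorm L 3 z.y + hNorm L 2 z.b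

/-- `h² ε₁⁻¹ + σ² ε₂⁻¹ + h² [y, b]_σ² ε₂⁻¹ → 0` along the sequences of parameters. -/
def ApproxCondition (Lbc : (Fin 6 → E3) →L[ℝ] F) (lbc : F) (v : RibbonSpace L)
    (h ε₁ ε₂ σ : ℕ → ℝ) : Prop :=
  Tendsto (fun n => ENNReal.ofReal (h n ^ 2 / ε₁ n) + ENNReal.ofReal (σ n ^ 2 / ε₂ n)
    + ENNReal.ofReal (h n ^ 2 / ε₂ n) * approxNorm Lbc lbc v (σ n) ^ 2) atTop (𝓝 0)

end Constraints

/-! ### Regularization -/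

/-- `reg δ = |·|_δ` is a family of regularized modulus functions. -/
structure IsRegularizedModulus (reg : ℝ → ℝ → ℝ) (c₀ c₁ c₂ cuni : ℝ) : Prop where
  nonneg : ∀ δ, 0 ≤ δ → ∀ x, 0 ≤ reg δ x
  contDiff : ∀ δ, 0 < δ → ContDiff ℝ 2 (reg δ)
  lower_bound : ∀ δ, 0 ≤ δ → ∀ x, c₀ * δ ≤ reg δ x
  deriv_le : ∀ δ, 0 < δ → ∀ x, deriv (reg δ) x ≤ c₁
  deriv2_le : ∀ δ, 0 < δ → ∀ x, iteratedDeriv 2 (reg δ) x ≤ c₂ * δ⁻¹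
  uniform : ∀ δ, 0 ≤ δ → ∀ x, |reg δ x - (|x|)| ≤ cuni * δ

/-- `ψ_δ(r, s) = |r - s|_δ + 4 s² / (r + s + |r - s|_δ)`. -/
def psi (reg : ℝ → ℝ → ℝ) (δ r s : ℝ) : ℝ :=
  reg δ (r - s) + 4 * s ^ 2 / (r + s + reg δ (r - s))

/-! ### Finite elements -/

/-- A partitioning `0 = x_0 < x_1 < ⋯ < x_N = L` of `(0, L)`. -/
structure Mesh (L : ℝ) where
  N : ℕ
  node : Fin (N + 1) → ℝ
  strictMono : StrictMono node
  node_zero : node 0 = 0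
  node_last : node (Fin.last N) = L

namespace Mesh

variable {L : ℝ} (T : Mesh L)

/-- Left end point of the element `j`. -/
def lft (j : Fin T.N) : ℝ := T.node j.castSucc

/-- Right end point of the element `j`. -/
def rgt (j : Fin T.N) : ℝ := T.node j.succ

/-- Length of the element `j`. -/
def len (j : Fin T.N) : ℝ := T.rgt j - T.lft j

/-- The maximal mesh-size. -/
def meshSize : ℝ := ⨆ j : Fin T.N, T.len j

/-- `𝒮^{p,k}(𝒯_h)³`: functions in `C^k` that are polynomials of degree at most `p` on every
element. -/
def IsSpline (p k : ℕ) (v : ℝ → E3) : Prop :=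
  ContDiffOn ℝ k v (Set.Icc 0 L) ∧
  ∀ j : Fin T.N, ∃ c : Fin (p + 1) → E3, ∀ x ∈ Set.Icc (T.lft j) (T.rgt j),
    v x = ∑ i : Fin (p + 1), x ^ (i : ℕ) • c i

/-- The element average `𝒜_h f` on the element `j`. -/
def avg (f : ℝ → E3) (j : Fin T.N) : E3 := (T.len j)⁻¹ • ∫ x in (T.lft j)..(T.rgt j), f x

/-- The midpoint average `ℳ_h r` on the element `j`. -/
def mid (r : ℝ → E3) (j : Fin T.N) : E3 := (1 / 2 : ℝ) • (r (T.lft j) + r (T.rgt j))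

/-- The nodal interpolant `ℐ_h^{1,0} g` on the element `j`. -/
def interp (g : ℝ → ℝ) (j : Fin T.N) (x : ℝ) : ℝ :=
  g (T.lft j) + (x - T.lft j) / T.len j * (g (T.rgt j) - g (T.lft j))

/-- The functional `E^quad_{δ,ε,h}`, with the integrals split into the contributions of the
elements. -/
def energyQuad (reg : ℝ → ℝ → ℝ) (δ ε₁ ε₂ : ℝ) (v : RibbonSpace L) : ℝ :=
  (1 / 2) * (∑ j : Fin T.N, ∫ x in (T.lft j)..(T.rgt j),
      (‖D L (D L v.y) x‖ ^ 2 + 5 * ‖D L v.b x‖ ^ 2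
        + psi reg δ (‖T.avg (D L (D L v.y)) j‖ ^ 2) (‖D L v.b x‖ ^ 2)))
    + 1 / (2 * ε₁) * (∑ j : Fin T.N, ∫ x in (T.lft j)..(T.rgt j),
        T.interp (fun s => ⟪D L v.y s, v.b s⟫ ^ 2) j x)
    + 1 / (2 * ε₂) * (∑ j : Fin T.N, ∫ x in (T.lft j)..(T.rgt j),
        ⟪T.mid (D L v.y) j, D L v.b x⟫ ^ 2)

variable {F : Type*} [NormedAddCommGroup F] [NormedSpace ℝ F]

/-- Discrete admissible pairs: `(y_h, b_h) ∈ V_h` with the unit length constraints at the nodes and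
the boundary conditions. -/
def IsDiscreteAdmissible (Lbc : (Fin 6 → E3) →L[ℝ] F) (lbc : F) (v : RibbonSpace L) : Prop :=
  T.IsSpline 3 1 v.y ∧ T.IsSpline 1 0 v.b ∧
  (∀ i, ‖D L v.y (T.node i)‖ ^ 2 = 1 ∧ ‖v.b (T.node i)‖ ^ 2 = 1) ∧
  Lbc (boundaryData v) = lbc

open Classical in
/-- The constrained functional `E^quad_{δ,ε,h}`, with value `+∞` off the set of discrete admissible
pairs. -/
def constrainedEnergyQuad (Lbc : (Fin 6 → E3) →L[ℝ] F) (lbc : F) (reg : ℝ → ℝ → ℝ)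
    (δ ε₁ ε₂ : ℝ) (v : RibbonSpace L) : EReal :=
  if T.IsDiscreteAdmissible Lbc lbc v then (T.energyQuad reg δ ε₁ ε₂ v : EReal) else ⊤

end Mesh

end

noncomputable section

/-! ### Integration on the interval -/

/-! The density is convex although it is given by cases: for α, β ≥ 0 its square root `gam` is the
maximum over s ∈ [0, 1] of the linear forms (1 - s²) α + 2 s β (`le_gam`), attained at s = `ratio α
β`. This yields an explicit subgradient of linear growth for (p, q) ↦ Q̄(|p|, |q|) (`subgrad_le`)
and the Lipschitz continuity of `gam`. Moreover ½(α² + 5β² + ψ_δ(α², β²)) equals Q̄(α, β) up to O(δ)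
(`abs_psi_sub_le`). Hence, up to O(δ), the elastic part of the discrete energy is ∫ Q̄(|𝒜_h y''|,
|b'|) + ½ ∫ (|y''|² - |𝒜_h y''|²), and the last term is nonnegative by Jensen's inequality.

Lower bound (`energyPen_le_of_weakConv`). The convex energy lies above its affine minorant given by
the subgradient at the weak limit. Averaging is symmetric and 𝒜_h ξ → ξ in L² for a fixed field ξ,
so the minorant passes to the limit. Weakly convergent sequences are bounded, hence uniformly Hölder
continuous, so endpoint and midpoint values on the elements converge pointwise; this transfers the
nodal unit length constraints and the relation y' ⬝ b = 0 to the limit. The shear penalty is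
linearized in the same spirit by m² ≥ 2 g m - g², where g is the shear of the limit. All this is
done for a fixed ε₂ = ε. Since the discrete energy decreases in ε₂, a sequence ε₂ → 0 satisfies the
bound for every ε > 0, and ε → 0 forces y' ⬝ b' = 0 (`energy_le_of_frequently`).

Recovery. The pair (y, b) is interpolated directly, without smoothing: cubic Hermite interpolation
of y and linear interpolation of b. Nodal values are preserved, so the interpolants are discretely
admissible and their nodal penalty is exactly zero; the element averages of y'' and b' are preserved
as well, which gives strong convergence and convergence of the elastic energy. If y' ⬝ b' = 0, then
𝓜_h y' ⬝ b' = (𝓜_h y' - y') ⬝ b', and |𝓜_h y' - y'| ≤ h^{1/2} ‖y''‖ bounds the shear penalty by h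
‖y''‖² ‖b'‖²; thus h/ε₂ → 0 suffices (`tendsto_energyQuad_interpolant`).

The condition (*) identifies a pair as a limit of smooth frames with vanishing shear, hence as
admissible (`isAdmissible_of_approxCondition`). The statements on Γ-convergence and on
almost-minimizers then follow by the usual comparison of lower bound and recovery. -/

instance isFiniteMeasure_mu (L : ℝ) : IsFiniteMeasure (mu L) := by
  unfold mu; infer_instance

section Calculus

variable {L : ℝ} {G : Type*} [NormedAddCommGroup G]

theorem integrableOn_of_integrable_mu {f : ℝ → G} (hf : Integrable f (mu L)) {a b : ℝ}
    (ha : 0 ≤ a) (hb : b ≤ L) : IntegrableOn f (Set.Ioc a b) volume :=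
  IntegrableOn.mono_set (t := Set.Ioc 0 L) hf (Set.Ioc_subset_Ioc ha hb)

theorem intervalIntegrable_of_integrable_mu {f : ℝ → G} (hf : Integrable f (mu L)) {a b : ℝ}
    (ha : a ∈ Set.Icc 0 L) (hb : b ∈ Set.Icc 0 L) : IntervalIntegrable f volume a b :=
  ⟨integrableOn_of_integrable_mu hf ha.1 hb.2, integrableOn_of_integrable_mu hf hb.1 ha.2⟩

theorem memLp_integrable {f : ℝ → G} (hf : MemLp f 2 (mu L)) : Integrable f (mu L) :=
  hf.integrable (by norm_num)

theorem memLp_integrable_sq {f : ℝ → G} (hf : MemLp f 2 (mu L)) :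
    Integrable (fun x => ‖f x‖ ^ 2) (mu L) :=
  (memLp_two_iff_integrable_sq_norm hf.1).1 hf

theorem memLp_inner_integrable {f g : ℝ → E3} (hf : MemLp f 2 (mu L)) (hg : MemLp g 2 (mu L)) :
    Integrable (fun x => ⟪f x, g x⟫) (mu L) := by
  refine ((memLp_integrable_sq hf).add (memLp_integrable_sq hg)).mono
    (hf.1.inner hg.1) (ae_of_all _ fun x => ?_)
  have h1 := abs_real_inner_le_norm (f x) (g x)
  rw [Real.norm_eq_abs, Real.norm_of_nonneg (by simp only [Pi.add_apply]; positivity)]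
  simp only [Pi.add_apply]
  nlinarith [sq_nonneg (‖f x‖ - ‖g x‖), norm_nonneg (f x), norm_nonneg (g x)]

theorem setIntegral_le_integral_mu {f : ℝ → ℝ} (hf : Integrable f (mu L)) (h0 : ∀ x, 0 ≤ f x)
    {a b : ℝ} (ha : 0 ≤ a) (hab : a ≤ b) (hb : b ≤ L) :
    ∫ x in a..b, f x ≤ ∫ x, f x ∂(mu L) := by
  rw [intervalIntegral.integral_of_le hab]
  exact setIntegral_mono_set (t := Set.Ioc 0 L) hf (ae_of_all _ h0)
    (Set.Ioc_subset_Ioc ha hb).eventuallyLE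

theorem ae_interval_of_ae_mu {p : ℝ → Prop} (hp : ∀ᵐ x ∂(mu L), p x) {a b : ℝ}
    (ha : 0 ≤ a) (hb : b ≤ L) : ∀ᵐ x ∂volume, x ∈ Set.Ioc a b → p x := by
  have h := (ae_restrict_iff' (μ := volume) (s := Set.Ioc 0 L) measurableSet_Ioc).1 hp
  filter_upwards [h] with x hx hxab
  exact hx ⟨ha.trans_lt hxab.1, hxab.2.trans hb⟩

/-- Expansion of the mean squared distance to a constant. -/
theorem integral_norm_sub_const_sq {f : ℝ → E3} {a b : ℝ} (hf : IntervalIntegrable f volume a b)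
    (hf2 : IntervalIntegrable (fun x => ‖f x‖ ^ 2) volume a b) (c : E3) :
    ∫ x in a..b, ‖f x - c‖ ^ 2 =
      (∫ x in a..b, ‖f x‖ ^ 2) - 2 * ⟪∫ x in a..b, f x, c⟫ + (b - a) * ‖c‖ ^ 2 := by
  have hi : IntervalIntegrable (fun x => ⟪f x, c⟫) volume a b :=
    ⟨hf.1.inner_const c, hf.2.inner_const c⟩
  have hin : ∫ x in a..b, ⟪f x, c⟫ = ⟪∫ x in a..b, f x, c⟫ := by
    have := ((innerSL ℝ c).intervalIntegral_comp_comm hf)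
    simpa [real_inner_comm] using this
  simp_rw [norm_sub_sq_real]
  rw [intervalIntegral.integral_add (hf2.sub (hi.const_mul 2)) (by simp),
    intervalIntegral.integral_sub hf2 (hi.const_mul 2), intervalIntegral.integral_const_mul, hin]
  simp

/-- The Cauchy–Schwarz inequality against a constant. -/
theorem integral_sq_le_mul {g : ℝ → ℝ} {a b : ℝ} (hab : a ≤ b)
    (hg : IntervalIntegrable g volume a b)
    (hg2 : IntervalIntegrable (fun x => g x ^ 2) volume a b) :
    (∫ x in a..b, g x) ^ 2 ≤ (b - a) * ∫ x in a..b, g x ^ 2 := by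
  rcases hab.eq_or_lt with rfl | hlt
  · simp
  -- Nonnegativity of the variance: m is the mean of g, and expanding ∫ (g - m)² ≥ 0 gives the
  -- claim.
  set m := (∫ x in a..b, g x) / (b - a) with hm
  have hpos : 0 < b - a := sub_pos.2 hlt
  have h0 : 0 ≤ ∫ x in a..b, (g x - m) ^ 2 :=
    intervalIntegral.integral_nonneg hab fun x _ => sq_nonneg _
  have he : ∫ x in a..b, (g x - m) ^ 2
      = (∫ x in a..b, g x ^ 2) - 2 * m * (∫ x in a..b, g x) + (b - a) * m ^ 2 := by
    have : ∀ x, (g x - m) ^ 2 = g x ^ 2 - 2 * m * g x + m ^ 2 := fun x => by ring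
    simp_rw [this]
    rw [intervalIntegral.integral_add (hg2.sub (hg.const_mul _)) (by simp),
      intervalIntegral.integral_sub hg2 (hg.const_mul _), intervalIntegral.integral_const_mul]
    simp
  have hI : ∫ x in a..b, g x = m * (b - a) := by rw [hm]; field_simp
  rw [he, hI] at h0
  rw [hI]
  nlinarith

theorem norm_integral_sq_le {f : ℝ → E3} (hf : MemLp f 2 (mu L)) {a b : ℝ}
    (ha : 0 ≤ a) (hab : a ≤ b) (hb : b ≤ L) :
    ‖∫ x in a..b, f x‖ ^ 2 ≤ (b - a) * ∫ x in a..b, ‖f x‖ ^ 2 := by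
  have ha' : a ∈ Set.Icc 0 L := ⟨ha, hab.trans hb⟩
  have hb' : b ∈ Set.Icc 0 L := ⟨ha.trans hab, hb⟩
  refine le_trans ?_ (integral_sq_le_mul hab
    (intervalIntegrable_of_integrable_mu (memLp_integrable hf).norm ha' hb')
    (intervalIntegrable_of_integrable_mu (memLp_integrable_sq hf) ha' hb'))
  exact pow_le_pow_left₀ (norm_nonneg _) (intervalIntegral.norm_integral_le_integral_norm hab) 2

/-! ### Functions in `H¹` and `H²` -/

theorem MemH1.sub_eq_integral {u : ℝ → E3} (hu : MemH1 L u) {x y : ℝ} (hx : x ∈ Set.Icc 0 L)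
    (hy : y ∈ Set.Icc 0 L) : u y - u x = ∫ t in x..y, D L u t := by
  have h0 : (0 : ℝ) ∈ Set.Icc 0 L := ⟨le_rfl, hx.1.trans hx.2⟩
  have hi := memLp_integrable hu.1
  rw [hu.2 x hx, hu.2 y hy, ← intervalIntegral.integral_interval_sub_left
    (intervalIntegrable_of_integrable_mu hi h0 hy) (intervalIntegrable_of_integrable_mu hi h0 hx)]
  abel

/-- Hölder continuity with exponent 1/2, from Cauchy–Schwarz. All errors caused by replacing a field
by its nodal or midpoint values come from here, and with them the factor h in the shear estimate. -/
theorem MemH1.norm_sub_sq_le {u : ℝ → E3} (hu : MemH1 L u) {x y : ℝ} (hx : x ∈ Set.Icc 0 L)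
    (hy : y ∈ Set.Icc 0 L) :
    ‖u y - u x‖ ^ 2 ≤ |y - x| * ∫ t, ‖D L u t‖ ^ 2 ∂(mu L) := by
  wlog hxy : x ≤ y generalizing x y
  · rw [norm_sub_rev, abs_sub_comm]
    exact this hy hx (le_of_not_ge hxy)
  rw [hu.sub_eq_integral hx hy, abs_of_nonneg (sub_nonneg.2 hxy)]
  exact (norm_integral_sq_le hu.1 hx.1 hxy hy.2).trans
    (mul_le_mul_of_nonneg_left (setIntegral_le_integral_mu (memLp_integrable_sq hu.1)
      (fun x => sq_nonneg _) hx.1 hxy hy.2) (sub_nonneg.2 hxy))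

theorem continuousOn_primitive_mu {g : ℝ → E3} (hg : MemLp g 2 (mu L)) (hL : 0 ≤ L) (c : E3) :
    ContinuousOn (fun x => c + ∫ t in (0 : ℝ)..x, g t) (Set.Icc 0 L) := by
  refine continuousOn_const.add ?_
  have h0 : (0 : ℝ) ∈ Set.Icc 0 L := ⟨le_rfl, hL⟩
  have hLL : L ∈ Set.Icc 0 L := ⟨hL, le_rfl⟩
  have := intervalIntegral.continuousOn_primitive_interval' (f := g) (μ := volume) (a := 0)
    (b₁ := 0) (b₂ := L) (intervalIntegrable_of_integrable_mu (memLp_integrable hg) h0 hLL)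
    (by simp)
  rwa [Set.uIcc_of_le hL] at this

theorem ae_hasDerivWithinAt_primitive {g : ℝ → E3} (hg : MemLp g 2 (mu L)) (hL : 0 ≤ L)
    (c : E3) {u : ℝ → E3} (hu : ∀ x ∈ Set.Icc 0 L, u x = c + ∫ t in (0 : ℝ)..x, g t) :
    ∀ᵐ x ∂(mu L), HasDerivWithinAt u (g x) (Set.Icc 0 L) x := by
  have h0 : (0 : ℝ) ∈ Set.Icc 0 L := ⟨le_rfl, hL⟩
  have hLL : L ∈ Set.Icc 0 L := ⟨hL, le_rfl⟩
  have h := (intervalIntegrable_of_integrable_mu (memLp_integrable hg) h0 hLL).ae_hasDerivAt_integral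
  rw [Set.uIcc_of_le hL] at h
  refine (ae_restrict_iff' (μ := volume) (s := Set.Ioc 0 L) measurableSet_Ioc).2 ?_
  filter_upwards [h] with x hx hxL
  have hx' := Set.Ioc_subset_Icc_self hxL
  exact (((hx hx' 0 h0).const_add c).hasDerivWithinAt).congr hu (hu x hx')

theorem uniqueDiffWithinAt_Icc (hL : 0 < L) {x : ℝ} (hx : x ∈ Set.Icc 0 L) :
    UniqueDiffWithinAt ℝ (Set.Icc 0 L) x := uniqueDiffOn_Icc hL x hx

/-- `D` is a pointwise derivative, so for a merely square integrable g it is recovered only almost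
everywhere, by Lebesgue differentiation. This is enough to rewrite the integral formula with `D L u`
in place of g. -/
theorem memH1_of_primitive {g : ℝ → E3} (hg : MemLp g 2 (mu L)) (hL : 0 < L)
    (c : E3) {u : ℝ → E3} (hu : ∀ x ∈ Set.Icc 0 L, u x = c + ∫ t in (0 : ℝ)..x, g t) :
    MemH1 L u ∧ D L u =ᵐ[mu L] g := by
  have hD : D L u =ᵐ[mu L] g := by
    have hm : ∀ᵐ x ∂(mu L), x ∈ Set.Ioc 0 L := ae_restrict_mem measurableSet_Ioc
    filter_upwards [ae_hasDerivWithinAt_primitive hg hL.le c hu, hm] with x hx hxm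
    exact hx.derivWithin (uniqueDiffWithinAt_Icc hL (Set.Ioc_subset_Icc_self hxm))
  refine ⟨⟨(memLp_congr_ae hD).2 hg, fun x hx => ?_⟩, hD⟩
  have h0 : u 0 = c := by simpa using hu 0 ⟨le_rfl, hL.le⟩
  rw [hu x hx, h0]
  congr 1
  refine intervalIntegral.integral_congr_ae ?_
  rw [Set.uIoc_of_le hx.1]
  filter_upwards [ae_interval_of_ae_mu hD le_rfl hx.2] with t ht htx
  exact (ht htx).symm

theorem MemH1.ae_hasDerivWithinAt {u : ℝ → E3} (hu : MemH1 L u) (hL : 0 < L) :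
    ∀ᵐ x ∂(mu L), HasDerivWithinAt u (D L u x) (Set.Icc 0 L) x :=
  ae_hasDerivWithinAt_primitive hu.1 hL.le (u 0) hu.2

theorem MemH1.continuousOn {u : ℝ → E3} (hu : MemH1 L u) (hL : 0 < L) :
    ContinuousOn u (Set.Icc 0 L) :=
  (continuousOn_primitive_mu hu.1 hL.le (u 0)).congr hu.2

theorem hasDerivWithinAt_primitive_of_continuousOn {g : ℝ → E3}
    (hg : ContinuousOn g (Set.Icc 0 L)) (c : E3) {u : ℝ → E3}
    (hu : ∀ x ∈ Set.Icc 0 L, u x = c + ∫ t in (0 : ℝ)..x, g t) {x : ℝ} (hx : x ∈ Set.Icc 0 L) :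
    HasDerivWithinAt u (g x) (Set.Icc 0 L) x := by
  have hi : IntervalIntegrable g volume 0 x := by
    refine ContinuousOn.intervalIntegrable (hg.mono ?_)
    rw [Set.uIcc_of_le hx.1]
    exact Set.Icc_subset_Icc_right hx.2
  have : Fact (x ∈ Set.Icc 0 L) := ⟨hx⟩
  have h := intervalIntegral.integral_hasDerivWithinAt_right (s := Set.Icc 0 L) (t := Set.Icc 0 L)
    hi (hg.stronglyMeasurableAtFilter_nhdsWithin measurableSet_Icc x) (hg x hx)
  exact (h.const_add c).congr hu (hu x hx)

/-- The derivative of an H² function exists at every point because it is the primitive of a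
continuous function; this gives meaning to nodal values of y'. -/
theorem MemH2.hasDerivWithinAt {y : ℝ → E3} (hy : MemH2 L y) (hL : 0 < L) {x : ℝ}
    (hx : x ∈ Set.Icc 0 L) : HasDerivWithinAt y (D L y x) (Set.Icc 0 L) x :=
  hasDerivWithinAt_primitive_of_continuousOn (hy.2.continuousOn hL) (y 0) hy.1.2 hx

theorem D_congr {u v : ℝ → E3} (h : ∀ x ∈ Set.Icc 0 L, u x = v x) {x : ℝ}
    (hx : x ∈ Set.Icc 0 L) : D L u x = D L v x :=
  derivWithin_congr h (h x hx)

theorem memLp_of_continuousOn {g : ℝ → G} (hg : ContinuousOn g (Set.Icc 0 L)) :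
    MemLp g 2 (mu L) := by
  obtain ⟨C, hC⟩ := isCompact_Icc.exists_bound_of_continuousOn hg
  have hm : AEStronglyMeasurable g (mu L) :=
    (hg.aestronglyMeasurable_of_isCompact isCompact_Icc measurableSet_Icc).mono_measure
      (Measure.restrict_mono_set volume Set.Ioc_subset_Icc_self)
  refine MemLp.of_bound hm C ?_
  refine (ae_restrict_iff' (μ := volume) (s := Set.Ioc 0 L) measurableSet_Ioc).2 ?_
  exact ae_of_all _ fun x hx => hC x (Set.Ioc_subset_Icc_self hx)

theorem memH2_of_primitive {g : ℝ → E3} (hg : MemLp g 2 (mu L)) (hL : 0 < L)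
    (c d : E3) {y : ℝ → E3}
    (hy : ∀ x ∈ Set.Icc 0 L, y x = c + ∫ s in (0 : ℝ)..x, (d + ∫ t in (0 : ℝ)..s, g t)) :
    MemH2 L y ∧ (∀ x ∈ Set.Icc 0 L, D L y x = d + ∫ t in (0 : ℝ)..x, g t) ∧
      D L (D L y) =ᵐ[mu L] g := by
  have hc := continuousOn_primitive_mu hg hL.le d
  have hD : ∀ x ∈ Set.Icc 0 L, D L y x = d + ∫ t in (0 : ℝ)..x, g t := fun x hx =>
    (hasDerivWithinAt_primitive_of_continuousOn hc c hy hx).derivWithin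
      (uniqueDiffWithinAt_Icc hL hx)
  have h2 := memH1_of_primitive hg hL d hD
  exact ⟨⟨(memH1_of_primitive (memLp_of_continuousOn hc) hL c hy).1, h2.1⟩, hD, h2.2⟩

theorem MemH1.ae_D_sub {u v : ℝ → E3} (hL : 0 < L) (hu : MemH1 L u) (hv : MemH1 L v) :
    D L (fun x => u x - v x) =ᵐ[mu L] fun x => D L u x - D L v x := by
  have hm : ∀ᵐ x ∂(mu L), x ∈ Set.Ioc 0 L := ae_restrict_mem measurableSet_Ioc
  filter_upwards [hu.ae_hasDerivWithinAt hL, hv.ae_hasDerivWithinAt hL, hm] with x h1 h2 hx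
  exact (h1.sub h2).derivWithin (uniqueDiffWithinAt_Icc hL (Set.Ioc_subset_Icc_self hx))

theorem MemH2.D_sub {u v : ℝ → E3} (hL : 0 < L) (hu : MemH2 L u) (hv : MemH2 L v) {x : ℝ}
    (hx : x ∈ Set.Icc 0 L) : D L (fun x => u x - v x) x = D L u x - D L v x :=
  ((hu.hasDerivWithinAt hL hx).sub (hv.hasDerivWithinAt hL hx)).derivWithin
    (uniqueDiffWithinAt_Icc hL hx)

/-- `D` does not respect almost everywhere equality of its argument, so the outer derivative is
computed from an identity of first derivatives that holds on all of [0, L]. -/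
theorem MemH2.ae_DD_sub {u v : ℝ → E3} (hL : 0 < L) (hu : MemH2 L u) (hv : MemH2 L v) :
    D L (D L (fun x => u x - v x)) =ᵐ[mu L] fun x => D L (D L u) x - D L (D L v) x := by
  have hm : ∀ᵐ x ∂(mu L), x ∈ Set.Ioc 0 L := ae_restrict_mem measurableSet_Ioc
  filter_upwards [hu.2.ae_D_sub hL hv.2, hm] with x h1 hx
  rw [← h1]
  exact D_congr (fun z hz => hu.D_sub hL hv hz) (Set.Ioc_subset_Icc_self hx)

end Calculus

/-! ### Piecewise defined functions on a mesh -/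

namespace Mesh

variable {L : ℝ} (T : Mesh L)

theorem lft_lt_rgt (j : Fin T.N) : T.lft j < T.rgt j :=
  T.strictMono (Fin.castSucc_lt_succ)

theorem len_pos (j : Fin T.N) : 0 < T.len j := sub_pos.2 (T.lft_lt_rgt j)

theorem node_nonneg (i : Fin (T.N + 1)) : 0 ≤ T.node i := by
  rw [← T.node_zero]; exact T.strictMono.monotone (Fin.zero_le i)

theorem node_le (i : Fin (T.N + 1)) : T.node i ≤ L :=
  (T.strictMono.monotone (Fin.le_last i)).trans_eq T.node_last

theorem node_mem (i : Fin (T.N + 1)) : T.node i ∈ Set.Icc 0 L := ⟨T.node_nonneg i, T.node_le i⟩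

theorem length_nonneg (T : Mesh L) : 0 ≤ L := (T.node_nonneg 0).trans (T.node_le 0)

theorem lft_mem (j : Fin T.N) : T.lft j ∈ Set.Icc 0 L := T.node_mem _

theorem rgt_mem (j : Fin T.N) : T.rgt j ∈ Set.Icc 0 L := T.node_mem _

theorem mem_of_mem_element {j : Fin T.N} {x : ℝ} (hx : x ∈ Set.Icc (T.lft j) (T.rgt j)) :
    x ∈ Set.Icc 0 L := ⟨(T.lft_mem j).1.trans hx.1, hx.2.trans (T.rgt_mem j).2⟩

theorem len_le_meshSize (j : Fin T.N) : T.len j ≤ T.meshSize :=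
  le_ciSup (Set.finite_range _).bddAbove j

/-- Elements are used as half-open intervals: together with `element_unique` they partition (0, L]
exactly, so piecewise definitions are unambiguous at the nodes. -/
theorem exists_mem_element {x : ℝ} (hx : x ∈ Set.Ioc 0 L) :
    ∃ j : Fin T.N, x ∈ Set.Ioc (T.lft j) (T.rgt j) := by
  have key : ∀ i : Fin (T.N + 1), x ≤ T.node i →
      ∃ j : Fin T.N, x ∈ Set.Ioc (T.lft j) (T.rgt j) := by
    intro i
    induction i using Fin.induction with
    | zero => intro h; rw [T.node_zero] at h; exact absurd hx.1 (not_lt.2 h)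
    | succ i ih =>
      intro h
      by_cases h' : x ≤ T.node i.castSucc
      · exact ih h'
      · exact ⟨i, not_le.1 h', h⟩
  exact key (Fin.last _) (by rw [T.node_last]; exact hx.2)

theorem element_unique {x : ℝ} {i j : Fin T.N} (hi : x ∈ Set.Ioc (T.lft i) (T.rgt i))
    (hj : x ∈ Set.Ioc (T.lft j) (T.rgt j)) : i = j := by
  have key : ∀ {i j : Fin T.N}, x ∈ Set.Ioc (T.lft i) (T.rgt i) →
      x ∈ Set.Ioc (T.lft j) (T.rgt j) → ¬ i < j := by
    intro i j hi hj hij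
    have : T.rgt i ≤ T.lft j := T.strictMono.monotone (by
      rw [Fin.le_def]; simpa using hij)
    exact absurd (hi.2.trans this) (not_le.2 hj.1)
  exact le_antisymm (not_lt.1 (key hj hi)) (not_lt.1 (key hi hj))

variable {G : Type*} [NormedAddCommGroup G]

theorem sum_integral [NormedSpace ℝ G] {f : ℝ → G} (hf : Integrable f (mu L)) :
    ∑ j : Fin T.N, ∫ x in (T.lft j)..(T.rgt j), f x = ∫ x, f x ∂(mu L) := by
  -- The nodes as a sequence indexed by ℕ, frozen at the last node, so that the telescoping sum of
  -- integrals applies.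
  let a : ℕ → ℝ := fun k => T.node ⟨min k T.N, by omega⟩
  have ha : ∀ k, a k ∈ Set.Icc 0 L := fun k => T.node_mem _
  have h := intervalIntegral.sum_integral_adjacent_intervals (f := f) (μ := volume) (a := a)
    (n := T.N) (fun k _ => intervalIntegrable_of_integrable_mu hf (ha k) (ha (k + 1)))
  have h0 : a 0 = 0 := by
    rw [← T.node_zero]; simp only [a]; congr 1
  have hN : a T.N = L := by
    refine Eq.trans ?_ T.node_last; simp only [a]; congr 1; ext; simp
  rw [Finset.sum_range, h0, hN, intervalIntegral.integral_of_le T.length_nonneg] at h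
  rw [mu, ← h]
  refine Finset.sum_congr rfl fun j _ => ?_
  have hl : T.lft j = a j := by
    simp only [a, lft]; congr 1; ext; simp
  have hr : T.rgt j = a (j + 1) := by
    simp only [a, rgt]; congr 1; ext; simp
  rw [hl, hr]

/-- The function that coincides with `f j` on the element `j`. -/
def glue (f : Fin T.N → ℝ → G) (x : ℝ) : G :=
  ∑ j : Fin T.N, (Set.Ioc (T.lft j) (T.rgt j)).indicator (f j) x

theorem glue_eq (f : Fin T.N → ℝ → G) {j : Fin T.N} {x : ℝ}
    (hx : x ∈ Set.Ioc (T.lft j) (T.rgt j)) : T.glue f x = f j x := by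
  rw [glue, Finset.sum_eq_single j, Set.indicator_of_mem hx]
  · intro i _ hij
    exact Set.indicator_of_notMem (fun hi => hij (T.element_unique hi hx)) _
  · simp

theorem memLp_glue {p : ℝ≥0∞} {f : Fin T.N → ℝ → G} (hf : ∀ j, MemLp (f j) p (mu L)) :
    MemLp (T.glue f) p (mu L) :=
  memLp_finsetSum _ fun j _ => (hf j).indicator measurableSet_Ioc

theorem integral_element_congr [NormedSpace ℝ G] {f g : ℝ → G} {j : Fin T.N} {b : ℝ}
    (hb : b ∈ Set.Icc (T.lft j) (T.rgt j))
    (h : ∀ x ∈ Set.Ioc (T.lft j) (T.rgt j), f x = g x) :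
    ∫ x in (T.lft j)..b, f x = ∫ x in (T.lft j)..b, g x := by
  refine intervalIntegral.integral_congr_ae (ae_of_all _ fun x hx => ?_)
  rw [Set.uIoc_of_le hb.1] at hx
  exact h x ⟨hx.1, hx.2.trans hb.2⟩

theorem sum_integral_eq [NormedSpace ℝ G] {f : ℝ → G} (hf : Integrable f (mu L))
    {g : Fin T.N → ℝ → G} (h : ∀ j, ∀ x ∈ Set.Ioc (T.lft j) (T.rgt j), f x = g j x) :
    ∑ j : Fin T.N, ∫ x in (T.lft j)..(T.rgt j), g j x = ∫ x, f x ∂(mu L) := by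
  rw [← T.sum_integral hf]
  exact Finset.sum_congr rfl fun j _ =>
    (T.integral_element_congr ⟨(T.lft_lt_rgt j).le, le_rfl⟩ (h j)).symm

theorem integral_element_mono {f g : ℝ → ℝ} (hf : Integrable f (mu L)) (hg : Integrable g (mu L))
    (j : Fin T.N) (h : ∀ x ∈ Set.Ioc (T.lft j) (T.rgt j), f x ≤ g x) :
    ∫ x in (T.lft j)..(T.rgt j), f x ≤ ∫ x in (T.lft j)..(T.rgt j), g x := by
  rw [intervalIntegral.integral_of_le (T.lft_lt_rgt j).le,
    intervalIntegral.integral_of_le (T.lft_lt_rgt j).le]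
  exact setIntegral_mono_on (integrableOn_of_integrable_mu hf (T.lft_mem j).1 (T.rgt_mem j).2)
    (integrableOn_of_integrable_mu hg (T.lft_mem j).1 (T.rgt_mem j).2) measurableSet_Ioc h

theorem intervalIntegrable_element {f : ℝ → G} (hf : Integrable f (mu L)) (j : Fin T.N) :
    IntervalIntegrable f volume (T.lft j) (T.rgt j) :=
  intervalIntegrable_of_integrable_mu hf (T.lft_mem j) (T.rgt_mem j)

/-! ### Element averages -/

/-- The piecewise constant function of the element averages. -/
def avgFun (f : ℝ → E3) : ℝ → E3 := T.glue fun j _ => T.avg f j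

theorem memLp_avgFun (f : ℝ → E3) : MemLp (T.avgFun f) 2 (mu L) :=
  T.memLp_glue fun _ => memLp_const _

theorem avgFun_eq (f : ℝ → E3) {j : Fin T.N} {x : ℝ}
    (hx : x ∈ Set.Ioc (T.lft j) (T.rgt j)) : T.avgFun f x = T.avg f j := T.glue_eq _ hx

theorem integral_element (f : ℝ → E3) (j : Fin T.N) :
    ∫ x in (T.lft j)..(T.rgt j), f x = T.len j • T.avg f j := by
  rw [avg, smul_inv_smul₀ (T.len_pos j).ne']

/-- Pythagoras: on an element f minus its average is L²-orthogonal to constants. Best approximation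
by the average and Jensen's inequality are read off from this identity. -/
theorem integral_norm_sub_avg {f : ℝ → E3} (hf : MemLp f 2 (mu L)) (j : Fin T.N) (c : E3) :
    ∫ x in (T.lft j)..(T.rgt j), ‖f x - c‖ ^ 2 =
      (∫ x in (T.lft j)..(T.rgt j), ‖f x - T.avg f j‖ ^ 2)
        + T.len j * ‖T.avg f j - c‖ ^ 2 := by
  have h := integral_norm_sub_const_sq (T.intervalIntegrable_element (memLp_integrable hf) j)
    (T.intervalIntegrable_element (memLp_integrable_sq hf) j)
  rw [h, h, T.integral_element, norm_sub_sq_real, inner_smul_left, inner_smul_left,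
    real_inner_self_eq_norm_sq]
  simp only [RCLike.conj_to_real, len]
  ring

theorem integral_norm_sq_element {f : ℝ → E3} (hf : MemLp f 2 (mu L)) (j : Fin T.N) :
    ∫ x in (T.lft j)..(T.rgt j), ‖f x‖ ^ 2 =
      (∫ x in (T.lft j)..(T.rgt j), ‖f x - T.avg f j‖ ^ 2) + T.len j * ‖T.avg f j‖ ^ 2 := by
  simpa using T.integral_norm_sub_avg hf j 0

theorem integral_norm_avg_le {f : ℝ → E3} (hf : MemLp f 2 (mu L)) (j : Fin T.N) :
    T.len j * ‖T.avg f j‖ ^ 2 ≤ ∫ x in (T.lft j)..(T.rgt j), ‖f x‖ ^ 2 := by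
  rw [T.integral_norm_sq_element hf]
  exact le_add_of_nonneg_left
    (intervalIntegral.integral_nonneg (T.lft_lt_rgt j).le fun x _ => sq_nonneg _)

theorem integral_sub_avg_le {f : ℝ → E3} (hf : MemLp f 2 (mu L)) (j : Fin T.N) (c : E3) :
    ∫ x in (T.lft j)..(T.rgt j), ‖f x - T.avg f j‖ ^ 2 ≤
      ∫ x in (T.lft j)..(T.rgt j), ‖f x - c‖ ^ 2 := by
  rw [T.integral_norm_sub_avg hf j c]
  exact le_add_of_nonneg_right (mul_nonneg (T.len_pos j).le (sq_nonneg _))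

theorem sum_integral_sub_avg {f : ℝ → E3} (hf : MemLp f 2 (mu L)) :
    ∑ j : Fin T.N, ∫ x in (T.lft j)..(T.rgt j), ‖f x - T.avg f j‖ ^ 2 =
      ∫ x, ‖f x - T.avgFun f x‖ ^ 2 ∂(mu L) :=
  T.sum_integral_eq (memLp_integrable_sq (hf.sub (T.memLp_avgFun f)))
    fun j x hx => by simp only [Pi.sub_apply, T.avgFun_eq f hx]

theorem integral_norm_avgFun_sq (f : ℝ → E3) :
    ∫ x, ‖T.avgFun f x‖ ^ 2 ∂(mu L) = ∑ j : Fin T.N, T.len j * ‖T.avg f j‖ ^ 2 := by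
  rw [← T.sum_integral_eq (g := fun j _ => ‖T.avg f j‖ ^ 2)
    (memLp_integrable_sq (T.memLp_avgFun f)) fun j x hx => by rw [T.avgFun_eq f hx]]
  simp [len]

/-- In the lower bound this makes ½ ∫ (|y''|² - |𝒜_h y''|²) a nonnegative surplus that can be
dropped. -/
theorem integral_norm_avgFun_sq_le {f : ℝ → E3} (hf : MemLp f 2 (mu L)) :
    ∫ x, ‖T.avgFun f x‖ ^ 2 ∂(mu L) ≤ ∫ x, ‖f x‖ ^ 2 ∂(mu L) := by
  rw [T.integral_norm_avgFun_sq, ← T.sum_integral (memLp_integrable_sq hf)]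
  exact Finset.sum_le_sum fun j _ => T.integral_norm_avg_le hf j

/-- Averaging is symmetric. -/
theorem integral_inner_avgFun {f g : ℝ → E3} (hf : MemLp f 2 (mu L)) (hg : MemLp g 2 (mu L)) :
    ∫ x, ⟪T.avgFun f x, g x⟫ ∂(mu L) = ∫ x, ⟪f x, T.avgFun g x⟫ ∂(mu L) := by
  rw [← T.sum_integral_eq (g := fun j x => ⟪T.avg f j, g x⟫)
      (memLp_inner_integrable (T.memLp_avgFun f) hg) fun j x hx => by rw [T.avgFun_eq f hx],
    ← T.sum_integral_eq (g := fun j x => ⟪f x, T.avg g j⟫)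
      (memLp_inner_integrable hf (T.memLp_avgFun g)) fun j x hx => by rw [T.avgFun_eq g hx]]
  refine Finset.sum_congr rfl fun j _ => ?_
  have h1 := (innerSL ℝ (T.avg f j)).intervalIntegral_comp_comm
    (T.intervalIntegrable_element (memLp_integrable hg) j)
  have h2 := (innerSL ℝ (T.avg g j)).intervalIntegral_comp_comm
    (T.intervalIntegrable_element (memLp_integrable hf) j)
  simp only [innerSL_apply_apply] at h1 h2
  simp_rw [real_inner_comm (T.avg g j)]
  rw [h1, h2, T.integral_element, T.integral_element, inner_smul_right, inner_smul_right,
    real_inner_comm]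

end Mesh

/-- The element averages of an `L²` function converge in `L²`. -/
theorem tendsto_integral_sub_avgFun {L : ℝ} {T : ℕ → Mesh L} {h : ℕ → ℝ}
    (hT : ∀ n j, (T n).len j ≤ h n) (hh : Tendsto h atTop (𝓝 0))
    {f : ℝ → E3} (hf : MemLp f 2 (mu L)) :
    Tendsto (fun n => ∫ x, ‖f x - (T n).avgFun f x‖ ^ 2 ∂(mu L)) atTop (𝓝 0) := by
  rw [Metric.tendsto_atTop]
  intro ε hε
  have hL : 0 ≤ L := (T 0).length_nonneg
  -- Density of compactly supported continuous functions. The budget is 2 · ε/8 for the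
  -- approximation and 2 η² L ≤ ε/4 for the oscillation of φ on elements, in total ε/2.
  obtain ⟨φ, hφs, hφ, hφc, hφL⟩ := MemLp.exists_hasCompactSupport_integral_rpow_sub_le
    (p := 2) (μ := mu L) (by norm_num) (f := f) (by simpa using hf) (ε := ε / 8) (by positivity)
  have hφL : MemLp φ 2 (mu L) := by simpa using hφL
  have hφ : ∫ x, ‖f x - φ x‖ ^ 2 ∂(mu L) ≤ ε / 8 := by simpa using hφ
  have hφu := hφs.uniformContinuous_of_continuous hφc
  obtain ⟨η, hη, hηe⟩ : ∃ η : ℝ, 0 < η ∧ 2 * (η ^ 2 * L) ≤ ε / 4 := by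
    refine ⟨√(ε / (8 * (L + 1))), by positivity, ?_⟩
    rw [Real.sq_sqrt (by positivity), div_mul_eq_mul_div, ← mul_div_assoc, div_le_iff₀ (by positivity)]
    nlinarith
  obtain ⟨r, hr, hrφ⟩ := Metric.uniformContinuous_iff.1 hφu η hη
  obtain ⟨N, hN⟩ := Metric.tendsto_atTop.1 hh r hr
  refine ⟨N, fun n hn => ?_⟩
  have hlt : h n < r := lt_of_abs_lt (by simpa using hN n hn)
  have hi0 : Integrable (fun x => 2 * ‖f x - φ x‖ ^ 2) (mu L) :=
    (memLp_integrable_sq (hf.sub hφL)).const_mul 2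
  have hi : Integrable (fun x => 2 * ‖f x - φ x‖ ^ 2 + 2 * η ^ 2) (mu L) :=
    hi0.add (integrable_const _)
  have key : ∫ x, ‖f x - (T n).avgFun f x‖ ^ 2 ∂(mu L) ≤
      ∫ x, (2 * ‖f x - φ x‖ ^ 2 + 2 * η ^ 2) ∂(mu L) := by
    rw [← (T n).sum_integral_sub_avg hf, ← (T n).sum_integral hi]
    refine Finset.sum_le_sum fun j _ => ?_
    -- The average is the best constant on the element, so it may be replaced by the value of φ at
    -- the left end point.
    refine ((T n).integral_sub_avg_le hf j (φ ((T n).lft j))).trans ?_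
    refine (T n).integral_element_mono (memLp_integrable_sq (hf.sub (memLp_const _))) hi j ?_
    intro x hx
    have hd : ‖φ x - φ ((T n).lft j)‖ ≤ η := by
      rw [← dist_eq_norm]
      refine (hrφ ?_).le
      rw [Real.dist_eq, abs_of_pos (sub_pos.2 hx.1)]
      have := hT n j
      unfold Mesh.len at this
      linarith [hx.2]
    have ht : ‖f x - φ ((T n).lft j)‖ ≤ ‖f x - φ x‖ + ‖φ x - φ ((T n).lft j)‖ :=
      norm_sub_le_norm_sub_add_norm_sub _ _ _
    change ‖f x - φ ((T n).lft j)‖ ^ 2 ≤ 2 * ‖f x - φ x‖ ^ 2 + 2 * η ^ 2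
    nlinarith [norm_nonneg (f x - φ ((T n).lft j)), norm_nonneg (f x - φ x),
      norm_nonneg (φ x - φ ((T n).lft j)), sq_nonneg (‖f x - φ x‖ - η)]
  have hc : ∫ x, (2 * ‖f x - φ x‖ ^ 2 + 2 * η ^ 2) ∂(mu L) =
      2 * ∫ x, ‖f x - φ x‖ ^ 2 ∂(mu L) + 2 * (η ^ 2 * L) := by
    rw [integral_add hi0 (integrable_const _),
      integral_const_mul, integral_const]
    simp [mu, hL]
    ring
  rw [Real.dist_eq, sub_zero, abs_of_nonneg (integral_nonneg fun x => sq_nonneg _)]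
  linarith

/-! ### Nodal interpolation -/

namespace Mesh

variable {L : ℝ} (T : Mesh L)

theorem integral_zero_eq_add {g : ℝ → E3} (hg : Integrable g (mu L)) (j : Fin T.N) {x : ℝ}
    (hx : x ∈ Set.Icc (T.lft j) (T.rgt j)) :
    ∫ t in (0 : ℝ)..x, g t = (∫ t in (0 : ℝ)..(T.lft j), g t) + ∫ t in (T.lft j)..x, g t := by
  have h0 : (0 : ℝ) ∈ Set.Icc 0 L := ⟨le_rfl, T.length_nonneg⟩
  exact (intervalIntegral.integral_add_adjacent_intervals
    (intervalIntegrable_of_integrable_mu hg h0 (T.lft_mem j))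
    (intervalIntegrable_of_integrable_mu hg (T.lft_mem j) (T.mem_of_mem_element hx))).symm

/-- A primitive interpolates `u` at the nodes if the increments over the elements agree. -/
theorem primitive_node_eq {g : ℝ → E3} (hg : Integrable g (mu L)) {u : ℝ → E3}
    (h : ∀ j, ∫ t in (T.lft j)..(T.rgt j), g t = u (T.rgt j) - u (T.lft j))
    (i : Fin (T.N + 1)) : u 0 + ∫ t in (0 : ℝ)..(T.node i), g t = u (T.node i) := by
  induction i using Fin.induction with
  | zero => simp [T.node_zero]
  | succ i ih =>
    have hj := h i
    change u 0 + ∫ t in (0 : ℝ)..(T.rgt i), g t = u (T.rgt i)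
    change u 0 + ∫ t in (0 : ℝ)..(T.lft i), g t = u (T.lft i) at ih
    rw [T.integral_zero_eq_add hg i ⟨(T.lft_lt_rgt i).le, le_rfl⟩, hj, ← add_assoc, ih]
    abel

/-- The piecewise linear nodal interpolant. -/
def linInterp (b : ℝ → E3) (x : ℝ) : E3 := b 0 + ∫ t in (0 : ℝ)..x, T.avgFun (D L b) t

theorem memH1_linInterp (hL : 0 < L) (b : ℝ → E3) :
    MemH1 L (T.linInterp b) ∧ D L (T.linInterp b) =ᵐ[mu L] T.avgFun (D L b) :=
  memH1_of_primitive (T.memLp_avgFun _) hL (b 0) fun _ _ => rfl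

theorem linInterp_node {b : ℝ → E3} (hb : MemH1 L b) (i : Fin (T.N + 1)) :
    T.linInterp b (T.node i) = b (T.node i) := by
  refine T.primitive_node_eq (memLp_integrable (T.memLp_avgFun _)) (fun j => ?_) i
  rw [hb.sub_eq_integral (T.lft_mem j) (T.rgt_mem j), T.integral_element (D L b),
    T.integral_element_congr ⟨(T.lft_lt_rgt j).le, le_rfl⟩ (fun x hx => T.avgFun_eq _ hx)]
  simp [len]

theorem linInterp_eq {b : ℝ → E3} (hb : MemH1 L b) (j : Fin T.N) {x : ℝ}
    (hx : x ∈ Set.Icc (T.lft j) (T.rgt j)) :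
    T.linInterp b x = b (T.lft j) + (x - T.lft j) • T.avg (D L b) j := by
  have hn : T.linInterp b (T.lft j) = b (T.lft j) := T.linInterp_node hb _
  rw [linInterp] at hn ⊢
  rw [T.integral_zero_eq_add (memLp_integrable (T.memLp_avgFun _)) j hx, ← add_assoc, hn,
    T.integral_element_congr hx (fun x hx => T.avgFun_eq _ hx)]
  simp

theorem isSpline_linInterp (hL : 0 < L) {b : ℝ → E3} (hb : MemH1 L b) :
    T.IsSpline 1 0 (T.linInterp b) := by
  refine ⟨?_, fun j => ?_⟩
  · rw [Nat.cast_zero, contDiffOn_zero]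
    exact (T.memH1_linInterp hL b).1.continuousOn hL
  · refine ⟨![b (T.lft j) - T.lft j • T.avg (D L b) j, T.avg (D L b) j], fun x hx => ?_⟩
    rw [T.linInterp_eq hb j hx]
    refine Eq.trans ?_ (Fin.sum_univ_two (M := E3) _).symm
    change _ = x ^ 0 • (b (T.lft j) - T.lft j • T.avg (D L b) j) + x ^ 1 • T.avg (D L b) j
    module

/-- Coefficient of the linear part of the second derivative of the Hermite interpolant. -/
def hermSlope (y : ℝ → E3) (j : Fin T.N) : E3 :=
  -- The slope multiplies the bubble (x - lft)(x - rgt)/2 in the derivative of the interpolant. This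
  -- bubble has integral -len³/12 over the element, so the factor makes the increment of the
  -- interpolant equal to that of y.
  (-(12 / T.len j ^ 3)) • ∫ x in (T.lft j)..(T.rgt j),
    (D L y x - D L y (T.lft j) - (x - T.lft j) • T.avg (D L (D L y)) j)

/-- The second derivative of the Hermite interpolant. -/
def hermSnd (y : ℝ → E3) : ℝ → E3 := T.glue fun j x =>
  -- The linear part is centred at the midpoint and has mean zero. Hence interpolation preserves the
  -- element averages of y'', which are the arguments of ψ_δ in the discrete energy.
  T.avg (D L (D L y)) j + (x - (T.lft j + T.rgt j) / 2) • T.hermSlope y j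

/-- The piecewise cubic Hermite interpolant. -/
def hermite (y : ℝ → E3) (x : ℝ) : E3 :=
  y 0 + ∫ s in (0 : ℝ)..x, (D L y 0 + ∫ t in (0 : ℝ)..s, T.hermSnd y t)

theorem memLp_hermSnd (y : ℝ → E3) : MemLp (T.hermSnd y) 2 (mu L) :=
  T.memLp_glue fun _ => memLp_of_continuousOn (by fun_prop)

theorem memH2_hermite (hL : 0 < L) (y : ℝ → E3) :
    MemH2 L (T.hermite y) ∧
      (∀ x ∈ Set.Icc 0 L, D L (T.hermite y) x = D L y 0 + ∫ t in (0 : ℝ)..x, T.hermSnd y t) ∧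
      D L (D L (T.hermite y)) =ᵐ[mu L] T.hermSnd y :=
  memH2_of_primitive (T.memLp_hermSnd y) hL (y 0) (D L y 0) fun _ _ => rfl

theorem integral_hermSnd (y : ℝ → E3) (j : Fin T.N) {x : ℝ}
    (hx : x ∈ Set.Icc (T.lft j) (T.rgt j)) :
    ∫ t in (T.lft j)..x, T.hermSnd y t = (x - T.lft j) • T.avg (D L (D L y)) j
      + ((x - T.lft j) * (x - T.rgt j) / 2) • T.hermSlope y j := by
  rw [hermSnd, T.integral_element_congr hx (fun x hx => T.glue_eq _ hx),
    intervalIntegral.integral_add (by simp) (Continuous.intervalIntegrable (by fun_prop) _ _),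
    intervalIntegral.integral_smul_const, intervalIntegral.integral_sub (by simp) (by simp)]
  simp only [intervalIntegral.integral_const, integral_id, smul_eq_mul]
  congr 2
  ring

/-- The mean-zero part of the second derivative contributes a bubble that vanishes at both ends of
the element, so only the average of y'' enters the increment of the derivative. -/
theorem D_hermite_node (hL : 0 < L) {y : ℝ → E3} (hy : MemH2 L y) (i : Fin (T.N + 1)) :
    D L (T.hermite y) (T.node i) = D L y (T.node i) := by
  rw [(T.memH2_hermite hL y).2.1 _ (T.node_mem i)]
  refine T.primitive_node_eq (u := D L y) (memLp_integrable (T.memLp_hermSnd y)) (fun j => ?_) i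
  rw [hy.2.sub_eq_integral (T.lft_mem j) (T.rgt_mem j), T.integral_element (D L (D L y)),
    T.integral_hermSnd y j ⟨(T.lft_lt_rgt j).le, le_rfl⟩]
  simp [len]

theorem D_hermite_eq (hL : 0 < L) {y : ℝ → E3} (hy : MemH2 L y) (j : Fin T.N) {x : ℝ}
    (hx : x ∈ Set.Icc (T.lft j) (T.rgt j)) :
    D L (T.hermite y) x = D L y (T.lft j) + (x - T.lft j) • T.avg (D L (D L y)) j
      + ((x - T.lft j) * (x - T.rgt j) / 2) • T.hermSlope y j := by
  have hn : D L (T.hermite y) (T.lft j) = D L y (T.lft j) := T.D_hermite_node hL hy _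
  rw [(T.memH2_hermite hL y).2.1 _ (T.lft_mem j)] at hn
  rw [(T.memH2_hermite hL y).2.1 _ (T.mem_of_mem_element hx),
    T.integral_zero_eq_add (memLp_integrable (T.memLp_hermSnd y)) j hx, ← add_assoc, hn,
    T.integral_hermSnd y j hx, add_assoc]

theorem integral_D_hermite (hL : 0 < L) {y : ℝ → E3} (hy : MemH2 L y) (j : Fin T.N) {x : ℝ}
    (hx : x ∈ Set.Icc (T.lft j) (T.rgt j)) :
    ∫ s in (T.lft j)..x, D L (T.hermite y) s = (x - T.lft j) • D L y (T.lft j)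
      + ((x - T.lft j) ^ 2 / 2) • T.avg (D L (D L y)) j
      + ((x - T.lft j) ^ 3 / 6 - T.len j * (x - T.lft j) ^ 2 / 4) • T.hermSlope y j := by
  rw [T.integral_element_congr hx
    (fun x hx => T.D_hermite_eq hL hy j (Set.Ioc_subset_Icc_self hx))]
  have hd : ∀ s : ℝ, HasDerivAt (fun s : ℝ => (s - T.lft j) • D L y (T.lft j)
      + ((s - T.lft j) ^ 2 / 2) • T.avg (D L (D L y)) j
      + ((s - T.lft j) ^ 3 / 6 - T.len j * (s - T.lft j) ^ 2 / 4) • T.hermSlope y j)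
      (D L y (T.lft j) + (s - T.lft j) • T.avg (D L (D L y)) j
      + ((s - T.lft j) * (s - T.rgt j) / 2) • T.hermSlope y j) s := by
    intro s
    have h1 : HasDerivAt (fun s : ℝ => s - T.lft j) 1 s := (hasDerivAt_id s).sub_const _
    refine HasDerivAt.congr_deriv (((h1.smul_const (D L y (T.lft j))).add
      (((h1.pow 2).div_const 2).smul_const (T.avg (D L (D L y)) j))).add
      ((((h1.pow 3).div_const 6).sub (((h1.pow 2).const_mul (T.len j)).div_const 4)).smul_const
        (T.hermSlope y j))) ?_
    simp only [len, Nat.cast_ofNat]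
    norm_num
    module
  rw [intervalIntegral.integral_eq_sub_of_hasDerivAt (fun s _ => hd s)
    (Continuous.intervalIntegrable (by fun_prop) _ _)]
  simp

theorem hermite_node (hL : 0 < L) {y : ℝ → E3} (hy : MemH2 L y) (i : Fin (T.N + 1)) :
    T.hermite y (T.node i) = y (T.node i) := by
  have hz := T.memH2_hermite hL y
  have h0 : T.hermite y 0 = y 0 := by simp [hermite]
  rw [hz.1.1.2 _ (T.node_mem i), h0]
  refine T.primitive_node_eq (memLp_integrable hz.1.1.1) (fun j => ?_) i
  have hlen := (T.len_pos j).ne'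
  have hD : IntervalIntegrable (D L y) volume (T.lft j) (T.rgt j) :=
    T.intervalIntegrable_element (memLp_integrable hy.1.1) j
  have hI : ∫ x in (T.lft j)..(T.rgt j),
      (D L y x - D L y (T.lft j) - (x - T.lft j) • T.avg (D L (D L y)) j) =
      (y (T.rgt j) - y (T.lft j)) - T.len j • D L y (T.lft j)
        - (T.len j ^ 2 / 2) • T.avg (D L (D L y)) j := by
    rw [intervalIntegral.integral_sub (hD.sub (by simp))
      (Continuous.intervalIntegrable (by fun_prop) _ _), intervalIntegral.integral_sub hD (by simp),
      intervalIntegral.integral_smul_const, intervalIntegral.integral_sub (by simp) (by simp),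
      ← hy.1.sub_eq_integral (T.lft_mem j) (T.rgt_mem j)]
    simp only [intervalIntegral.integral_const, integral_id, smul_eq_mul]
    congr 2
    simp only [len]
    ring
  rw [T.integral_D_hermite hL hy j ⟨(T.lft_lt_rgt j).le, le_rfl⟩, hermSlope, hI, smul_smul]
  change T.len j • _ + (T.len j ^ 2 / 2) • _ + ((T.len j ^ 3 / 6 - T.len j * T.len j ^ 2 / 4) * _) • _ = _
  -- At the right end point the cubic bubble equals (1/6 - 1/4) len³ = -len³/12, which the
  -- normalization in `hermSlope` cancels.
  have : (T.len j ^ 3 / 6 - T.len j * T.len j ^ 2 / 4) * -(12 / T.len j ^ 3) = 1 := by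
    field_simp; norm_num
  rw [this]
  module

theorem hermite_eq (hL : 0 < L) {y : ℝ → E3} (hy : MemH2 L y) (j : Fin T.N) {x : ℝ}
    (hx : x ∈ Set.Icc (T.lft j) (T.rgt j)) :
    T.hermite y x = y (T.lft j) + (x - T.lft j) • D L y (T.lft j)
      + ((x - T.lft j) ^ 2 / 2) • T.avg (D L (D L y)) j
      + ((x - T.lft j) ^ 3 / 6 - T.len j * (x - T.lft j) ^ 2 / 4) • T.hermSlope y j := by
  have hn : T.hermite y (T.lft j) = y (T.lft j) := T.hermite_node hL hy _
  have h := (T.memH2_hermite hL y).1.1.sub_eq_integral (T.lft_mem j) (T.mem_of_mem_element hx)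
  rw [T.integral_D_hermite hL hy j hx, hn] at h
  rw [eq_add_of_sub_eq' h]
  module

theorem isSpline_hermite (hL : 0 < L) {y : ℝ → E3} (hy : MemH2 L y) :
    T.IsSpline 3 1 (T.hermite y) := by
  have hz := (T.memH2_hermite hL y).1
  refine ⟨?_, fun j => ?_⟩
  · rw [Nat.cast_one, contDiffOn_one_iff_derivWithin (uniqueDiffOn_Icc hL)]
    exact ⟨fun x hx => (hz.hasDerivWithinAt hL hx).differentiableWithinAt, hz.2.continuousOn hL⟩
  · set a := T.lft j
    set l := T.len j
    set p := D L y a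
    set q := T.avg (D L (D L y)) j
    set d := T.hermSlope y j
    -- The coefficients result from expanding the local formula `hermite_eq` in powers of x instead
    -- of x - a.
    refine ⟨![y a - a • p + (a ^ 2 / 2) • q + (-(a ^ 3 / 6) - l * a ^ 2 / 4) • d,
      p - a • q + (a ^ 2 / 2 + l * a / 2) • d, (1 / 2 : ℝ) • q + (-(a / 2) - l / 4) • d,
      (1 / 6 : ℝ) • d], fun x hx => ?_⟩
    rw [T.hermite_eq hL hy j hx]
    refine Eq.trans ?_ (Fin.sum_univ_four (M := E3) _).symm
    change y a + (x - a) • p + ((x - a) ^ 2 / 2) • q + ((x - a) ^ 3 / 6 - l * (x - a) ^ 2 / 4) • d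
      = x ^ 0 • (y a - a • p + (a ^ 2 / 2) • q + (-(a ^ 3 / 6) - l * a ^ 2 / 4) • d)
        + x ^ 1 • (p - a • q + (a ^ 2 / 2 + l * a / 2) • d)
        + x ^ 2 • ((1 / 2 : ℝ) • q + (-(a / 2) - l / 4) • d) + x ^ 3 • ((1 / 6 : ℝ) • d)
    module

theorem avg_hermSnd (y : ℝ → E3) (j : Fin T.N) :
    T.avg (T.hermSnd y) j = T.avg (D L (D L y)) j := by
  rw [avg, T.integral_hermSnd y j ⟨(T.lft_lt_rgt j).le, le_rfl⟩]
  simp [len, inv_smul_smul₀ (sub_pos.2 (T.lft_lt_rgt j)).ne']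

/-- The integrand defining the slope is the primitive of y'' minus its average, hence bounded by
(len · S)^{1/2}, where S is the integral of the squared deviation of y'' from its average. Its
integral has square at most len³ S, and the squared prefactor is 144/len⁶. -/
theorem norm_hermSlope_sq_le {y : ℝ → E3} (hy : MemH2 L y) (j : Fin T.N) :
    T.len j ^ 3 * ‖T.hermSlope y j‖ ^ 2 ≤
      144 * ∫ x in (T.lft j)..(T.rgt j), ‖D L (D L y) x - T.avg (D L (D L y)) j‖ ^ 2 := by
  set c := T.avg (D L (D L y)) j
  set l := T.len j with hl
  have hlp : 0 < l := T.len_pos j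
  set S := ∫ x in (T.lft j)..(T.rgt j), ‖D L (D L y) x - c‖ ^ 2
  have hS : 0 ≤ S := intervalIntegral.integral_nonneg (T.lft_lt_rgt j).le fun x _ => sq_nonneg _
  have hm : MemLp (fun x => D L (D L y) x - c) 2 (mu L) := hy.2.1.sub (memLp_const c)
  have hpt : ∀ x ∈ Set.Ioc (T.lft j) (T.rgt j),
      ‖D L y x - D L y (T.lft j) - (x - T.lft j) • c‖ ≤ √(l * S) := by
    intro x hx
    have hx' := T.mem_of_mem_element (Set.Ioc_subset_Icc_self hx)
    have he : D L y x - D L y (T.lft j) - (x - T.lft j) • c =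
        ∫ t in (T.lft j)..x, (D L (D L y) t - c) := by
      rw [intervalIntegral.integral_sub (intervalIntegrable_of_integrable_mu
        (memLp_integrable hy.2.1) (T.lft_mem j) hx') (by simp),
        ← hy.2.sub_eq_integral (T.lft_mem j) hx']
      simp
    rw [he]
    refine Real.le_sqrt_of_sq_le ((norm_integral_sq_le hm (T.lft_mem j).1 hx.1.le hx'.2).trans ?_)
    have h1 : ∫ t in (T.lft j)..x, ‖D L (D L y) t - c‖ ^ 2 ≤ S :=
      intervalIntegral.integral_mono_interval le_rfl hx.1.le hx.2 (ae_of_all _ fun t => sq_nonneg _)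
        (T.intervalIntegrable_element (memLp_integrable_sq hm) j)
    have h2 : x - T.lft j ≤ l := by rw [hl, len]; linarith [hx.2]
    exact mul_le_mul h2 h1
      (intervalIntegral.integral_nonneg hx.1.le fun x _ => sq_nonneg _) hlp.le
  have hI := intervalIntegral.norm_integral_le_of_norm_le_const (a := T.lft j) (b := T.rgt j)
    (C := √(l * S)) (f := fun x => D L y x - D L y (T.lft j) - (x - T.lft j) • c)
    (by rwa [Set.uIoc_of_le (T.lft_lt_rgt j).le])
  rw [abs_of_pos (sub_pos.2 (T.lft_lt_rgt j))] at hI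
  change _ ≤ √(l * S) * l at hI
  have hI2 := pow_le_pow_left₀ (norm_nonneg _) hI 2
  rw [mul_pow, Real.sq_sqrt (by positivity)] at hI2
  rw [hermSlope, norm_smul, mul_pow, norm_neg, Real.norm_of_nonneg (by positivity), div_pow]
  calc l ^ 3 * (12 ^ 2 / (l ^ 3) ^ 2 * _) ≤ l ^ 3 * (12 ^ 2 / (l ^ 3) ^ 2 * (l * S * l ^ 2)) := by
        gcongr
    _ = 144 * S := by field_simp; ring

/-- The distance of the second derivative of the Hermite interpolant to the element averages. -/
theorem integral_hermSnd_sub_avg_le {y : ℝ → E3} (hy : MemH2 L y) :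
    ∫ x, ‖T.hermSnd y x - T.avgFun (D L (D L y)) x‖ ^ 2 ∂(mu L) ≤
      144 * ∫ x, ‖D L (D L y) x - T.avgFun (D L (D L y)) x‖ ^ 2 ∂(mu L) := by
  rw [← T.sum_integral_sub_avg hy.2.1, Finset.mul_sum,
    ← T.sum_integral (f := fun x => ‖T.hermSnd y x - T.avgFun (D L (D L y)) x‖ ^ 2)
      (memLp_integrable_sq ((T.memLp_hermSnd y).sub (T.memLp_avgFun _)))]
  refine Finset.sum_le_sum fun j _ => le_trans ?_ (T.norm_hermSlope_sq_le hy j)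
  have hl := T.len_pos j
  have h : ∫ x in (T.lft j)..(T.rgt j), ‖T.hermSnd y x - T.avgFun (D L (D L y)) x‖ ^ 2 ≤
      ∫ x in (T.lft j)..(T.rgt j), T.len j ^ 2 * ‖T.hermSlope y j‖ ^ 2 := by
    refine T.integral_element_mono (memLp_integrable_sq ((T.memLp_hermSnd y).sub (T.memLp_avgFun _)))
      (integrable_const _) j fun x hx => ?_
    change ‖T.hermSnd y x - T.avgFun (D L (D L y)) x‖ ^ 2 ≤ _
    rw [T.avgFun_eq _ hx, hermSnd, T.glue_eq _ hx, add_sub_cancel_left, norm_smul,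
      mul_pow, Real.norm_eq_abs, sq_abs]
    refine mul_le_mul_of_nonneg_right (sq_le_sq' ?_ ?_) (sq_nonneg _) <;>
    · simp only [len]; linarith [hx.1, hx.2, T.lft_lt_rgt j]
  refine h.trans (le_of_eq ?_)
  rw [intervalIntegral.integral_const, smul_eq_mul, ← len]
  ring

end Mesh

/-! ### The corrected Sadowsky density -/

/-- The maximizer `s` in `le_gam`. -/
def ratio (α β : ℝ) : ℝ := β / max α β

/-- The square root of the density `Qbar`, a maximum of linear forms. -/
def gam (α β : ℝ) : ℝ := (1 - ratio α β ^ 2) * α + 2 * ratio α β * β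

theorem ratio_nonneg {α β : ℝ} (hα : 0 ≤ α) (hβ : 0 ≤ β) : 0 ≤ ratio α β :=
  div_nonneg hβ (hα.trans (le_max_left _ _))

theorem ratio_le_one {α β : ℝ} (hα : 0 ≤ α) : ratio α β ≤ 1 :=
  div_le_one_of_le₀ (le_max_right _ _) (hα.trans (le_max_left _ _))

theorem gam_of_le {α β : ℝ} (h : β ≤ α) : gam α β = α + β ^ 2 / α := by
  rw [gam, ratio, max_eq_left h]
  rcases eq_or_ne α 0 with rfl | h0
  · simp
  · field_simp; ring

theorem gam_of_lt {α β : ℝ} (hα : 0 ≤ α) (h : α < β) : gam α β = 2 * β := by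
  rw [gam, ratio, max_eq_right h.le, div_self (hα.trans_lt h).ne']
  ring

theorem gam_nonneg {α β : ℝ} (hα : 0 ≤ α) (hβ : 0 ≤ β) : 0 ≤ gam α β := by
  have h0 := ratio_nonneg hα hβ
  have h1 := ratio_le_one (β := β) hα
  have : 0 ≤ 1 - ratio α β ^ 2 := by nlinarith
  unfold gam
  positivity

theorem gam_le {α β : ℝ} (hα : 0 ≤ α) (hβ : 0 ≤ β) : gam α β ≤ α + 2 * β := by
  have h0 := ratio_nonneg hα hβ
  have h1 := ratio_le_one (β := β) hα
  unfold gam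
  nlinarith [mul_nonneg (sq_nonneg (ratio α β)) hα, mul_nonneg (sub_nonneg.2 h1) hβ]

/-- For β ≤ α the gap between the two sides is (s α - β)²/α. For α < β it is 2 (1 - s)(β - α) + (1 -
s)² α. This is the source of the convexity of the density. -/
theorem le_gam {α β s : ℝ} (hα : 0 ≤ α) (hβ : 0 ≤ β) (h1 : s ≤ 1) :
    (1 - s ^ 2) * α + 2 * s * β ≤ gam α β := by
  rcases le_or_gt β α with h | h
  · rw [gam_of_le h]
    rcases hα.eq_or_lt with rfl | hpos
    · have : β = 0 := le_antisymm h hβ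
      simp [this]
    · have : 0 ≤ (s * α - β) ^ 2 / α := by positivity
      have he : (s * α - β) ^ 2 / α = s ^ 2 * α - 2 * s * β + β ^ 2 / α := by
        field_simp; ring
      linarith
  · rw [gam_of_lt hα h]
    nlinarith [mul_nonneg (sub_nonneg.2 h1) (sub_nonneg.2 h.le),
      mul_nonneg (sub_nonneg.2 h1) (mul_nonneg (sub_nonneg.2 h1) hα)]

theorem Qbar_eq {α β : ℝ} (hα : 0 ≤ α) (hβ : 0 ≤ β) : Qbar α β = gam α β ^ 2 := by
  rw [Qbar, abs_of_nonneg hα, abs_of_nonneg hβ]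
  split_ifs with h
  · rw [gam_of_le h]
    rcases eq_or_ne α 0 with rfl | h0
    · have : β = 0 := le_antisymm h hβ
      simp [this]
    · field_simp
  · rw [gam_of_lt hα (not_le.1 h)]; ring

/-- The optimal s for (α, β) is a competitor for (α', β'), and the coefficients 1 - s² and 2 s of
the corresponding linear form are at most 1 and 2. -/
theorem gam_sub_le {α β α' β' : ℝ} (hα : 0 ≤ α) (hβ : 0 ≤ β) (hα' : 0 ≤ α') (hβ' : 0 ≤ β') :
    gam α β - gam α' β' ≤ |α - α'| + 2 * |β - β'| := by
  have h0 := ratio_nonneg hα hβ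
  have h1 := ratio_le_one (β := β) hα
  have h := le_gam hα' hβ' h1
  have e : gam α β = (1 - ratio α β ^ 2) * α + 2 * ratio α β * β := rfl
  have a1 : (1 - ratio α β ^ 2) * (α - α') ≤ |α - α'| := by
    have : (1 - ratio α β ^ 2) * |α - α'| ≤ 1 * |α - α'| :=
      mul_le_mul_of_nonneg_right (by nlinarith) (abs_nonneg _)
    have : (1 - ratio α β ^ 2) * (α - α') ≤ (1 - ratio α β ^ 2) * |α - α'| :=
      mul_le_mul_of_nonneg_left (le_abs_self _) (by nlinarith)
    linarith
  have a2 : ratio α β * (β - β') ≤ |β - β'| := by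
    have : ratio α β * |β - β'| ≤ 1 * |β - β'| := mul_le_mul_of_nonneg_right h1 (abs_nonneg _)
    have : ratio α β * (β - β') ≤ ratio α β * |β - β'| :=
      mul_le_mul_of_nonneg_left (le_abs_self _) h0
    linarith
  rw [e]
  linarith

theorem abs_gam_sub_le {α β α' β' : ℝ} (hα : 0 ≤ α) (hβ : 0 ≤ β) (hα' : 0 ≤ α') (hβ' : 0 ≤ β') :
    |gam α β - gam α' β'| ≤ |α - α'| + 2 * |β - β'| := by
  refine abs_le.2 ⟨?_, gam_sub_le hα hβ hα' hβ'⟩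
  have := gam_sub_le hα' hβ' hα hβ
  rw [abs_sub_comm α' α, abs_sub_comm β' β] at this
  linarith

/-- With r = α² and s = β² one has r + s + |r - s| = 2 max(r, s), so the right-hand side is ψ with
the exact modulus. This explains the splitting ½(|y''|² + 5|b'|² + ψ) of the density. -/
theorem two_mul_Qbar_eq {α β : ℝ} (hα : 0 ≤ α) (hβ : 0 < β) :
    2 * Qbar α β - α ^ 2 - 5 * β ^ 2 =
      |α ^ 2 - β ^ 2| + 4 * (β ^ 2) ^ 2 / (α ^ 2 + β ^ 2 + |α ^ 2 - β ^ 2|) := by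
  rw [Qbar, abs_of_nonneg hα, abs_of_nonneg hβ.le]
  split_ifs with h
  · have h2 : β ^ 2 ≤ α ^ 2 := by gcongr
    have hα0 : α ≠ 0 := (hβ.trans_le h).ne'
    rw [abs_of_nonneg (sub_nonneg.2 h2)]
    have : α ^ 2 + β ^ 2 + (α ^ 2 - β ^ 2) = 2 * α ^ 2 := by ring
    rw [this]
    field_simp
    ring
  · have h2 : α ^ 2 ≤ β ^ 2 := by gcongr; exact (not_le.1 h).le
    rw [abs_of_nonpos (sub_nonpos.2 h2)]
    have : α ^ 2 + β ^ 2 + -(α ^ 2 - β ^ 2) = 2 * β ^ 2 := by ring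
    rw [this]
    field_simp
    ring

/-- The regularized density differs from the limit density by a multiple of `δ`. -/
theorem abs_psi_sub_le {reg : ℝ → ℝ → ℝ} {c₀ c₁ c₂ cuni δ : ℝ}
    (hreg : IsRegularizedModulus reg c₀ c₁ c₂ cuni) (hδ : 0 ≤ δ) {α β : ℝ}
    (hα : 0 ≤ α) (hβ : 0 ≤ β) :
    |psi reg δ (α ^ 2) (β ^ 2) - (2 * Qbar α β - α ^ 2 - 5 * β ^ 2)| ≤ 3 * (cuni * δ) := by
  have hu := hreg.uniform δ hδ (α ^ 2 - β ^ 2)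
  have hn := hreg.nonneg δ hδ (α ^ 2 - β ^ 2)
  rcases hβ.eq_or_lt with rfl | hpos
  · have hQ : Qbar α 0 = α ^ 2 := by
      rw [Qbar_eq hα le_rfl, gam_of_le hα]; simp
    have hab : |α ^ 2 - 0 ^ 2| = α ^ 2 := by simp
    rw [hab] at hu
    have : psi reg δ (α ^ 2) (0 ^ 2) - (2 * Qbar α 0 - α ^ 2 - 5 * 0 ^ 2) =
        reg δ (α ^ 2 - 0 ^ 2) - α ^ 2 := by
      rw [hQ, psi]; simp; ring
    rw [this]
    linarith [abs_nonneg (reg δ (α ^ 2 - 0 ^ 2) - α ^ 2)]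
  · rw [two_mul_Qbar_eq hα hpos, psi]
    set r := α ^ 2
    set s := β ^ 2 with hs
    set a := reg δ (r - s)
    set m := |r - s| with hm
    have hs0 : 0 < s := by positivity
    have hr0 : 0 ≤ r := sq_nonneg _
    have hsum : 2 * s ≤ r + s + m := by have := neg_abs_le (r - s); linarith
    have h1 : s ≤ r + s + a := by linarith
    have hd : 4 * s ^ 2 / (r + s + a) - 4 * s ^ 2 / (r + s + m) =
        4 * s ^ 2 * (m - a) / ((r + s + a) * (r + s + m)) := by
      rw [div_sub_div _ _ (by linarith) (by linarith)]
      congr 1; ring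
    -- The two denominators are at least s and 2 s, so the difference of the quotients is at most 4
    -- s² |a - m| / (2 s²). Together with |a - m| itself this gives the constant 3.
    have hb : |4 * s ^ 2 / (r + s + a) - 4 * s ^ 2 / (r + s + m)| ≤ 2 * |a - m| := by
      have hp : 0 < (r + s + a) * (r + s + m) := mul_pos (by linarith) (by linarith)
      rw [hd, abs_div, abs_of_pos hp, abs_mul, abs_of_nonneg (by positivity : 0 ≤ 4 * s ^ 2),
        div_le_iff₀ hp, abs_sub_comm m a]
      have : s * (2 * s) ≤ (r + s + a) * (r + s + m) :=
        mul_le_mul h1 hsum (by linarith) (by linarith)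
      nlinarith [abs_nonneg (a - m)]
    calc |a + 4 * s ^ 2 / (r + s + a) - (m + 4 * s ^ 2 / (r + s + m))|
        = |(a - m) + (4 * s ^ 2 / (r + s + a) - 4 * s ^ 2 / (r + s + m))| := by congr 1; ring
      _ ≤ |a - m| + 2 * |a - m| := (abs_add_le _ _).trans (by linarith)
      _ ≤ 3 * (cuni * δ) := by linarith

theorem psi_nonneg {reg : ℝ → ℝ → ℝ} {c₀ c₁ c₂ cuni δ : ℝ}
    (hreg : IsRegularizedModulus reg c₀ c₁ c₂ cuni) (hδ : 0 ≤ δ) {r s : ℝ}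
    (hr : 0 ≤ r) (hs : 0 ≤ s) : 0 ≤ psi reg δ r s := by
  have hn := hreg.nonneg δ hδ (r - s)
  unfold psi
  positivity

/-! ### Subgradients of the density -/

/-- First component of a subgradient of `(p, q) ↦ Qbar ‖p‖ ‖q‖`. -/
def subgradFst (p q : E3) : E3 :=
  -- At p = 0 the direction p/|p| is read as 0, which is compatible with the subgradient inequality.
  (2 * gam ‖p‖ ‖q‖ * (1 - ratio ‖p‖ ‖q‖ ^ 2) * ‖p‖⁻¹) • p

/-- Second component of a subgradient of `(p, q) ↦ Qbar ‖p‖ ‖q‖`. -/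
def subgradSnd (p q : E3) : E3 :=
  (4 * gam ‖p‖ ‖q‖ * ratio ‖p‖ ‖q‖ * ‖q‖⁻¹) • q

theorem norm_inv_mul_norm_sq (p : E3) : ‖p‖⁻¹ * ‖p‖ ^ 2 = ‖p‖ := by
  rcases eq_or_ne ‖p‖ 0 with h | h
  · simp [h]
  · field_simp

/-- Euler's relation: the density is positively homogeneous of degree two. -/
theorem inner_subgrad_self (p q : E3) :
    ⟪subgradFst p q, p⟫ + ⟪subgradSnd p q, q⟫ = 2 * Qbar ‖p‖ ‖q‖ := by
  rw [subgradFst, subgradSnd, inner_smul_left, inner_smul_left, real_inner_self_eq_norm_sq,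
    real_inner_self_eq_norm_sq, Qbar_eq (norm_nonneg _) (norm_nonneg _)]
  simp only [RCLike.conj_to_real, mul_assoc, norm_inv_mul_norm_sq]
  have : gam ‖p‖ ‖q‖ ^ 2 = gam ‖p‖ ‖q‖ *
      ((1 - ratio ‖p‖ ‖q‖ ^ 2) * ‖p‖ + 2 * ratio ‖p‖ ‖q‖ * ‖q‖) := by rw [sq]; rfl
  rw [this]
  ring

theorem inv_norm_mul_inner_le (p p' : E3) : ‖p‖⁻¹ * ⟪p, p'⟫ ≤ ‖p'‖ := by
  rcases eq_or_ne ‖p‖ 0 with h | h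
  · simp [h]
  · rw [inv_mul_le_iff₀ (lt_of_le_of_ne (norm_nonneg _) h.symm)]
    exact real_inner_le_norm p p'

/-- The subgradient inequality, i.e. the convexity of `(p, q) ↦ Qbar ‖p‖ ‖q‖`. -/
theorem subgrad_le (p q p' q' : E3) :
    ⟪subgradFst p q, p'⟫ + ⟪subgradSnd p q, q'⟫ - Qbar ‖p‖ ‖q‖ ≤ Qbar ‖p'‖ ‖q'‖ := by
  have h0 := ratio_nonneg (norm_nonneg p) (norm_nonneg q)
  have h1 := ratio_le_one (β := ‖q‖) (norm_nonneg p)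
  have hg := gam_nonneg (norm_nonneg p) (norm_nonneg q)
  have hle := le_gam (norm_nonneg p') (norm_nonneg q') h1
  have hp := inv_norm_mul_inner_le p p'
  have hq := inv_norm_mul_inner_le q q'
  rw [subgradFst, subgradSnd, inner_smul_left, inner_smul_left,
    Qbar_eq (norm_nonneg _) (norm_nonneg _), Qbar_eq (norm_nonneg _) (norm_nonneg _)]
  simp only [RCLike.conj_to_real]
  set g := gam ‖p‖ ‖q‖
  set t := ratio ‖p‖ ‖q‖
  set g' := gam ‖p'‖ ‖q'‖
  have h2 : 0 ≤ 1 - t ^ 2 := by nlinarith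
  have k1 : (1 - t ^ 2) * (‖p‖⁻¹ * ⟪p, p'⟫) ≤ (1 - t ^ 2) * ‖p'‖ :=
    mul_le_mul_of_nonneg_left hp h2
  have k2 : t * (‖q‖⁻¹ * ⟪q, q'⟫) ≤ t * ‖q'‖ := mul_le_mul_of_nonneg_left hq h0
  -- The linear form that is optimal at (p, q) is at most g' at (p', q'). It remains to use 2 g g' -
  -- g² ≤ g'².
  have k3 : g * ((1 - t ^ 2) * (‖p‖⁻¹ * ⟪p, p'⟫) + 2 * (t * (‖q‖⁻¹ * ⟪q, q'⟫))) ≤ g * g' :=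
    mul_le_mul_of_nonneg_left (by linarith) hg
  nlinarith [sq_nonneg (g - g')]

theorem norm_smul_inv_norm_le (c : ℝ) (p : E3) : ‖(c * ‖p‖⁻¹) • p‖ ≤ |c| := by
  rw [norm_smul, norm_mul, Real.norm_eq_abs, norm_inv, norm_norm, mul_assoc]
  exact mul_le_of_le_one_right (abs_nonneg _) inv_mul_le_one

theorem norm_subgradFst_le (p q : E3) : ‖subgradFst p q‖ ≤ 4 * (‖p‖ + 2 * ‖q‖) := by
  have h0 := ratio_nonneg (norm_nonneg p) (norm_nonneg q)
  have h1 := ratio_le_one (β := ‖q‖) (norm_nonneg p)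
  have hg := gam_nonneg (norm_nonneg p) (norm_nonneg q)
  have hg' := gam_le (norm_nonneg p) (norm_nonneg q)
  refine (norm_smul_inv_norm_le _ p).trans ?_
  have h2 : 0 ≤ 1 - ratio ‖p‖ ‖q‖ ^ 2 := by nlinarith
  rw [abs_of_nonneg (by positivity)]
  nlinarith [mul_nonneg hg (sq_nonneg (ratio ‖p‖ ‖q‖))]

theorem norm_subgradSnd_le (p q : E3) : ‖subgradSnd p q‖ ≤ 4 * (‖p‖ + 2 * ‖q‖) := by
  have h0 := ratio_nonneg (norm_nonneg p) (norm_nonneg q)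
  have h1 := ratio_le_one (β := ‖q‖) (norm_nonneg p)
  have hg := gam_nonneg (norm_nonneg p) (norm_nonneg q)
  have hg' := gam_le (norm_nonneg p) (norm_nonneg q)
  refine (norm_smul_inv_norm_le _ q).trans ?_
  rw [abs_of_nonneg (by positivity)]
  nlinarith [mul_nonneg hg (sub_nonneg.2 h1)]

theorem measurable_gam : Measurable fun z : ℝ × ℝ => gam z.1 z.2 := by
  unfold gam ratio; fun_prop

theorem measurable_ratio : Measurable fun z : ℝ × ℝ => ratio z.1 z.2 := by
  unfold ratio; fun_prop

theorem measurable_subgradFst : Measurable fun z : E3 × E3 => subgradFst z.1 z.2 := by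
  have h : Measurable fun z : E3 × E3 => (‖z.1‖, ‖z.2‖) := by fun_prop
  have h1 := measurable_gam.comp h
  have h2 := measurable_ratio.comp h
  unfold subgradFst
  simp only [Function.comp_def] at h1 h2
  fun_prop

theorem measurable_subgradSnd : Measurable fun z : E3 × E3 => subgradSnd z.1 z.2 := by
  have h : Measurable fun z : E3 × E3 => (‖z.1‖, ‖z.2‖) := by fun_prop
  have h1 := measurable_gam.comp h
  have h2 := measurable_ratio.comp h
  unfold subgradSnd
  simp only [Function.comp_def] at h1 h2
  fun_prop

section

variable {L : ℝ} {p q : ℝ → E3}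

theorem memLp_norm_add (hp : MemLp p 2 (mu L)) (hq : MemLp q 2 (mu L)) (c : ℝ) :
    MemLp (fun x => c * (‖p x‖ + 2 * ‖q x‖)) 2 (mu L) :=
  (hp.norm.add (hq.norm.const_mul 2)).const_mul c

theorem memLp_subgradFst (hp : MemLp p 2 (mu L)) (hq : MemLp q 2 (mu L)) :
    MemLp (fun x => subgradFst (p x) (q x)) 2 (mu L) :=
  (memLp_norm_add hp hq 4).mono
    (measurable_subgradFst.comp_aemeasurable
      (hp.1.aemeasurable.prodMk hq.1.aemeasurable)).aestronglyMeasurable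
    (ae_of_all _ fun _ => (norm_subgradFst_le _ _).trans (le_abs_self _))

theorem memLp_subgradSnd (hp : MemLp p 2 (mu L)) (hq : MemLp q 2 (mu L)) :
    MemLp (fun x => subgradSnd (p x) (q x)) 2 (mu L) :=
  (memLp_norm_add hp hq 4).mono
    (measurable_subgradSnd.comp_aemeasurable
      (hp.1.aemeasurable.prodMk hq.1.aemeasurable)).aestronglyMeasurable
    (ae_of_all _ fun _ => (norm_subgradSnd_le _ _).trans (le_abs_self _))

theorem memLp_gam (hp : MemLp p 2 (mu L)) (hq : MemLp q 2 (mu L)) :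
    MemLp (fun x => gam ‖p x‖ ‖q x‖) 2 (mu L) :=
  (memLp_norm_add hp hq 1).mono
    (measurable_gam.comp_aemeasurable
      (hp.1.aemeasurable.norm.prodMk hq.1.aemeasurable.norm)).aestronglyMeasurable
    (ae_of_all _ fun x => by
      rw [Real.norm_of_nonneg (gam_nonneg (norm_nonneg _) (norm_nonneg _)), one_mul]
      exact (gam_le (norm_nonneg _) (norm_nonneg _)).trans (le_abs_self _))

theorem integrable_Qbar (hp : MemLp p 2 (mu L)) (hq : MemLp q 2 (mu L)) :
    Integrable (fun x => Qbar ‖p x‖ ‖q x‖) (mu L) := by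
  refine (memLp_integrable_sq (memLp_gam hp hq)).congr (ae_of_all _ fun x => ?_)
  simp only [Real.norm_eq_abs, sq_abs]
  exact (Qbar_eq (norm_nonneg _) (norm_nonneg _)).symm

/-- The integrated subgradient inequality. -/
theorem integral_subgrad_le {p' q' : ℝ → E3} (hp : MemLp p 2 (mu L)) (hq : MemLp q 2 (mu L))
    (hp' : MemLp p' 2 (mu L)) (hq' : MemLp q' 2 (mu L)) :
    (∫ x, ⟪subgradFst (p x) (q x), p' x⟫ ∂(mu L)) + (∫ x, ⟪subgradSnd (p x) (q x), q' x⟫ ∂(mu L))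
      - (∫ x, Qbar ‖p x‖ ‖q x‖ ∂(mu L)) ≤ ∫ x, Qbar ‖p' x‖ ‖q' x‖ ∂(mu L) := by
  have h1 := memLp_inner_integrable (memLp_subgradFst hp hq) hp'
  have h2 := memLp_inner_integrable (memLp_subgradSnd hp hq) hq'
  have h3 : Integrable (fun x => ⟪subgradFst (p x) (q x), p' x⟫ + ⟪subgradSnd (p x) (q x), q' x⟫)
    (mu L) := h1.add h2
  rw [← integral_add h1 h2, ← integral_sub h3 (integrable_Qbar hp hq)]
  exact integral_mono (h3.sub (integrable_Qbar hp hq)) (integrable_Qbar hp' hq')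
    fun x => subgrad_le _ _ _ _

theorem integral_inner_subgrad_self (hp : MemLp p 2 (mu L)) (hq : MemLp q 2 (mu L)) :
    (∫ x, ⟪subgradFst (p x) (q x), p x⟫ ∂(mu L)) + (∫ x, ⟪subgradSnd (p x) (q x), q x⟫ ∂(mu L))
      = 2 * ∫ x, Qbar ‖p x‖ ‖q x‖ ∂(mu L) := by
  rw [← integral_add (memLp_inner_integrable (memLp_subgradFst hp hq) hp)
    (memLp_inner_integrable (memLp_subgradSnd hp hq) hq), ← integral_const_mul]
  exact integral_congr_ae (ae_of_all _ fun x => inner_subgrad_self _ _)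

end

/-! ### Strong and weak convergence in `L²` -/

section LTwo

variable {L : ℝ}

theorem inner_toLp {G : Type*} [NormedAddCommGroup G] [InnerProductSpace ℝ G] {f g : ℝ → G}
    (hf : MemLp f 2 (mu L)) (hg : MemLp g 2 (mu L)) :
    ⟪hf.toLp f, hg.toLp g⟫ = ∫ x, ⟪f x, g x⟫ ∂(mu L) := by
  rw [L2.inner_def]
  refine integral_congr_ae ?_
  filter_upwards [hf.coeFn_toLp, hg.coeFn_toLp] with x h1 h2
  rw [h1, h2]

theorem norm_toLp_sq {G : Type*} [NormedAddCommGroup G] [InnerProductSpace ℝ G] {f : ℝ → G}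
    (hf : MemLp f 2 (mu L)) : ‖hf.toLp f‖ ^ 2 = ∫ x, ‖f x‖ ^ 2 ∂(mu L) := by
  rw [← real_inner_self_eq_norm_sq, inner_toLp hf hf]
  simp_rw [real_inner_self_eq_norm_sq]

theorem integral_inner_le {f g : ℝ → E3} (hf : MemLp f 2 (mu L)) (hg : MemLp g 2 (mu L)) :
    |∫ x, ⟪f x, g x⟫ ∂(mu L)| ≤
      √(∫ x, ‖f x‖ ^ 2 ∂(mu L)) * √(∫ x, ‖g x‖ ^ 2 ∂(mu L)) := by
  rw [← inner_toLp hf hg, ← norm_toLp_sq hf, ← norm_toLp_sq hg, Real.sqrt_sq (norm_nonneg _),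
    Real.sqrt_sq (norm_nonneg _)]
  exact abs_real_inner_le_norm _ _

/-- Strong convergence implies convergence of the squared norms. -/
theorem tendsto_integral_norm_sq {G : Type*} [NormedAddCommGroup G] [InnerProductSpace ℝ G]
    {f : ℕ → ℝ → G} {g : ℝ → G} (hf : ∀ n, MemLp (f n) 2 (mu L)) (hg : MemLp g 2 (mu L))
    (h : Tendsto (fun n => ∫ x, ‖f n x - g x‖ ^ 2 ∂(mu L)) atTop (𝓝 0)) :
    Tendsto (fun n => ∫ x, ‖f n x‖ ^ 2 ∂(mu L)) atTop (𝓝 (∫ x, ‖g x‖ ^ 2 ∂(mu L))) := by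
  have h1 : Tendsto (fun n => (hf n).toLp (f n)) atTop (𝓝 (hg.toLp g)) := by
    rw [tendsto_iff_norm_sub_tendsto_zero]
    have h2 : ∀ n, ‖(hf n).toLp (f n) - hg.toLp g‖ = √(∫ x, ‖f n x - g x‖ ^ 2 ∂(mu L)) := by
      intro n
      rw [← MemLp.toLp_sub, ← Real.sqrt_sq (norm_nonneg (MemLp.toLp (f n - g) _)), norm_toLp_sq]
      rfl
    simp_rw [h2]
    simpa using h.sqrt
  have := (h1.norm.pow 2)
  simpa only [norm_toLp_sq] using this

theorem weakL2_iff (hL : 0 ≤ L) (f : ℕ → ℝ → E3) (g : ℝ → E3) :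
    WeakL2 L f g ↔ ∀ φ : ℝ → E3, MemLp φ 2 (mu L) →
      Tendsto (fun n => ∫ x, ⟪f n x, φ x⟫ ∂(mu L)) atTop (𝓝 (∫ x, ⟪g x, φ x⟫ ∂(mu L))) := by
  simp only [WeakL2, intervalIntegral.integral_of_le hL, mu]

/-- Weakly convergent sequences are bounded. -/
theorem WeakL2.bounded (hL : 0 ≤ L) {f : ℕ → ℝ → E3} {g : ℝ → E3} (h : WeakL2 L f g)
    (hf : ∀ n, MemLp (f n) 2 (mu L)) :
    ∃ M, 0 ≤ M ∧ ∀ n, ∫ x, ‖f n x‖ ^ 2 ∂(mu L) ≤ M := by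
  rw [weakL2_iff hL] at h
  obtain ⟨C, hC⟩ := banach_steinhaus (g := fun n => innerSL ℝ ((hf n).toLp (f n))) (by
    intro φ
    have hφ := h φ (Lp.memLp φ)
    obtain ⟨C, hC⟩ := hφ.norm.bddAbove_range
    refine ⟨C, fun n => ?_⟩
    have := hC ⟨n, rfl⟩
    simp only at this
    rw [← inner_toLp (hf n) (Lp.memLp φ), Lp.toLp_coeFn] at this
    simpa using this)
  refine ⟨C ^ 2, sq_nonneg _, fun n => ?_⟩
  rw [← norm_toLp_sq (hf n)]
  have := hC n
  rw [innerSL_apply_norm] at this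
  exact pow_le_pow_left₀ (norm_nonneg _) this 2

/-- Products of weakly and strongly convergent sequences. -/
theorem WeakL2.tendsto_inner (hL : 0 ≤ L) {f : ℕ → ℝ → E3} {g : ℝ → E3} (h : WeakL2 L f g)
    (hf : ∀ n, MemLp (f n) 2 (mu L)) {φ : ℕ → ℝ → E3} {ψ : ℝ → E3}
    (hφ : ∀ n, MemLp (φ n) 2 (mu L)) (hψ : MemLp ψ 2 (mu L))
    (hc : Tendsto (fun n => ∫ x, ‖φ n x - ψ x‖ ^ 2 ∂(mu L)) atTop (𝓝 0)) :
    Tendsto (fun n => ∫ x, ⟪f n x, φ n x⟫ ∂(mu L)) atTop (𝓝 (∫ x, ⟪g x, ψ x⟫ ∂(mu L))) := by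
  obtain ⟨M, hM0, hM⟩ := h.bounded hL hf
  have h1 := (weakL2_iff hL f g).1 h ψ hψ
  have h2 : Tendsto (fun n => ∫ x, ⟪f n x, φ n x - ψ x⟫ ∂(mu L)) atTop (𝓝 0) := by
    have hs : Tendsto (fun n => √M * √(∫ x, ‖φ n x - ψ x‖ ^ 2 ∂(mu L))) atTop (𝓝 0) := by
      simpa using hc.sqrt.const_mul (√M)
    refine squeeze_zero_norm (fun n => ?_) hs
    refine (integral_inner_le (hf n) ((hφ n).sub hψ)).trans ?_
    exact mul_le_mul_of_nonneg_right (Real.sqrt_le_sqrt (hM n)) (Real.sqrt_nonneg _)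
  have h3 := h2.add h1
  rw [zero_add] at h3
  refine h3.congr fun n => ?_
  have hi : Integrable (fun x => ⟪f n x, φ n x - ψ x⟫) (mu L) :=
    memLp_inner_integrable (hf n) ((hφ n).sub hψ)
  rw [← integral_add hi (memLp_inner_integrable (hf n) hψ)]
  exact integral_congr_ae (ae_of_all _ fun x => by simp [inner_sub_right])

theorem weakL2_of_tendsto (hL : 0 ≤ L) {f : ℕ → ℝ → E3} {g : ℝ → E3}
    (hf : ∀ n, MemLp (f n) 2 (mu L)) (hg : MemLp g 2 (mu L))
    (hc : Tendsto (fun n => ∫ x, ‖f n x - g x‖ ^ 2 ∂(mu L)) atTop (𝓝 0)) : WeakL2 L f g := by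
  rw [weakL2_iff hL]
  intro φ hφ
  have h2 : Tendsto (fun n => ∫ x, ⟪f n x - g x, φ x⟫ ∂(mu L)) atTop (𝓝 0) := by
    have hs : Tendsto (fun n => √(∫ x, ‖f n x - g x‖ ^ 2 ∂(mu L)) *
        √(∫ x, ‖φ x‖ ^ 2 ∂(mu L))) atTop (𝓝 0) := by
      simpa using hc.sqrt.mul_const (√(∫ x, ‖φ x‖ ^ 2 ∂(mu L)))
    exact squeeze_zero_norm (fun n => integral_inner_le ((hf n).sub hg) hφ) hs
  have h3 := h2.add_const (∫ x, ⟪g x, φ x⟫ ∂(mu L))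
  rw [zero_add] at h3
  refine h3.congr fun n => ?_
  have hi : Integrable (fun x => ⟪f n x - g x, φ x⟫) (mu L) :=
    memLp_inner_integrable ((hf n).sub hg) hφ
  rw [← integral_add hi (memLp_inner_integrable hg hφ)]
  exact integral_congr_ae (ae_of_all _ fun x => by simp [inner_sub_left])

theorem tendsto_of_tendsto_inner {a : ℕ → E3} {c : E3}
    (h : ∀ e : E3, Tendsto (fun n => ⟪a n, e⟫) atTop (𝓝 ⟪c, e⟫)) : Tendsto a atTop (𝓝 c) := by
  set b := EuclideanSpace.basisFun (Fin 3) ℝ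
  have hs := tendsto_finsetSum Finset.univ
    fun (i : Fin 3) _ => (h (b i)).smul_const (b i)
  have he : ∀ x : E3, ∑ i, ⟪x, b i⟫ • b i = x := fun x => by
    exact (Finset.sum_congr rfl fun i _ => by rw [real_inner_comm]).trans (b.sum_repr' x)
  simpa only [he] using hs

/-- Weak convergence in `H¹` implies pointwise convergence. -/
theorem WeakL2.tendsto_apply (hL : 0 < L) {u : ℕ → ℝ → E3} {v : ℝ → E3}
    (hu : ∀ n, MemH1 L (u n)) (hv : MemH1 L v) (h0 : WeakL2 L u v)
    (h1 : WeakL2 L (fun n => D L (u n)) (D L v)) {x : ℝ} (hx : x ∈ Set.Icc 0 L) :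
    Tendsto (fun n => u n x) atTop (𝓝 (v x)) := by
  obtain ⟨M, hM0, hM⟩ := h1.bounded hL.le fun n => (hu n).1
  have hz : (0 : ℝ) ∈ Set.Icc 0 L := ⟨le_rfl, hL.le⟩
  rw [weakL2_iff hL.le] at h0 h1
  -- Testing the derivative with the indicator of (0, x] produces the increment w x - w 0.
  have hform : ∀ {w : ℝ → E3}, MemH1 L w → ∀ e : E3, ∀ x ∈ Set.Icc 0 L,
      ∫ t, ⟪D L w t, (Set.Ioc 0 x).indicator (fun _ => e) t⟫ ∂(mu L) = ⟪w x - w 0, e⟫ := by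
    intro w hw e x hx
    rw [hw.sub_eq_integral hz hx, intervalIntegral.integral_of_le hx.1, real_inner_comm,
      ← integral_inner (integrableOn_of_integrable_mu (memLp_integrable hw.1) le_rfl hx.2)]
    have : ∀ t, ⟪D L w t, (Set.Ioc 0 x).indicator (fun _ => e) t⟫ =
        (Set.Ioc 0 x).indicator (fun t => ⟪e, D L w t⟫) t := fun t => by
      by_cases ht : t ∈ Set.Ioc 0 x
      · simp [ht, real_inner_comm]
      · simp [ht]
    simp_rw [this]
    rw [integral_indicator measurableSet_Ioc, mu, Measure.restrict_restrict measurableSet_Ioc,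
      Set.inter_eq_left.2 (Set.Ioc_subset_Ioc_right hx.2)]
  have hinc : ∀ e : E3, ∀ x ∈ Set.Icc 0 L,
      Tendsto (fun n => ⟪u n x - u n 0, e⟫) atTop (𝓝 ⟪v x - v 0, e⟫) := by
    intro e x hx
    have h := h1 ((Set.Ioc 0 x).indicator fun _ => e) ((memLp_const e).indicator measurableSet_Ioc)
    simpa only [hform hv e x hx, fun n => hform (hu n) e x hx] using h
  have hmL : ∀ {w : ℝ → E3}, MemH1 L w → MemLp w 2 (mu L) := fun hw =>
    memLp_of_continuousOn (hw.continuousOn hL)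
  have hae : ∀ᵐ x ∂(mu L), x ∈ Set.Ioc 0 L := ae_restrict_mem measurableSet_Ioc
  -- Increments converge pointwise and, by the Hölder bound, with a uniform majorant. Subtracting
  -- their integral from that of u n, which converges by weak convergence, isolates L times the
  -- value at 0.
  have hzero : ∀ e : E3, Tendsto (fun n => ⟪u n 0, e⟫) atTop (𝓝 ⟪v 0, e⟫) := by
    intro e
    have hdc : Tendsto (fun n => ∫ x, ⟪u n x - u n 0, e⟫ ∂(mu L)) atTop
        (𝓝 (∫ x, ⟪v x - v 0, e⟫ ∂(mu L))) := by
      refine tendsto_integral_of_dominated_convergence (fun _ => √(L * M) * ‖e‖) (fun n => ?_)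
        (integrable_const _) (fun n => ?_) ?_
      · exact (((hmL (hu n)).sub (memLp_const (u n 0))).inner_const e).1
      · filter_upwards [hae] with x hx
        refine (abs_real_inner_le_norm _ _).trans (mul_le_mul_of_nonneg_right ?_ (norm_nonneg _))
        refine Real.le_sqrt_of_sq_le (((hu n).norm_sub_sq_le hz
          (Set.Ioc_subset_Icc_self hx)).trans ?_)
        rw [sub_zero, abs_of_pos hx.1]
        exact mul_le_mul hx.2 (hM n) (integral_nonneg fun _ => sq_nonneg _) hL.le
      · filter_upwards [hae] with x hx using hinc e x (Set.Ioc_subset_Icc_self hx)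
    have hw := (h0 (fun _ => e) (memLp_const e)).sub hdc
    have hform0 : ∀ {w : ℝ → E3}, MemH1 L w →
        (∫ x, ⟪w x, e⟫ ∂(mu L)) - (∫ x, ⟪w x - w 0, e⟫ ∂(mu L)) = L * ⟪w 0, e⟫ := by
      intro w hw
      have hi : Integrable (fun x => ⟪w x - w 0, e⟫) (mu L) :=
        memLp_inner_integrable ((hmL hw).sub (memLp_const (w 0))) (memLp_const e)
      rw [← integral_sub (memLp_inner_integrable (hmL hw) (memLp_const e)) hi]
      simp [inner_sub_left, mu, hL.le]
    simp only [hform0 hv, fun n => hform0 (hu n)] at hw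
    have := hw.const_mul L⁻¹
    simpa only [inv_mul_cancel_left₀ hL.ne'] using this
  refine tendsto_of_tendsto_inner fun e => ?_
  have := (hinc e x hx).add (hzero e)
  simpa only [← inner_add_left, sub_add_cancel] using this

theorem integral_norm_sq_eq {f : ℝ → E3} (hf : MemLp f 2 (mu L)) :
    ∫ x, ‖f x‖ ^ 2 ∂(mu L) = (eLpNorm f 2 (mu L)).toReal ^ 2 := by
  rw [← norm_toLp_sq hf, Lp.norm_toLp]

theorem tendsto_integral_norm_sq_zero_iff {f : ℕ → ℝ → E3} (hf : ∀ n, MemLp (f n) 2 (mu L)) :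
    Tendsto (fun n => ∫ x, ‖f n x‖ ^ 2 ∂(mu L)) atTop (𝓝 0) ↔
      Tendsto (fun n => eLpNorm (f n) 2 (mu L)) atTop (𝓝 0) := by
  simp_rw [fun n => integral_norm_sq_eq (hf n)]
  rw [← ENNReal.tendsto_toReal_iff (fun n => (hf n).2.ne) ENNReal.zero_ne_top]
  constructor
  · intro h
    have := h.sqrt
    simpa [Real.sqrt_sq ENNReal.toReal_nonneg] using this
  · intro h
    simpa using h.pow 2

theorem tendsto_hNorm_zero_iff {k : ℕ} {u : ℕ → ℝ → E3} :
    Tendsto (fun n => hNorm L k (u n)) atTop (𝓝 0) ↔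
      ∀ i ≤ k, Tendsto (fun n => eLpNorm ((D L)^[i] (u n)) 2 (mu L)) atTop (𝓝 0) := by
  constructor
  · intro h i hi
    refine tendsto_of_tendsto_of_tendsto_of_le_of_le tendsto_const_nhds h (fun _ => zero_le)
      fun n => ?_
    have hle : eLpNorm ((D L)^[i] (u n)) 2 (mu L) ^ 2 ≤
        ∑ i ∈ Finset.range (k + 1), eLpNorm ((D L)^[i] (u n)) 2 (mu L) ^ 2 :=
      Finset.single_le_sum (f := fun i => eLpNorm ((D L)^[i] (u n)) 2 (mu L) ^ 2)
        (fun _ _ => zero_le) (Finset.mem_range.2 (Nat.lt_succ_of_le hi))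
    have := ENNReal.rpow_le_rpow hle (z := 1 / 2) (by norm_num)
    rw [← ENNReal.rpow_natCast, ← ENNReal.rpow_mul] at this
    simpa [hNorm] using this
  · intro h
    have h1 : Tendsto (fun n => ∑ i ∈ Finset.range (k + 1), eLpNorm ((D L)^[i] (u n)) 2 (mu L) ^ 2)
        atTop (𝓝 (∑ i ∈ Finset.range (k + 1), (0 : ℝ≥0∞) ^ 2)) :=
      tendsto_finsetSum _ fun i hi =>
        ENNReal.Tendsto.pow (h i (Nat.lt_succ_iff.1 (Finset.mem_range.1 hi)))
    have h2 := h1.ennrpow_const (1 / 2)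
    simpa [hNorm] using h2

end LTwo

/-! ### The discrete energy -/

namespace Mesh

variable {L : ℝ} (T : Mesh L)

/-- The elastic part of the discrete energy. -/
def elastic (reg : ℝ → ℝ → ℝ) (δ : ℝ) (v : RibbonSpace L) : ℝ :=
  (1 / 2) * (∑ j : Fin T.N, ∫ x in (T.lft j)..(T.rgt j),
      (‖D L (D L v.y) x‖ ^ 2 + 5 * ‖D L v.b x‖ ^ 2
        + psi reg δ (‖T.avg (D L (D L v.y)) j‖ ^ 2) (‖D L v.b x‖ ^ 2)))

/-- The penalty for the orthogonality of `y'` and `b`. -/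
def nodalPenalty (v : RibbonSpace L) : ℝ :=
  ∑ j : Fin T.N, ∫ x in (T.lft j)..(T.rgt j), T.interp (fun s => ⟪D L v.y s, v.b s⟫ ^ 2) j x

/-- The penalty for the orthogonality of `y'` and `b'`. -/
def shearPenalty (v : RibbonSpace L) : ℝ :=
  ∑ j : Fin T.N, ∫ x in (T.lft j)..(T.rgt j), ⟪T.mid (D L v.y) j, D L v.b x⟫ ^ 2

theorem energyQuad_eq (reg : ℝ → ℝ → ℝ) (δ ε₁ ε₂ : ℝ) (v : RibbonSpace L) :
    T.energyQuad reg δ ε₁ ε₂ v = T.elastic reg δ v + 1 / (2 * ε₁) * T.nodalPenalty v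
      + 1 / (2 * ε₂) * T.shearPenalty v := rfl

theorem sum_len : ∑ j : Fin T.N, T.len j = L := by
  have h := T.sum_integral (f := fun _ => (1 : ℝ)) (integrable_const _)
  simpa [mu, T.length_nonneg, len] using h

/-- As b' is constant in the interior of each element, so is the term ψ_δ(|𝒜_h y''|², |b'|²); its
integrability follows without any regularity of the modulus. -/
theorem IsSpline.exists_D_eq {T : Mesh L} {b : ℝ → E3} (hb : T.IsSpline 1 0 b) :
    ∃ β : Fin T.N → E3, ∀ j, ∀ x ∈ Set.Ioo (T.lft j) (T.rgt j), D L b x = β j := by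
  choose c hc using hb.2
  refine ⟨fun j => c j 1, fun j x hx => ?_⟩
  have hn : Set.Ioo (T.lft j) (T.rgt j) ∈ 𝓝 x := isOpen_Ioo.mem_nhds hx
  have hI : Set.Icc 0 L ∈ 𝓝 x := mem_of_superset hn fun z hz =>
    T.mem_of_mem_element (Set.Ioo_subset_Icc_self hz)
  rw [D, derivWithin_of_mem_nhds hI]
  have he : b =ᶠ[𝓝 x] fun z => c j 0 + z • c j 1 := by
    filter_upwards [hn] with z hz
    rw [hc j z (Set.Ioo_subset_Icc_self hz)]
    refine (Fin.sum_univ_two (M := E3) _).trans ?_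
    change z ^ 0 • c j 0 + z ^ 1 • c j 1 = _
    rw [pow_zero, pow_one, one_smul]
  rw [he.deriv_eq]
  simpa using (((hasDerivAt_id x).smul_const (c j 1)).const_add (c j 0)).deriv

/-- The elastic part up to an error of order `δ`. -/
theorem abs_elastic_sub_le {reg : ℝ → ℝ → ℝ} {c₀ c₁ c₂ cuni δ : ℝ}
    (hreg : IsRegularizedModulus reg c₀ c₁ c₂ cuni) (hδ : 0 ≤ δ) (w : RibbonSpace L)
    (hb : T.IsSpline 1 0 w.b) :
    |T.elastic reg δ w - ((1 / 2) * ((∫ x, ‖D L (D L w.y) x‖ ^ 2 ∂(mu L))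
        - ∫ x, ‖T.avgFun (D L (D L w.y)) x‖ ^ 2 ∂(mu L))
      + ∫ x, Qbar ‖T.avgFun (D L (D L w.y)) x‖ ‖D L w.b x‖ ∂(mu L))| ≤
      3 / 2 * (cuni * δ) * L := by
  obtain ⟨β, hβ⟩ := hb.exists_D_eq
  set p := D L (D L w.y)
  set q := D L w.b
  have hp : MemLp p 2 (mu L) := w.memH2_y.2.1
  have hq : MemLp q 2 (mu L) := w.memH1_b.1
  have hA := T.memLp_avgFun p
  have i1 := memLp_integrable_sq hp
  have i2 := memLp_integrable_sq hA
  have i3 := integrable_Qbar hA hq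
  have i12 : Integrable (fun x => ‖p x‖ ^ 2 - ‖T.avgFun p x‖ ^ 2) (mu L) := i1.sub i2
  have iR : Integrable (fun x => ‖p x‖ ^ 2 - ‖T.avgFun p x‖ ^ 2
      + 2 * Qbar ‖T.avgFun p x‖ ‖q x‖) (mu L) := i12.add (i3.const_mul 2)
  have hR : ∑ j : Fin T.N, ∫ x in (T.lft j)..(T.rgt j),
      (‖p x‖ ^ 2 - ‖T.avg p j‖ ^ 2 + 2 * Qbar ‖T.avg p j‖ ‖q x‖) =
      ((∫ x, ‖p x‖ ^ 2 ∂(mu L)) - ∫ x, ‖T.avgFun p x‖ ^ 2 ∂(mu L))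
        + 2 * ∫ x, Qbar ‖T.avgFun p x‖ ‖q x‖ ∂(mu L) := by
    rw [T.sum_integral_eq iR fun j x hx => by rw [T.avgFun_eq p hx],
      integral_add i12 (i3.const_mul 2), integral_sub i1 i2, integral_const_mul]
  -- On each element ψ is replaced by 2 Q̄ - α² - 5 β² with α = |𝒜_h y''| and β = |b'|, so that the
  -- terms 5|b'|² cancel; the error is controlled pointwise by `abs_psi_sub_le`.
  have hj : ∀ j : Fin T.N, |(∫ x in (T.lft j)..(T.rgt j),
      (‖p x‖ ^ 2 + 5 * ‖q x‖ ^ 2 + psi reg δ (‖T.avg p j‖ ^ 2) (‖q x‖ ^ 2))) -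
      ∫ x in (T.lft j)..(T.rgt j),
      (‖p x‖ ^ 2 - ‖T.avg p j‖ ^ 2 + 2 * Qbar ‖T.avg p j‖ ‖q x‖)| ≤ 3 * (cuni * δ) * T.len j := by
    intro j
    have k1 := T.intervalIntegrable_element i1 j
    have k2 := T.intervalIntegrable_element (memLp_integrable_sq hq) j
    have k3 : IntervalIntegrable (fun x => psi reg δ (‖T.avg p j‖ ^ 2) (‖q x‖ ^ 2)) volume
        (T.lft j) (T.rgt j) := by
      refine (intervalIntegrable_const (c := psi reg δ (‖T.avg p j‖ ^ 2) (‖β j‖ ^ 2))).congr_uIoo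
        fun x hx => ?_
      rw [Set.uIoo_of_le (T.lft_lt_rgt j).le] at hx
      simp only [hβ j x hx]
    have k4 : IntervalIntegrable (fun x => Qbar ‖T.avg p j‖ ‖q x‖) volume
        (T.lft j) (T.rgt j) :=
      T.intervalIntegrable_element (integrable_Qbar (memLp_const (T.avg p j)) hq) j
    rw [← intervalIntegral.integral_sub ((k1.add (k2.const_mul 5)).add k3)
      ((k1.sub (by simp)).add (k4.const_mul 2)), ← Real.norm_eq_abs]
    refine (intervalIntegral.norm_integral_le_of_norm_le_const (C := 3 * (cuni * δ))
      fun x _ => ?_).trans_eq (by rw [abs_of_pos (sub_pos.2 (T.lft_lt_rgt j)), len])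
    rw [Real.norm_eq_abs]
    refine le_trans (le_of_eq ?_) (abs_psi_sub_le hreg hδ (norm_nonneg (T.avg p j))
      (norm_nonneg (q x)))
    congr 1
    ring
  have hsum : |∑ j : Fin T.N, ((∫ x in (T.lft j)..(T.rgt j),
      (‖p x‖ ^ 2 + 5 * ‖q x‖ ^ 2 + psi reg δ (‖T.avg p j‖ ^ 2) (‖q x‖ ^ 2))) -
      ∫ x in (T.lft j)..(T.rgt j),
      (‖p x‖ ^ 2 - ‖T.avg p j‖ ^ 2 + 2 * Qbar ‖T.avg p j‖ ‖q x‖))| ≤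
      ∑ j : Fin T.N, 3 * (cuni * δ) * T.len j :=
    (Finset.abs_sum_le_sum_abs _ _).trans (Finset.sum_le_sum fun j _ => hj j)
  rw [Finset.sum_sub_distrib, hR, ← Finset.mul_sum, T.sum_len] at hsum
  rw [elastic]
  rw [abs_le] at hsum ⊢
  constructor <;> linarith [hsum.1, hsum.2]

theorem elastic_nonneg {reg : ℝ → ℝ → ℝ} {c₀ c₁ c₂ cuni δ : ℝ}
    (hreg : IsRegularizedModulus reg c₀ c₁ c₂ cuni) (hδ : 0 ≤ δ) (w : RibbonSpace L) :
    0 ≤ T.elastic reg δ w := by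
  refine mul_nonneg (by norm_num) (Finset.sum_nonneg fun j _ =>
    intervalIntegral.integral_nonneg (T.lft_lt_rgt j).le fun x _ => ?_)
  have := psi_nonneg hreg hδ (sq_nonneg ‖T.avg (D L (D L w.y)) j‖) (sq_nonneg ‖D L w.b x‖)
  positivity

theorem shearPenalty_nonneg (w : RibbonSpace L) : 0 ≤ T.shearPenalty w :=
  Finset.sum_nonneg fun j _ =>
    intervalIntegral.integral_nonneg (T.lft_lt_rgt j).le fun _ _ => sq_nonneg _

/-- The values at the left end points of the elements. -/
def lftFun (r : ℝ → E3) : ℝ → E3 := T.glue fun j _ => r (T.lft j)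

/-- The values at the right end points of the elements. -/
def rgtFun (r : ℝ → E3) : ℝ → E3 := T.glue fun j _ => r (T.rgt j)

theorem memLp_lftFun (r : ℝ → E3) : MemLp (T.lftFun r) 2 (mu L) :=
  T.memLp_glue fun _ => memLp_const _

theorem memLp_rgtFun (r : ℝ → E3) : MemLp (T.rgtFun r) 2 (mu L) :=
  T.memLp_glue fun _ => memLp_const _

theorem lftFun_eq (r : ℝ → E3) {j : Fin T.N} {x : ℝ}
    (hx : x ∈ Set.Ioc (T.lft j) (T.rgt j)) : T.lftFun r x = r (T.lft j) := T.glue_eq _ hx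

theorem rgtFun_eq (r : ℝ → E3) {j : Fin T.N} {x : ℝ}
    (hx : x ∈ Set.Ioc (T.lft j) (T.rgt j)) : T.rgtFun r x = r (T.rgt j) := T.glue_eq _ hx

/-- The midpoint averages. -/
def midFun (r : ℝ → E3) (x : ℝ) : E3 := (1 / 2 : ℝ) • (T.lftFun r x + T.rgtFun r x)

theorem midFun_eq (r : ℝ → E3) {j : Fin T.N} {x : ℝ}
    (hx : x ∈ Set.Ioc (T.lft j) (T.rgt j)) : T.midFun r x = T.mid r j := by
  rw [midFun, T.lftFun_eq r hx, T.rgtFun_eq r hx, mid]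

theorem memLp_midFun (r : ℝ → E3) : MemLp (T.midFun r) 2 (mu L) :=
  ((T.memLp_lftFun r).add (T.memLp_rgtFun r)).const_smul (1 / 2 : ℝ)

theorem norm_lftFun_sub_le {r : ℝ → E3} (hr : MemH1 L r) {h : ℝ} (hT : ∀ j, T.len j ≤ h)
    {x : ℝ} (hx : x ∈ Set.Ioc 0 L) :
    ‖T.lftFun r x - r x‖ ≤ √(h * ∫ t, ‖D L r t‖ ^ 2 ∂(mu L)) := by
  obtain ⟨j, hj⟩ := T.exists_mem_element hx
  rw [T.lftFun_eq r hj]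
  refine Real.le_sqrt_of_sq_le
    ((hr.norm_sub_sq_le (Set.Ioc_subset_Icc_self hx) (T.lft_mem j)).trans ?_)
  refine mul_le_mul_of_nonneg_right ?_ (integral_nonneg fun _ => sq_nonneg _)
  have := hT j
  unfold len at this
  rw [abs_le]
  constructor <;> linarith [hj.1, hj.2]

theorem norm_rgtFun_sub_le {r : ℝ → E3} (hr : MemH1 L r) {h : ℝ} (hT : ∀ j, T.len j ≤ h)
    {x : ℝ} (hx : x ∈ Set.Ioc 0 L) :
    ‖T.rgtFun r x - r x‖ ≤ √(h * ∫ t, ‖D L r t‖ ^ 2 ∂(mu L)) := by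
  obtain ⟨j, hj⟩ := T.exists_mem_element hx
  rw [T.rgtFun_eq r hj]
  refine Real.le_sqrt_of_sq_le
    ((hr.norm_sub_sq_le (Set.Ioc_subset_Icc_self hx) (T.rgt_mem j)).trans ?_)
  refine mul_le_mul_of_nonneg_right ?_ (integral_nonneg fun _ => sq_nonneg _)
  have := hT j
  unfold len at this
  rw [abs_le]
  constructor <;> linarith [hj.1, hj.2]

theorem norm_midFun_sub_le {r : ℝ → E3} (hr : MemH1 L r) {h : ℝ} (hT : ∀ j, T.len j ≤ h)
    {x : ℝ} (hx : x ∈ Set.Ioc 0 L) :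
    ‖T.midFun r x - r x‖ ≤ √(h * ∫ t, ‖D L r t‖ ^ 2 ∂(mu L)) := by
  have h1 := T.norm_lftFun_sub_le hr hT hx
  have h2 := T.norm_rgtFun_sub_le hr hT hx
  have he : T.midFun r x - r x =
      (1 / 2 : ℝ) • ((T.lftFun r x - r x) + (T.rgtFun r x - r x)) := by
    rw [midFun]; module
  rw [he, norm_smul, Real.norm_of_nonneg (by norm_num)]
  have := norm_add_le (T.lftFun r x - r x) (T.rgtFun r x - r x)
  linarith

theorem norm_midFun_le_one {r : ℝ → E3} (hr : ∀ i, ‖r (T.node i)‖ ≤ 1) {x : ℝ}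
    (hx : x ∈ Set.Ioc 0 L) : ‖T.midFun r x‖ ≤ 1 := by
  obtain ⟨j, hj⟩ := T.exists_mem_element hx
  rw [midFun, T.lftFun_eq r hj, T.rgtFun_eq r hj, norm_smul, Real.norm_of_nonneg (by norm_num)]
  have := norm_add_le (r (T.lft j)) (r (T.rgt j))
  have h1 : ‖r (T.lft j)‖ ≤ 1 := hr _
  have h2 : ‖r (T.rgt j)‖ ≤ 1 := hr _
  linarith

/-- Integrating a piecewise linear interpolant is the trapezoidal rule. Written with piecewise
constant end point values, the penalty becomes accessible to dominated convergence. -/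
theorem nodalPenalty_eq (w : RibbonSpace L) :
    T.nodalPenalty w = ∫ x, (1 / 2 : ℝ) * (⟪T.lftFun (D L w.y) x, T.lftFun w.b x⟫ ^ 2
      + ⟪T.rgtFun (D L w.y) x, T.rgtFun w.b x⟫ ^ 2) ∂(mu L) := by
  set g : ℝ → ℝ := fun s => ⟪D L w.y s, w.b s⟫ ^ 2
  have hi : MemLp (T.glue fun j _ => (1 / 2 : ℝ) * (g (T.lft j) + g (T.rgt j))) 1 (mu L) :=
    T.memLp_glue fun _ => memLp_const _
  have he : ∫ x, (1 / 2 : ℝ) * (⟪T.lftFun (D L w.y) x, T.lftFun w.b x⟫ ^ 2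
      + ⟪T.rgtFun (D L w.y) x, T.rgtFun w.b x⟫ ^ 2) ∂(mu L) =
      ∫ x, (T.glue fun j _ => (1 / 2 : ℝ) * (g (T.lft j) + g (T.rgt j))) x ∂(mu L) := by
    refine integral_congr_ae ?_
    filter_upwards [show ∀ᵐ x ∂(mu L), x ∈ Set.Ioc 0 L from ae_restrict_mem measurableSet_Ioc]
      with x hx
    obtain ⟨j, hj⟩ := T.exists_mem_element hx
    rw [T.glue_eq _ hj, T.lftFun_eq _ hj, T.lftFun_eq _ hj, T.rgtFun_eq _ hj, T.rgtFun_eq _ hj]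
  rw [he, ← T.sum_integral_eq (memLp_one_iff_integrable.1 hi) fun j x hx => T.glue_eq _ hx,
    nodalPenalty]
  refine Finset.sum_congr rfl fun j _ => ?_
  simp only [interp]
  rw [intervalIntegral.integral_add (by simp)
    (Continuous.intervalIntegrable (by fun_prop) _ _), intervalIntegral.integral_mul_const,
    intervalIntegral.integral_div, intervalIntegral.integral_sub (by simp) (by simp)]
  simp only [intervalIntegral.integral_const, integral_id, smul_eq_mul]
  have hl : T.rgt j - T.lft j ≠ 0 := (T.len_pos j).ne'
  change _ + _ / (T.rgt j - T.lft j) * (g (T.rgt j) - g (T.lft j)) = _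
  field_simp
  ring

theorem nodalPenalty_nonneg (w : RibbonSpace L) : 0 ≤ T.nodalPenalty w := by
  rw [nodalPenalty_eq]
  exact integral_nonneg fun x => by positivity

theorem memLp_inner_midFun {r : ℝ → E3} (hr : ∀ i, ‖r (T.node i)‖ ≤ 1) {q : ℝ → E3}
    (hq : MemLp q 2 (mu L)) : MemLp (fun x => ⟪T.midFun r x, q x⟫) 2 (mu L) := by
  refine hq.mono ((T.memLp_midFun r).1.inner hq.1) ?_
  filter_upwards [show ∀ᵐ x ∂(mu L), x ∈ Set.Ioc 0 L from ae_restrict_mem measurableSet_Ioc]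
    with x hx
  refine (abs_real_inner_le_norm _ _).trans ?_
  exact mul_le_of_le_one_left (norm_nonneg _) (T.norm_midFun_le_one hr hx)

theorem shearPenalty_eq (w : RibbonSpace L) (hr : ∀ i, ‖D L w.y (T.node i)‖ ≤ 1) :
    T.shearPenalty w = ∫ x, ⟪T.midFun (D L w.y) x, D L w.b x⟫ ^ 2 ∂(mu L) :=
  T.sum_integral_eq (T.memLp_inner_midFun hr w.memH1_b.1).integrable_sq
    fun j x hx => by rw [T.midFun_eq _ hx]

/-- Permits freezing the penalty parameter: lower bounds along ε₂ → 0 reduce to those for fixed ε.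
-/
theorem energyQuad_anti {reg : ℝ → ℝ → ℝ} {δ ε₁ ε₂ ε : ℝ} (hε₂ : 0 < ε₂) (hε : ε₂ ≤ ε)
    (w : RibbonSpace L) : T.energyQuad reg δ ε₁ ε w ≤ T.energyQuad reg δ ε₁ ε₂ w := by
  rw [energyQuad_eq, energyQuad_eq]
  have : 1 / (2 * ε) ≤ 1 / (2 * ε₂) := by gcongr
  have := mul_le_mul_of_nonneg_right this (T.shearPenalty_nonneg w)
  linarith

end Mesh

/-! ### Admissible frames -/

theorem E3.inner_eq (t b : E3) : ⟪t, b⟫ = t 0 * b 0 + t 1 * b 1 + t 2 * b 2 := by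
  simp [PiLp.inner_apply, Fin.sum_univ_three, mul_comm]

/-- Beyond the relations between t and b, orthogonality requires a unit third column, and the
determinant of the frame equals |t × b|². Both are supplied by Lagrange's identity |t × b|² = |t|²
|b|² - (t ⬝ b)². -/
theorem frameMatrix_mem_iff (t b : E3) :
    frameMatrix t b ∈ Matrix.specialOrthogonalGroup (Fin 3) ℝ ↔
      ‖t‖ = 1 ∧ ‖b‖ = 1 ∧ ⟪t, b⟫ = 0 := by
  have hn : ∀ v : E3, ‖v‖ = 1 ↔ v 0 * v 0 + v 1 * v 1 + v 2 * v 2 = 1 := fun v => by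
    rw [← E3.inner_eq, real_inner_self_eq_norm_sq,
      pow_eq_one_iff_of_nonneg (norm_nonneg _) two_ne_zero]
  rw [hn, hn, E3.inner_eq]
  have hM : frameMatrix t b = !![t 0, b 0, t 1 * b 2 - t 2 * b 1;
      t 1, b 1, t 2 * b 0 - t 0 * b 2; t 2, b 2, t 0 * b 1 - t 1 * b 0] := by
    ext i j
    fin_cases i <;> fin_cases j <;> simp [frameMatrix, cross_apply]
  rw [Matrix.mem_specialOrthogonalGroup_iff, Matrix.mem_orthogonalGroup_iff', hM,
    Matrix.det_fin_three]
  simp only [← Matrix.ext_iff, Fin.forall_fin_succ]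
  simp [Matrix.mul_apply, Fin.sum_univ_three]
  generalize t 0 = t0, t 1 = t1, t 2 = t2, b 0 = b0, b 1 = b1, b 2 = b2
  constructor
  · rintro ⟨⟨⟨h1, h2, -⟩, ⟨-, h3, -⟩, -⟩, -⟩
    exact ⟨h1, h3, h2⟩
  · rintro ⟨h1, h3, h2⟩
    have hc : (t1 * b2 - t2 * b1) ^ 2 + (t2 * b0 - t0 * b2) ^ 2 + (t0 * b1 - t1 * b0) ^ 2 = 1 := by
      linear_combination (b0 * b0 + b1 * b1 + b2 * b2) * h1 + h3
        - (t0 * b0 + t1 * b1 + t2 * b2) * h2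
    refine ⟨⟨⟨h1, h2, by ring⟩, ⟨by linarith, h3, by ring⟩, by ring, by ring, ?_⟩, ?_⟩ <;>
    linear_combination hc

section

variable {L : ℝ} {F : Type*} [NormedAddCommGroup F] [NormedSpace ℝ F]
  {Lbc : (Fin 6 → E3) →L[ℝ] F} {lbc : F}

theorem isAdmissibleFrame_iff {v : RibbonSpace L} :
    IsAdmissibleFrame Lbc lbc v ↔
      (∀ᵐ x ∂(mu L), ‖D L v.y x‖ = 1 ∧ ‖v.b x‖ = 1 ∧ ⟪D L v.y x, v.b x⟫ = 0) ∧
        Lbc (boundaryData v) = lbc := by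
  simp only [IsAdmissibleFrame, frameMatrix_mem_iff]

/-! ### Weak limits of discrete admissible pairs -/

theorem WeakConv.tendsto_y (hL : 0 < L) {w : ℕ → RibbonSpace L} {v : RibbonSpace L}
    (h : WeakConv w v) {x : ℝ} (hx : x ∈ Set.Icc 0 L) :
    Tendsto (fun n => (w n).y x) atTop (𝓝 (v.y x)) :=
  WeakL2.tendsto_apply hL (fun n => (w n).memH2_y.1) v.memH2_y.1 (h.1 0 (by norm_num))
    (h.1 1 (by norm_num)) hx

theorem WeakConv.tendsto_D_y (hL : 0 < L) {w : ℕ → RibbonSpace L} {v : RibbonSpace L}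
    (h : WeakConv w v) {x : ℝ} (hx : x ∈ Set.Icc 0 L) :
    Tendsto (fun n => D L (w n).y x) atTop (𝓝 (D L v.y x)) :=
  WeakL2.tendsto_apply hL (fun n => (w n).memH2_y.2) v.memH2_y.2 (h.1 1 (by norm_num))
    (h.1 2 (by norm_num)) hx

theorem WeakConv.tendsto_b (hL : 0 < L) {w : ℕ → RibbonSpace L} {v : RibbonSpace L}
    (h : WeakConv w v) {x : ℝ} (hx : x ∈ Set.Icc 0 L) :
    Tendsto (fun n => (w n).b x) atTop (𝓝 (v.b x)) :=
  WeakL2.tendsto_apply hL (fun n => (w n).memH1_b) v.memH1_b (h.2 0 (by norm_num))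
    (h.2 1 (by norm_num)) hx

theorem WeakConv.boundaryData_eq (hL : 0 < L) {w : ℕ → RibbonSpace L} {v : RibbonSpace L}
    (h : WeakConv w v) (hw : ∀ n, Lbc (boundaryData (w n)) = lbc) :
    Lbc (boundaryData v) = lbc := by
  have h0 : (0 : ℝ) ∈ Set.Icc 0 L := ⟨le_rfl, hL.le⟩
  have hLL : L ∈ Set.Icc 0 L := ⟨hL.le, le_rfl⟩
  have ht : Tendsto (fun n => boundaryData (w n)) atTop (𝓝 (boundaryData v)) := by
    rw [tendsto_pi_nhds]
    intro i
    fin_cases i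
    · exact h.tendsto_y hL h0
    · exact h.tendsto_y hL hLL
    · exact h.tendsto_D_y hL h0
    · exact h.tendsto_D_y hL hLL
    · exact h.tendsto_b hL h0
    · exact h.tendsto_b hL hLL
  have h2 := (Lbc.continuous.tendsto _).comp ht
  refine tendsto_nhds_unique h2 ?_
  simp only [Function.comp_def, hw]
  exact tendsto_const_nhds

/-- The end points of the element containing x are within distance h of x, and the Hölder bound is
uniform along a weakly convergent sequence. -/
theorem tendsto_endpointFun (hL : 0 < L) {T : ℕ → Mesh L} {h : ℕ → ℝ}
    (hT : ∀ n j, (T n).len j ≤ h n) (hh : Tendsto h atTop (𝓝 0))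
    {u : ℕ → ℝ → E3} {v : ℝ → E3} (hu : ∀ n, MemH1 L (u n))
    (h1 : WeakL2 L (fun n => D L (u n)) (D L v)) {x : ℝ} (hx : x ∈ Set.Ioc 0 L)
    (hx' : Tendsto (fun n => u n x) atTop (𝓝 (v x))) :
    Tendsto (fun n => (T n).lftFun (u n) x) atTop (𝓝 (v x)) ∧
      Tendsto (fun n => (T n).rgtFun (u n) x) atTop (𝓝 (v x)) := by
  obtain ⟨M, hM0, hM⟩ := h1.bounded hL.le fun n => (hu n).1
  have hh0 : ∀ n, 0 ≤ h n := fun n => by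
    obtain ⟨j, -⟩ := (T n).exists_mem_element hx
    exact ((T n).len_pos j).le.trans (hT n j)
  have hs : Tendsto (fun n => √(h n * M)) atTop (𝓝 0) := by
    simpa using (hh.mul_const M).sqrt
  have hle : ∀ n, √(h n * ∫ t, ‖D L (u n) t‖ ^ 2 ∂(mu L)) ≤ √(h n * M) := fun n =>
    Real.sqrt_le_sqrt (mul_le_mul_of_nonneg_left (hM n) (hh0 n))
  have hl : Tendsto (fun n => (T n).lftFun (u n) x - u n x) atTop (𝓝 0) :=
    squeeze_zero_norm (fun n => ((T n).norm_lftFun_sub_le (hu n) (hT n) hx).trans (hle n)) hs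
  have hr : Tendsto (fun n => (T n).rgtFun (u n) x - u n x) atTop (𝓝 0) :=
    squeeze_zero_norm (fun n => ((T n).norm_rgtFun_sub_le (hu n) (hT n) hx).trans (hle n)) hs
  constructor
  · simpa using hl.add hx'
  · simpa using hr.add hx'

/-- The constraint is imposed at the nodes only; it reaches an arbitrary x through the left end
points of the elements containing x. -/
theorem norm_eq_one_of_weakL2 (hL : 0 < L) {T : ℕ → Mesh L} {h : ℕ → ℝ}
    (hT : ∀ n j, (T n).len j ≤ h n) (hh : Tendsto h atTop (𝓝 0))
    {u : ℕ → ℝ → E3} {v : ℝ → E3} (hu : ∀ n, MemH1 L (u n))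
    (h1 : WeakL2 L (fun n => D L (u n)) (D L v))
    (hp : ∀ x ∈ Set.Icc 0 L, Tendsto (fun n => u n x) atTop (𝓝 (v x)))
    (hn : ∀ n i, ‖u n ((T n).node i)‖ = 1) {x : ℝ} (hx : x ∈ Set.Icc 0 L) : ‖v x‖ = 1 := by
  -- The point 0 lies in no half-open element, but it is a node of every mesh.
  rcases hx.1.eq_or_lt with rfl | hpos
  · refine tendsto_nhds_unique (hp 0 hx).norm (tendsto_const_nhds.congr fun n => ?_)
    have := hn n 0
    rw [(T n).node_zero] at this
    exact this.symm
  · have hx' : x ∈ Set.Ioc 0 L := ⟨hpos, hx.2⟩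
    have hl := (tendsto_endpointFun hL hT hh hu h1 hx' (hp x hx)).1
    refine tendsto_nhds_unique hl.norm (tendsto_const_nhds.congr fun n => ?_)
    obtain ⟨j, hj⟩ := (T n).exists_mem_element hx'
    rw [(T n).lftFun_eq _ hj]
    exact (hn n _).symm

theorem Mesh.IsDiscreteAdmissible.norm_D_y {T : Mesh L} {w : RibbonSpace L}
    (hw : T.IsDiscreteAdmissible Lbc lbc w) (i : Fin (T.N + 1)) : ‖D L w.y (T.node i)‖ = 1 :=
  (pow_eq_one_iff_of_nonneg (norm_nonneg _) two_ne_zero).1 (hw.2.2.1 i).1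

theorem Mesh.IsDiscreteAdmissible.norm_b {T : Mesh L} {w : RibbonSpace L}
    (hw : T.IsDiscreteAdmissible Lbc lbc w) (i : Fin (T.N + 1)) : ‖w.b (T.node i)‖ = 1 :=
  (pow_eq_one_iff_of_nonneg (norm_nonneg _) two_ne_zero).1 (hw.2.2.1 i).2

/-- Unit length of weak limits of discrete admissible pairs. -/
theorem WeakConv.norm_eq_one (hL : 0 < L) {T : ℕ → Mesh L} {h : ℕ → ℝ}
    (hT : ∀ n j, (T n).len j ≤ h n) (hh : Tendsto h atTop (𝓝 0))
    {w : ℕ → RibbonSpace L} {v : RibbonSpace L}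
    (hw : ∀ n, (T n).IsDiscreteAdmissible Lbc lbc (w n)) (hv : WeakConv w v) {x : ℝ}
    (hx : x ∈ Set.Icc 0 L) : ‖D L v.y x‖ = 1 ∧ ‖v.b x‖ = 1 :=
  ⟨norm_eq_one_of_weakL2 hL hT hh (fun n => (w n).memH2_y.2) (hv.1 2 le_rfl)
    (fun _ hx => hv.tendsto_D_y hL hx) (fun n i => (hw n).norm_D_y i) hx,
  norm_eq_one_of_weakL2 hL hT hh (fun n => (w n).memH1_b) (hv.2 1 le_rfl)
    (fun _ hx => hv.tendsto_b hL hx) (fun n i => (hw n).norm_b i) hx⟩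

theorem ae_mem_Ioc (L : ℝ) : ∀ᵐ x ∂(mu L), x ∈ Set.Ioc 0 L := ae_restrict_mem measurableSet_Ioc

/-- The orthogonality penalties converge. -/
theorem tendsto_nodalPenalty (hL : 0 < L) {T : ℕ → Mesh L} {h : ℕ → ℝ}
    (hT : ∀ n j, (T n).len j ≤ h n) (hh : Tendsto h atTop (𝓝 0))
    {w : ℕ → RibbonSpace L} {v : RibbonSpace L}
    (hw : ∀ n, (T n).IsDiscreteAdmissible Lbc lbc (w n)) (hv : WeakConv w v) :
    Tendsto (fun n => (T n).nodalPenalty (w n)) atTop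
      (𝓝 (∫ x, ⟪D L v.y x, v.b x⟫ ^ 2 ∂(mu L))) := by
  simp_rw [Mesh.nodalPenalty_eq]
  refine tendsto_integral_of_dominated_convergence (fun _ => 1) (fun n => ?_)
    (integrable_const _) (fun n => ?_) ?_
  · exact (((((T n).memLp_lftFun _).1.inner ((T n).memLp_lftFun _).1).pow 2).add
      ((((T n).memLp_rgtFun _).1.inner ((T n).memLp_rgtFun _).1).pow 2)).const_mul _
  · filter_upwards [ae_mem_Ioc L] with x hx
    obtain ⟨j, hj⟩ := (T n).exists_mem_element hx
    have key : ∀ i, ⟪D L (w n).y ((T n).node i), (w n).b ((T n).node i)⟫ ^ 2 ≤ 1 := fun i => by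
      have := abs_real_inner_le_norm (D L (w n).y ((T n).node i)) ((w n).b ((T n).node i))
      rw [(hw n).norm_D_y, (hw n).norm_b, one_mul] at this
      exact (sq_le_one_iff_abs_le_one _).2 this
    rw [Real.norm_of_nonneg (by positivity), (T n).lftFun_eq _ hj, (T n).lftFun_eq _ hj,
      (T n).rgtFun_eq _ hj, (T n).rgtFun_eq _ hj]
    have h1 := key j.castSucc
    have h2 := key j.succ
    simp only [Mesh.lft, Mesh.rgt]
    linarith
  · filter_upwards [ae_mem_Ioc L] with x hx
    have hx' := Set.Ioc_subset_Icc_self hx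
    obtain ⟨a1, a2⟩ := tendsto_endpointFun hL hT hh (fun n => (w n).memH2_y.2) (hv.1 2 le_rfl) hx
      (hv.tendsto_D_y hL hx')
    obtain ⟨b1, b2⟩ := tendsto_endpointFun hL hT hh (fun n => (w n).memH1_b) (hv.2 1 le_rfl) hx
      (hv.tendsto_b hL hx')
    have := (((a1.inner b1).pow 2).add ((a2.inner b2).pow 2)).const_mul (1 / 2 : ℝ)
    convert this using 2
    ring

/-- Products of pointwise convergent unit fields and weakly convergent fields. -/
theorem tendsto_integral_mul_inner (hL : 0 ≤ L) {r : ℕ → ℝ → E3} {s : ℝ → E3} {f : ℕ → ℝ → E3}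
    {p : ℝ → E3} {g : ℝ → ℝ} (hg : MemLp g 2 (mu L))
    (hr : ∀ n, AEStronglyMeasurable (r n) (mu L)) (hs : AEStronglyMeasurable s (mu L))
    (hr1 : ∀ n, ∀ᵐ x ∂(mu L), ‖r n x‖ ≤ 1) (hs1 : ∀ᵐ x ∂(mu L), ‖s x‖ ≤ 1)
    (hrs : ∀ᵐ x ∂(mu L), Tendsto (fun n => r n x) atTop (𝓝 (s x)))
    (hf : ∀ n, MemLp (f n) 2 (mu L)) (hfp : WeakL2 L f p) :
    Tendsto (fun n => ∫ x, g x * ⟪r n x, f n x⟫ ∂(mu L)) atTop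
      (𝓝 (∫ x, g x * ⟪s x, p x⟫ ∂(mu L))) := by
  have hmem : ∀ {q : ℝ → E3}, AEStronglyMeasurable q (mu L) → (∀ᵐ x ∂(mu L), ‖q x‖ ≤ 1) →
      MemLp (fun x => g x • q x) 2 (mu L) := fun hq hq1 =>
    hg.mono (hg.1.smul hq) (by
      filter_upwards [hq1] with x hx
      rw [norm_smul]
      exact mul_le_of_le_one_right (norm_nonneg _) hx)
  -- Moving g to the unit fields makes g r_n strongly convergent in L², with majorant 4 g² since
  -- |r_n - s| ≤ 2; the claim becomes a weak-strong product.
  have hc : Tendsto (fun n => ∫ x, ‖g x • r n x - g x • s x‖ ^ 2 ∂(mu L)) atTop (𝓝 0) := by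
    have h0 : (0 : ℝ) = ∫ x, (0 : ℝ) ∂(mu L) := by simp
    rw [h0]
    refine tendsto_integral_of_dominated_convergence (fun x => 4 * g x ^ 2) (fun n => ?_)
      (hg.integrable_sq.const_mul 4) (fun n => ?_) ?_
    · exact ((hmem (hr n) (hr1 n)).1.sub (hmem hs hs1).1).norm.pow 2
    · filter_upwards [hr1 n, hs1] with x h1 h2
      have := norm_sub_le (r n x) (s x)
      rw [Real.norm_of_nonneg (sq_nonneg _), ← smul_sub, norm_smul, mul_pow, Real.norm_eq_abs,
        sq_abs, mul_comm]
      refine mul_le_mul_of_nonneg_right ?_ (sq_nonneg _)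
      nlinarith [norm_nonneg (r n x - s x)]
    · filter_upwards [hrs] with x hx
      have := ((hx.const_smul (g x)).sub_const (g x • s x)).norm.pow 2
      simpa using this
  have := hfp.tendsto_inner hL hf (fun n => hmem (hr n) (hr1 n)) (hmem hs hs1) hc
  simpa only [inner_smul_right, real_inner_comm] using this

theorem energy_eq (hL : 0 ≤ L) (v : RibbonSpace L) :
    energy v = ∫ x, Qbar ‖D L (D L v.y) x‖ ‖D L v.b x‖ ∂(mu L) :=
  intervalIntegral.integral_of_le hL

theorem energyPen_eq (hL : 0 ≤ L) (ε : ℝ) (v : RibbonSpace L) :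
    energyPen ε v = energy v + 1 / (2 * ε) * ∫ x, ⟪D L v.y x, D L v.b x⟫ ^ 2 ∂(mu L) := by
  rw [energyPen, intervalIntegral.integral_of_le hL]; rfl

theorem memLp_inner_of_norm_le_one {r q : ℝ → E3} (hr : AEStronglyMeasurable r (mu L))
    (hr1 : ∀ᵐ x ∂(mu L), ‖r x‖ ≤ 1) (hq : MemLp q 2 (mu L)) :
    MemLp (fun x => ⟪r x, q x⟫) 2 (mu L) := by
  refine hq.mono (hr.inner hq.1) ?_
  filter_upwards [hr1] with x hx
  exact (abs_real_inner_le_norm _ _).trans (mul_le_of_le_one_left (norm_nonneg _) hx)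

theorem integral_inner_comm (f g : ℝ → E3) :
    ∫ x, ⟪f x, g x⟫ ∂(mu L) = ∫ x, ⟪g x, f x⟫ ∂(mu L) :=
  integral_congr_ae (ae_of_all _ fun _ => real_inner_comm _ _)

/-- Weak lower semicontinuity along bounded sequences of discrete admissible pairs. -/
theorem energyPen_le_of_weakConv (hL : 0 < L) {reg : ℝ → ℝ → ℝ} {c₀ c₁ c₂ cuni : ℝ}
    (hreg : IsRegularizedModulus reg c₀ c₁ c₂ cuni) {T : ℕ → Mesh L} {h : ℕ → ℝ}
    (hT : ∀ n j, (T n).len j ≤ h n) (hh : Tendsto h atTop (𝓝 0))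
    {δ ε₁ : ℕ → ℝ} (hδ : ∀ n, 0 ≤ δ n) (hδ0 : Tendsto δ atTop (𝓝 0))
    (hε₁ : ∀ n, 0 < ε₁ n) (hε₁0 : Tendsto ε₁ atTop (𝓝 0)) {ε : ℝ} (hε : 0 < ε)
    {w : ℕ → RibbonSpace L} {v : RibbonSpace L}
    (hw : ∀ n, (T n).IsDiscreteAdmissible Lbc lbc (w n)) (hv : WeakConv w v) {C : ℝ}
    (hC : ∀ n, (T n).energyQuad reg (δ n) (ε₁ n) ε (w n) ≤ C) :
    IsAdmissibleFrame Lbc lbc v ∧ energyPen ε v ≤ C := by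
  have hunit := fun x hx => hv.norm_eq_one hL hT hh hw (x := x) hx
  have hmid : ∀ n i, ‖D L (w n).y ((T n).node i)‖ ≤ 1 := fun n i => ((hw n).norm_D_y i).le
  have hpv : MemLp (D L (D L v.y)) 2 (mu L) := v.memH2_y.2.1
  have hqv : MemLp (D L v.b) 2 (mu L) := v.memH1_b.1
  have hpw : ∀ n, MemLp (D L (D L (w n).y)) 2 (mu L) := fun n => (w n).memH2_y.2.1
  have hqw : ∀ n, MemLp (D L (w n).b) 2 (mu L) := fun n => (w n).memH1_b.1
  have hDy : MemLp (D L v.y) 2 (mu L) := v.memH2_y.1.1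
  have hunit1 : ∀ᵐ x ∂(mu L), ‖D L v.y x‖ ≤ 1 := by
    filter_upwards [ae_mem_Ioc L] with x hx
    exact (hunit x (Set.Ioc_subset_Icc_self hx)).1.le
  constructor
  · refine isAdmissibleFrame_iff.2 ⟨?_, hv.boundaryData_eq hL fun n => (hw n).2.2.2⟩
    have h1 := tendsto_nodalPenalty hL hT hh hw hv
    have h2 : Tendsto (fun n => 2 * ε₁ n * C) atTop (𝓝 0) := by
      simpa using (hε₁0.const_mul 2).mul_const C
    -- The nodal penalty is at most 2 ε₁ C, and it converges to ∫ (y' ⬝ b)².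
    have h3 : ∫ x, ⟪D L v.y x, v.b x⟫ ^ 2 ∂(mu L) ≤ 0 := by
      refine le_of_tendsto_of_tendsto' h1 h2 fun n => ?_
      have e1 := hC n
      rw [Mesh.energyQuad_eq] at e1
      have e2 := (T n).elastic_nonneg hreg (hδ n) (w n)
      have e3 : 0 ≤ 1 / (2 * ε) * (T n).shearPenalty (w n) :=
        mul_nonneg (by positivity) ((T n).shearPenalty_nonneg _)
      have e4 : 1 / (2 * ε₁ n) * (T n).nodalPenalty (w n) ≤ C := by linarith
      have hp : 0 < 2 * ε₁ n := mul_pos two_pos (hε₁ n)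
      rwa [one_div, inv_mul_le_iff₀ hp] at e4
    have hbm : MemLp v.b 2 (mu L) := memLp_of_continuousOn (v.memH1_b.continuousOn hL)
    have hi := (memLp_inner_of_norm_le_one hDy.1 hunit1 hbm).integrable_sq
    have h4 := (integral_eq_zero_iff_of_nonneg (fun x => sq_nonneg _) hi).1
      (le_antisymm h3 (integral_nonneg fun x => sq_nonneg _))
    filter_upwards [h4, ae_mem_Ioc L] with x hx hxm
    obtain ⟨a, b⟩ := hunit x (Set.Ioc_subset_Icc_self hxm)
    exact ⟨a, b, by simpa using hx⟩
  · set ξ := fun x => subgradFst (D L (D L v.y) x) (D L v.b x)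
    set η := fun x => subgradSnd (D L (D L v.y) x) (D L v.b x)
    set g := fun x => ⟪D L v.y x, D L v.b x⟫ with hg
    have hξ : MemLp ξ 2 (mu L) := memLp_subgradFst hpv hqv
    have hη : MemLp η 2 (mu L) := memLp_subgradSnd hpv hqv
    have hgm : MemLp g 2 (mu L) := memLp_inner_of_norm_le_one hDy.1 hunit1 hqv
    have t1 : Tendsto (fun n => ∫ x, ⟪ξ x, (T n).avgFun (D L (D L (w n).y)) x⟫ ∂(mu L)) atTop
        (𝓝 (∫ x, ⟪ξ x, D L (D L v.y) x⟫ ∂(mu L))) := by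
      -- By symmetry the averaging is moved from the weakly convergent y_h'' to the fixed field ξ,
      -- where it converges strongly.
      have hA : Tendsto (fun n => ∫ x, ‖(T n).avgFun ξ x - ξ x‖ ^ 2 ∂(mu L)) atTop (𝓝 0) := by
        simpa only [norm_sub_rev] using tendsto_integral_sub_avgFun hT hh hξ
      have := WeakL2.tendsto_inner hL.le (hv.1 2 le_rfl) hpw
        (fun n => (T n).memLp_avgFun ξ) hξ hA
      rw [integral_inner_comm ξ]
      refine this.congr fun n => ?_
      rw [← (T n).integral_inner_avgFun hξ (hpw n)]
      exact integral_inner_comm _ _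
    have t2 : Tendsto (fun n => ∫ x, ⟪η x, D L (w n).b x⟫ ∂(mu L)) atTop
        (𝓝 (∫ x, ⟪η x, D L v.b x⟫ ∂(mu L))) := by
      have := (weakL2_iff hL.le _ _).1 (hv.2 1 le_rfl) η hη
      rw [integral_inner_comm η]
      exact this.congr fun n => integral_inner_comm _ _
    have t3 : Tendsto (fun n => ∫ x, g x * ⟪(T n).midFun (D L (w n).y) x, D L (w n).b x⟫ ∂(mu L))
        atTop (𝓝 (∫ x, g x * ⟪D L v.y x, D L v.b x⟫ ∂(mu L))) := by
      refine tendsto_integral_mul_inner hL.le hgm (fun n => ((T n).memLp_midFun _).1) hDy.1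
        (fun n => ?_) hunit1 ?_ hqw (hv.2 1 le_rfl)
      · filter_upwards [ae_mem_Ioc L] with x hx using (T n).norm_midFun_le_one (hmid n) hx
      · filter_upwards [ae_mem_Ioc L] with x hx
        obtain ⟨a1, a2⟩ := tendsto_endpointFun hL hT hh (fun n => (w n).memH2_y.2)
          (hv.1 2 le_rfl) hx (hv.tendsto_D_y hL (Set.Ioc_subset_Icc_self hx))
        have := (a1.add a2).const_smul (1 / 2 : ℝ)
        have e : (1 / 2 : ℝ) • (D L v.y x + D L v.y x) = D L v.y x := by module
        rw [e] at this
        exact this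
    have t4 : Tendsto (fun n => 3 / 2 * (cuni * δ n) * L) atTop (𝓝 0) := by
      simpa using ((hδ0.const_mul cuni).const_mul (3 / 2)).mul_const L
    have hlim := (((t1.add t2).sub_const (energy v)).sub t4).add
      (((t3.const_mul 2).sub_const (∫ x, g x ^ 2 ∂(mu L))).const_mul (1 / (2 * ε)))
    -- At the limit itself both minorants are sharp: Euler's relation gives 2 E - E, and 2 g² - g² =
    -- g².
    have hval : (∫ x, ⟪ξ x, D L (D L v.y) x⟫ ∂(mu L)) + (∫ x, ⟪η x, D L v.b x⟫ ∂(mu L)) - energy v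
        - 0 + 1 / (2 * ε) * (2 * (∫ x, g x * ⟪D L v.y x, D L v.b x⟫ ∂(mu L))
          - ∫ x, g x ^ 2 ∂(mu L)) = energyPen ε v := by
      rw [integral_inner_subgrad_self hpv hqv, energyPen_eq hL.le, energy_eq hL.le]
      have : ∀ x, g x * ⟪D L v.y x, D L v.b x⟫ = g x ^ 2 := fun x => by rw [sq]
      simp_rw [this]
      simp only [hg]
      ring
    rw [hval] at hlim
    refine le_of_tendsto' hlim fun n => le_trans ?_ (hC n)
    have e1 := (abs_le.1 ((T n).abs_elastic_sub_le hreg (hδ n) (w n) (hw n).2.1)).1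
    have e2 := (T n).integral_norm_avgFun_sq_le (hpw n)
    have e3 := integral_subgrad_le hpv hqv ((T n).memLp_avgFun (D L (D L (w n).y))) (hqw n)
    have e4 : 0 ≤ 1 / (2 * ε₁ n) * (T n).nodalPenalty (w n) :=
      mul_nonneg (by have := hε₁ n; positivity) ((T n).nodalPenalty_nonneg _)
    -- The affine minorant m² ≥ 2 g m - g² of the square at the shear g of the limit; only this
    -- linear expression needs to pass to the limit.
    have e5 : 2 * (∫ x, g x * ⟪(T n).midFun (D L (w n).y) x, D L (w n).b x⟫ ∂(mu L))
        - ∫ x, g x ^ 2 ∂(mu L) ≤ (T n).shearPenalty (w n) := by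
      rw [(T n).shearPenalty_eq (w n) (hmid n)]
      have hm := (T n).memLp_inner_midFun (hmid n) (hqw n)
      have hi : Integrable (fun x => g x * ⟪(T n).midFun (D L (w n).y) x, D L (w n).b x⟫) (mu L) :=
        hgm.integrable_mul hm
      rw [← integral_const_mul, ← integral_sub (hi.const_mul 2) hgm.integrable_sq]
      refine integral_mono ((hi.const_mul 2).sub hgm.integrable_sq) hm.integrable_sq fun x => ?_
      simp only
      nlinarith [sq_nonneg (g x - ⟪(T n).midFun (D L (w n).y) x, D L (w n).b x⟫)]
    have e6 := mul_le_mul_of_nonneg_left e5 (show 0 ≤ 1 / (2 * ε) by positivity)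
    rw [Mesh.energyQuad_eq]
    rw [← energy_eq hL.le] at e3
    linarith

end

/-! ### Recovery sequences -/

section

variable {L : ℝ} {F : Type*} [NormedAddCommGroup F] [NormedSpace ℝ F]
  {Lbc : (Fin 6 → E3) →L[ℝ] F} {lbc : F}

theorem MemH1.sub (hL : 0 < L) {u v : ℝ → E3} (hu : MemH1 L u) (hv : MemH1 L v) :
    MemH1 L (fun x => u x - v x) := by
  refine (memH1_of_primitive (hu.1.sub hv.1) hL (u 0 - v 0) fun x hx => ?_).1
  have h0 : (0 : ℝ) ∈ Set.Icc 0 L := ⟨le_rfl, hL.le⟩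
  simp only [Pi.sub_apply]
  rw [intervalIntegral.integral_sub
    (intervalIntegrable_of_integrable_mu (memLp_integrable hu.1) h0 hx)
    (intervalIntegrable_of_integrable_mu (memLp_integrable hv.1) h0 hx), hu.2 x hx, hv.2 x hx]
  abel

theorem MemH2.sub (hL : 0 < L) {u v : ℝ → E3} (hu : MemH2 L u) (hv : MemH2 L v) :
    MemH2 L (fun x => u x - v x) := by
  refine ⟨hu.1.sub hL hv.1, ?_⟩
  have h := hu.2.sub hL hv.2
  refine (memH1_of_primitive h.1 hL (D L u 0 - D L v 0) fun x hx => ?_).1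
  rw [hu.D_sub hL hv hx]
  exact h.2 x hx

/-- A Poincaré inequality. Interpolants agree with their limit at 0, so convergence of the highest
derivatives controls the full norms. -/
theorem MemH1.integral_norm_sq_le (hL : 0 < L) {u : ℝ → E3} (hu : MemH1 L u) (h0 : u 0 = 0) :
    ∫ x, ‖u x‖ ^ 2 ∂(mu L) ≤ L ^ 2 * ∫ x, ‖D L u x‖ ^ 2 ∂(mu L) := by
  have hz : (0 : ℝ) ∈ Set.Icc 0 L := ⟨le_rfl, hL.le⟩
  have hi := memLp_integrable_sq (memLp_of_continuousOn (hu.continuousOn hL))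
  refine (integral_mono_ae hi (integrable_const (L * ∫ x, ‖D L u x‖ ^ 2 ∂(mu L))) ?_).trans_eq ?_
  · filter_upwards [ae_mem_Ioc L] with x hx
    have h := hu.norm_sub_sq_le hz (Set.Ioc_subset_Icc_self hx)
    rw [h0, sub_zero, sub_zero, abs_of_pos hx.1] at h
    exact h.trans (mul_le_mul_of_nonneg_right hx.2 (integral_nonneg fun _ => sq_nonneg _))
  · simp [mu, hL.le]
    ring

theorem tendsto_hNorm_one (hL : 0 < L) {u : ℕ → ℝ → E3} (hu : ∀ n, MemH1 L (u n))
    (h0 : ∀ n, u n 0 = 0)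
    (h : Tendsto (fun n => ∫ x, ‖D L (u n) x‖ ^ 2 ∂(mu L)) atTop (𝓝 0)) :
    Tendsto (fun n => hNorm L 1 (u n)) atTop (𝓝 0) := by
  rw [tendsto_hNorm_zero_iff]
  intro i hi
  interval_cases i
  · refine (tendsto_integral_norm_sq_zero_iff
      fun n => memLp_of_continuousOn ((hu n).continuousOn hL)).1 ?_
    refine squeeze_zero (fun n => integral_nonneg fun _ => sq_nonneg _)
      (fun n => (hu n).integral_norm_sq_le hL (h0 n)) ?_
    simpa using h.const_mul (L ^ 2)
  · exact (tendsto_integral_norm_sq_zero_iff fun n => (hu n).1).1 h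

theorem tendsto_hNorm_two (hL : 0 < L) {u : ℕ → ℝ → E3} (hu : ∀ n, MemH2 L (u n))
    (h0 : ∀ n, u n 0 = 0) (h1 : ∀ n, D L (u n) 0 = 0)
    (h : Tendsto (fun n => ∫ x, ‖D L (D L (u n)) x‖ ^ 2 ∂(mu L)) atTop (𝓝 0)) :
    Tendsto (fun n => hNorm L 2 (u n)) atTop (𝓝 0) := by
  have hD : Tendsto (fun n => ∫ x, ‖D L (u n) x‖ ^ 2 ∂(mu L)) atTop (𝓝 0) := by
    refine squeeze_zero (fun n => integral_nonneg fun _ => sq_nonneg _)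
      (fun n => (hu n).2.integral_norm_sq_le hL (h1 n)) ?_
    simpa using h.const_mul (L ^ 2)
  have hone := tendsto_hNorm_zero_iff.1 (tendsto_hNorm_one hL (fun n => (hu n).1) h0 hD)
  rw [tendsto_hNorm_zero_iff]
  intro i hi
  rcases Nat.lt_or_ge 1 i with h2 | h2
  · obtain rfl : i = 2 := by omega
    exact (tendsto_integral_norm_sq_zero_iff fun n => (hu n).2.1).1 h
  · exact hone i h2

theorem strongConv_of_tendsto (hL : 0 < L) {w : ℕ → RibbonSpace L} {v : RibbonSpace L}
    (hy : ∀ n, (w n).y 0 = v.y 0) (hDy : ∀ n, D L (w n).y 0 = D L v.y 0)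
    (hb : ∀ n, (w n).b 0 = v.b 0)
    (h2 : Tendsto (fun n => ∫ x, ‖D L (D L (w n).y) x - D L (D L v.y) x‖ ^ 2 ∂(mu L))
      atTop (𝓝 0))
    (h1 : Tendsto (fun n => ∫ x, ‖D L (w n).b x - D L v.b x‖ ^ 2 ∂(mu L)) atTop (𝓝 0)) :
    StrongConv w v := by
  constructor
  · refine tendsto_hNorm_two hL (fun n => (w n).memH2_y.sub hL v.memH2_y)
      (fun n => by rw [hy, sub_self]) (fun n => ?_) (h2.congr fun n => ?_)
    · rw [(w n).memH2_y.D_sub hL v.memH2_y ⟨le_rfl, hL.le⟩, hDy, sub_self]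
    · refine integral_congr_ae ?_
      filter_upwards [(w n).memH2_y.ae_DD_sub hL v.memH2_y] with x hx
      rw [hx]
  · refine tendsto_hNorm_one hL (fun n => (w n).memH1_b.sub hL v.memH1_b)
      (fun n => by rw [hb, sub_self]) (h1.congr fun n => ?_)
    refine integral_congr_ae ?_
    filter_upwards [(w n).memH1_b.ae_D_sub hL v.memH1_b] with x hx
    rw [hx]

/-- Continuity of the elastic energy with respect to strong convergence in `L²`. -/
theorem tendsto_integral_Qbar {p q : ℕ → ℝ → E3} {p₀ q₀ : ℝ → E3}
    (hp : ∀ n, MemLp (p n) 2 (mu L)) (hq : ∀ n, MemLp (q n) 2 (mu L))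
    (hp₀ : MemLp p₀ 2 (mu L)) (hq₀ : MemLp q₀ 2 (mu L))
    (h1 : Tendsto (fun n => ∫ x, ‖p n x - p₀ x‖ ^ 2 ∂(mu L)) atTop (𝓝 0))
    (h2 : Tendsto (fun n => ∫ x, ‖q n x - q₀ x‖ ^ 2 ∂(mu L)) atTop (𝓝 0)) :
    Tendsto (fun n => ∫ x, Qbar ‖p n x‖ ‖q n x‖ ∂(mu L)) atTop
      (𝓝 (∫ x, Qbar ‖p₀ x‖ ‖q₀ x‖ ∂(mu L))) := by
  have hQ : ∀ a b : E3, Qbar ‖a‖ ‖b‖ = ‖gam ‖a‖ ‖b‖‖ ^ 2 := fun a b => by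
    rw [Real.norm_eq_abs, sq_abs, Qbar_eq (norm_nonneg _) (norm_nonneg _)]
  simp_rw [hQ]
  refine tendsto_integral_norm_sq (fun n => memLp_gam (hp n) (hq n)) (memLp_gam hp₀ hq₀) ?_
  -- The Lipschitz bound for `gam` is used in the form (a + 2 b)² ≤ 2 a² + 8 b².
  have h3 := (h1.const_mul 2).add (h2.const_mul 8)
  simp only [mul_zero, add_zero] at h3
  refine squeeze_zero (fun n => integral_nonneg fun _ => sq_nonneg _) (fun n => ?_) h3
  have i1 : Integrable (fun x => 2 * ‖p n x - p₀ x‖ ^ 2) (mu L) :=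
    (memLp_integrable_sq ((hp n).sub hp₀)).const_mul 2
  have i2 : Integrable (fun x => 8 * ‖q n x - q₀ x‖ ^ 2) (mu L) :=
    (memLp_integrable_sq ((hq n).sub hq₀)).const_mul 8
  rw [← integral_const_mul, ← integral_const_mul, ← integral_add i1 i2]
  refine integral_mono (memLp_integrable_sq ((memLp_gam (hp n) (hq n)).sub (memLp_gam hp₀ hq₀)))
    (i1.add i2) fun x => ?_
  have h := abs_gam_sub_le (norm_nonneg (p n x)) (norm_nonneg (q n x)) (norm_nonneg (p₀ x))
    (norm_nonneg (q₀ x))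
  have h4 := abs_norm_sub_norm_le (p n x) (p₀ x)
  have h5 := abs_norm_sub_norm_le (q n x) (q₀ x)
  change ‖gam ‖p n x‖ ‖q n x‖ - gam ‖p₀ x‖ ‖q₀ x‖‖ ^ 2 ≤
    2 * ‖p n x - p₀ x‖ ^ 2 + 8 * ‖q n x - q₀ x‖ ^ 2
  rw [Real.norm_eq_abs]
  have h6 : |gam ‖p n x‖ ‖q n x‖ - gam ‖p₀ x‖ ‖q₀ x‖| ≤ ‖p n x - p₀ x‖ + 2 * ‖q n x - q₀ x‖ := by
    linarith
  have h7 := pow_le_pow_left₀ (abs_nonneg _) h6 2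
  nlinarith [sq_nonneg (‖p n x - p₀ x‖ - 2 * ‖q n x - q₀ x‖)]

/-- The relations defining an admissible frame hold everywhere. -/
theorem IsAdmissibleFrame.forall_mem (hL : 0 < L) {v : RibbonSpace L}
    (hv : IsAdmissibleFrame Lbc lbc v) {x : ℝ} (hx : x ∈ Set.Icc 0 L) :
    ‖D L v.y x‖ = 1 ∧ ‖v.b x‖ = 1 ∧ ⟪D L v.y x, v.b x⟫ = 0 := by
  have h := (isAdmissibleFrame_iff.1 hv).1
  have hmu : mu L = volume.restrict (Set.Icc 0 L) := Measure.restrict_congr_set Ioc_ae_eq_Icc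
  rw [hmu] at h
  have hy := v.memH2_y.2.continuousOn hL
  have hb := v.memH1_b.continuousOn hL
  have e1 := Measure.eqOn_Icc_of_ae_eq volume hL.ne (h.mono fun _ hx => hx.1) hy.norm
    continuousOn_const
  have e2 := Measure.eqOn_Icc_of_ae_eq volume hL.ne (h.mono fun _ hx => hx.2.1) hb.norm
    continuousOn_const
  have e3 := Measure.eqOn_Icc_of_ae_eq volume hL.ne (h.mono fun _ hx => hx.2.2) (hy.inner hb)
    continuousOn_const
  exact ⟨e1 hx, e2 hx, e3 hx⟩

namespace Mesh

/-- The nodal interpolant of a pair `(y, b)`. -/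
def interpolant (T : Mesh L) (hL : 0 < L) (v : RibbonSpace L) : RibbonSpace L where
  y := T.hermite v.y
  b := T.linInterp v.b
  memH2_y := (T.memH2_hermite hL v.y).1
  memH1_b := (T.memH1_linInterp hL v.b).1

variable (T : Mesh L) (hL : 0 < L)

theorem interpolant_y_node (v : RibbonSpace L) (i : Fin (T.N + 1)) :
    (T.interpolant hL v).y (T.node i) = v.y (T.node i) := T.hermite_node hL v.memH2_y i

theorem interpolant_D_y_node (v : RibbonSpace L) (i : Fin (T.N + 1)) :
    D L (T.interpolant hL v).y (T.node i) = D L v.y (T.node i) :=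
  T.D_hermite_node hL v.memH2_y i

theorem interpolant_b_node (v : RibbonSpace L) (i : Fin (T.N + 1)) :
    (T.interpolant hL v).b (T.node i) = v.b (T.node i) := T.linInterp_node v.memH1_b i

theorem boundaryData_interpolant (v : RibbonSpace L) :
    boundaryData (T.interpolant hL v) = boundaryData v := by
  have y0 := T.interpolant_y_node hL v 0
  have yL := T.interpolant_y_node hL v (Fin.last _)
  have d0 := T.interpolant_D_y_node hL v 0
  have dL := T.interpolant_D_y_node hL v (Fin.last _)
  have b0 := T.interpolant_b_node hL v 0
  have bL := T.interpolant_b_node hL v (Fin.last _)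
  rw [T.node_zero] at y0 d0 b0
  rw [T.node_last] at yL dL bL
  simp only [boundaryData, y0, yL, d0, dL, b0, bL]

theorem isDiscreteAdmissible_interpolant {v : RibbonSpace L} (hv : IsAdmissibleFrame Lbc lbc v) :
    T.IsDiscreteAdmissible Lbc lbc (T.interpolant hL v) := by
  refine ⟨T.isSpline_hermite hL v.memH2_y, T.isSpline_linInterp hL v.memH1_b, fun i => ?_, ?_⟩
  · obtain ⟨h1, h2, -⟩ := hv.forall_mem hL (T.node_mem i)
    rw [T.interpolant_D_y_node, T.interpolant_b_node, h1, h2]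
    norm_num
  · rw [T.boundaryData_interpolant]
    exact hv.2

theorem ae_DD_interpolant (v : RibbonSpace L) :
    D L (D L (T.interpolant hL v).y) =ᵐ[mu L] T.hermSnd v.y := (T.memH2_hermite hL v.y).2.2

theorem ae_D_interpolant_b (v : RibbonSpace L) :
    D L (T.interpolant hL v).b =ᵐ[mu L] T.avgFun (D L v.b) := (T.memH1_linInterp hL v.b).2

theorem avgFun_interpolant (v : RibbonSpace L) :
    T.avgFun (D L (D L (T.interpolant hL v).y)) = T.avgFun (D L (D L v.y)) := by
  have : ∀ j, T.avg (D L (D L (T.interpolant hL v).y)) j = T.avg (D L (D L v.y)) j := by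
    intro j
    rw [← T.avg_hermSnd v.y, avg, avg]
    congr 1
    refine intervalIntegral.integral_congr_ae ?_
    rw [Set.uIoc_of_le (T.lft_lt_rgt j).le]
    exact ae_interval_of_ae_mu (T.ae_DD_interpolant hL v) (T.lft_mem j).1 (T.rgt_mem j).2
  unfold avgFun
  simp only [this]

theorem midFun_interpolant (v : RibbonSpace L) :
    T.midFun (D L (T.interpolant hL v).y) = T.midFun (D L v.y) := by
  have h1 : ∀ j, D L (T.interpolant hL v).y (T.lft j) = D L v.y (T.lft j) :=
    fun j => T.interpolant_D_y_node hL v _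
  have h2 : ∀ j, D L (T.interpolant hL v).y (T.rgt j) = D L v.y (T.rgt j) :=
    fun j => T.interpolant_D_y_node hL v _
  funext x
  simp only [midFun, lftFun, rgtFun, h1, h2]

/-- The quadrature sees only the nodes, where interpolation preserves y' and b and hence y' ⬝ b = 0.
No power of h has to compensate the factor 1/ε₁. -/
theorem nodalPenalty_interpolant {v : RibbonSpace L} (hv : IsAdmissibleFrame Lbc lbc v) :
    T.nodalPenalty (T.interpolant hL v) = 0 := by
  refine Finset.sum_eq_zero fun j _ => ?_
  have h : ∀ i, ⟪D L (T.interpolant hL v).y (T.node i), (T.interpolant hL v).b (T.node i)⟫ = 0 :=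
    fun i => by
      rw [T.interpolant_D_y_node, T.interpolant_b_node]
      exact (hv.forall_mem hL (T.node_mem i)).2.2
  have h1 : ⟪D L (T.interpolant hL v).y (T.lft j), (T.interpolant hL v).b (T.lft j)⟫ = 0 := h _
  have h2 : ⟪D L (T.interpolant hL v).y (T.rgt j), (T.interpolant hL v).b (T.rgt j)⟫ = 0 := h _
  simp [interp, h1, h2]

theorem shearPenalty_interpolant {v : RibbonSpace L} (hv : IsAdmissibleFrame Lbc lbc v) :
    T.shearPenalty (T.interpolant hL v) =
      ∫ x, ⟪T.midFun (D L v.y) x, T.avgFun (D L v.b) x⟫ ^ 2 ∂(mu L) := by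
  rw [T.shearPenalty_eq _ fun i => ((T.isDiscreteAdmissible_interpolant hL hv).norm_D_y i).le,
    T.midFun_interpolant]
  refine integral_congr_ae ?_
  filter_upwards [T.ae_D_interpolant_b hL v] with x hx
  rw [hx]

theorem norm_D_y_node_le {v : RibbonSpace L} (hL : 0 < L) (hv : IsAdmissibleFrame Lbc lbc v)
    (i : Fin (T.N + 1)) : ‖D L v.y (T.node i)‖ ≤ 1 :=
  (hv.forall_mem hL (T.node_mem i)).1.le

/-- Jensen's inequality on each element, applicable because the midpoint average is constant there.
-/
theorem integral_inner_mid_avg_le {r q : ℝ → E3} (hr : ∀ i, ‖r (T.node i)‖ ≤ 1)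
    (hq : MemLp q 2 (mu L)) :
    ∫ x, ⟪T.midFun r x, T.avgFun q x⟫ ^ 2 ∂(mu L) ≤ ∫ x, ⟪T.midFun r x, q x⟫ ^ 2 ∂(mu L) := by
  have i1 := (T.memLp_inner_midFun hr (T.memLp_avgFun q)).integrable_sq
  have i2 := T.memLp_inner_midFun hr hq
  rw [← T.sum_integral_eq i1 (g := fun j _ => ⟪T.mid r j, T.avg q j⟫ ^ 2)
      fun j x hx => by rw [T.midFun_eq r hx, T.avgFun_eq q hx],
    ← T.sum_integral_eq i2.integrable_sq (g := fun j x => ⟪T.mid r j, q x⟫ ^ 2)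
      fun j x hx => by rw [T.midFun_eq r hx]]
  refine Finset.sum_le_sum fun j _ => ?_
  have hm : MemLp (fun x => ⟪T.mid r j, q x⟫) 2 (mu L) := hq.const_inner _
  have h := integral_sq_le_mul (T.lft_lt_rgt j).le
    (T.intervalIntegrable_element (hm.integrable (by norm_num)) j)
    (T.intervalIntegrable_element hm.integrable_sq j)
  have he := (innerSL ℝ (T.mid r j)).intervalIntegral_comp_comm
    (T.intervalIntegrable_element (memLp_integrable hq) j)
  simp only [innerSL_apply_apply] at he
  rw [he, T.integral_element, inner_smul_right, ← len] at h
  have hl := T.len_pos j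
  rw [intervalIntegral.integral_const, smul_eq_mul, ← len]
  refine le_of_mul_le_mul_left ?_ hl
  linarith

/-- The shear penalty of interpolants of unsheared frames. -/
theorem shearPenalty_interpolant_le {v : RibbonSpace L} (hv : IsAdmissible Lbc lbc v) {h : ℝ}
    (hT : ∀ j, T.len j ≤ h) :
    T.shearPenalty (T.interpolant hL v) ≤
      h * ((∫ x, ‖D L (D L v.y) x‖ ^ 2 ∂(mu L)) * ∫ x, ‖D L v.b x‖ ^ 2 ∂(mu L)) := by
  have hr := T.norm_D_y_node_le hL hv.1
  rw [T.shearPenalty_interpolant hL hv.1, ← mul_assoc, ← integral_const_mul]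
  refine (T.integral_inner_mid_avg_le hr v.memH1_b.1).trans ?_
  refine integral_mono_ae (T.memLp_inner_midFun hr v.memH1_b.1).integrable_sq
    ((memLp_integrable_sq v.memH1_b.1).const_mul _) ?_
  filter_upwards [ae_mem_Ioc L, hv.2] with x hx hux
  have hh : 0 ≤ h := by
    obtain ⟨j, -⟩ := T.exists_mem_element hx
    exact (T.len_pos j).le.trans (hT j)
  have hK : 0 ≤ h * ∫ x, ‖D L (D L v.y) x‖ ^ 2 ∂(mu L) :=
    mul_nonneg hh (integral_nonneg fun _ => sq_nonneg _)
  have h1 := T.norm_midFun_sub_le v.memH2_y.2 hT hx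
  -- Since y' ⬝ b' = 0, only the quadrature error of y' is paired with b'.
  have h2 : ⟪T.midFun (D L v.y) x, D L v.b x⟫ = ⟪T.midFun (D L v.y) x - D L v.y x, D L v.b x⟫ := by
    rw [inner_sub_left, hux, sub_zero]
  have h3 := abs_real_inner_le_norm (T.midFun (D L v.y) x - D L v.y x) (D L v.b x)
  have h4 := h3.trans (mul_le_mul_of_nonneg_right h1 (norm_nonneg _))
  have h5 := pow_le_pow_left₀ (abs_nonneg _) h4 2
  rw [sq_abs, mul_pow, Real.sq_sqrt hK] at h5
  rw [h2]
  exact h5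

end Mesh

/-! ### Convergence of the interpolants and of their energies. -/

section Limits

variable {T : ℕ → Mesh L} {h : ℕ → ℝ}

theorem tendsto_DD_interpolant (hL : 0 < L) (hT : ∀ n j, (T n).len j ≤ h n)
    (hh : Tendsto h atTop (𝓝 0)) (v : RibbonSpace L) :
    Tendsto (fun n => ∫ x, ‖D L (D L ((T n).interpolant hL v).y) x - D L (D L v.y) x‖ ^ 2 ∂(mu L))
      atTop (𝓝 0) := by
  -- Both second derivatives are compared with the element averages of y'': the factor 144 comes
  -- from `integral_hermSnd_sub_avg_le`, the factors 2 from squaring the triangle inequality.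
  have hA := (tendsto_integral_sub_avgFun hT hh v.memH2_y.2.1).const_mul (2 * 144 + 2)
  rw [mul_zero] at hA
  refine squeeze_zero (fun n => integral_nonneg fun _ => sq_nonneg _) (fun n => ?_) hA
  have hS := (T n).memLp_hermSnd v.y
  have hM := (T n).memLp_avgFun (D L (D L v.y))
  have i1 : Integrable (fun x => 2 * ‖(T n).hermSnd v.y x - (T n).avgFun (D L (D L v.y)) x‖ ^ 2)
    (mu L) := (memLp_integrable_sq (hS.sub hM)).const_mul 2
  have i2 : Integrable (fun x => 2 * ‖D L (D L v.y) x - (T n).avgFun (D L (D L v.y)) x‖ ^ 2)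
    (mu L) := (memLp_integrable_sq (v.memH2_y.2.1.sub hM)).const_mul 2
  calc ∫ x, ‖D L (D L ((T n).interpolant hL v).y) x - D L (D L v.y) x‖ ^ 2 ∂(mu L)
      = ∫ x, ‖(T n).hermSnd v.y x - D L (D L v.y) x‖ ^ 2 ∂(mu L) := by
        refine integral_congr_ae ?_
        filter_upwards [(T n).ae_DD_interpolant hL v] with x hx
        rw [hx]
    _ ≤ ∫ x, (2 * ‖(T n).hermSnd v.y x - (T n).avgFun (D L (D L v.y)) x‖ ^ 2
          + 2 * ‖D L (D L v.y) x - (T n).avgFun (D L (D L v.y)) x‖ ^ 2) ∂(mu L) := by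
        refine integral_mono (memLp_integrable_sq (hS.sub v.memH2_y.2.1)) (i1.add i2) fun x => ?_
        have ht := norm_sub_le ((T n).hermSnd v.y x - (T n).avgFun (D L (D L v.y)) x)
          (D L (D L v.y) x - (T n).avgFun (D L (D L v.y)) x)
        rw [sub_sub_sub_cancel_right] at ht
        have ht2 := pow_le_pow_left₀ (norm_nonneg _) ht 2
        simp only
        nlinarith [sq_nonneg (‖(T n).hermSnd v.y x - (T n).avgFun (D L (D L v.y)) x‖ -
          ‖D L (D L v.y) x - (T n).avgFun (D L (D L v.y)) x‖)]
    _ ≤ _ := by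
        rw [integral_add i1 i2, integral_const_mul, integral_const_mul]
        have := (T n).integral_hermSnd_sub_avg_le v.memH2_y
        linarith

theorem tendsto_avgFun (hT : ∀ n j, (T n).len j ≤ h n)
    (hh : Tendsto h atTop (𝓝 0)) {f : ℝ → E3} (hf : MemLp f 2 (mu L)) :
    Tendsto (fun n => ∫ x, ‖(T n).avgFun f x - f x‖ ^ 2 ∂(mu L)) atTop (𝓝 0) := by
  simpa only [norm_sub_rev] using tendsto_integral_sub_avgFun hT hh hf

theorem tendsto_D_interpolant_b (hL : 0 < L) (hT : ∀ n j, (T n).len j ≤ h n)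
    (hh : Tendsto h atTop (𝓝 0)) (v : RibbonSpace L) :
    Tendsto (fun n => ∫ x, ‖D L ((T n).interpolant hL v).b x - D L v.b x‖ ^ 2 ∂(mu L))
      atTop (𝓝 0) := by
  refine (tendsto_avgFun hT hh v.memH1_b.1).congr fun n => integral_congr_ae ?_
  filter_upwards [(T n).ae_D_interpolant_b hL v] with x hx
  rw [hx]

theorem strongConv_interpolant (hL : 0 < L) (hT : ∀ n j, (T n).len j ≤ h n)
    (hh : Tendsto h atTop (𝓝 0)) (v : RibbonSpace L) :
    StrongConv (fun n => (T n).interpolant hL v) v := by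
  refine strongConv_of_tendsto hL (fun n => ?_) (fun n => ?_) (fun n => ?_)
    (tendsto_DD_interpolant hL hT hh v) (tendsto_D_interpolant_b hL hT hh v)
  · simpa only [(T n).node_zero] using (T n).interpolant_y_node hL v 0
  · simpa only [(T n).node_zero] using (T n).interpolant_D_y_node hL v 0
  · simpa only [(T n).node_zero] using (T n).interpolant_b_node hL v 0

theorem tendsto_elastic_interpolant (hL : 0 < L) {reg : ℝ → ℝ → ℝ} {c₀ c₁ c₂ cuni : ℝ}
    (hreg : IsRegularizedModulus reg c₀ c₁ c₂ cuni) (hT : ∀ n j, (T n).len j ≤ h n)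
    (hh : Tendsto h atTop (𝓝 0)) {δ : ℕ → ℝ} (hδ : ∀ n, 0 ≤ δ n) (hδ0 : Tendsto δ atTop (𝓝 0))
    (v : RibbonSpace L) :
    Tendsto (fun n => (T n).elastic reg (δ n) ((T n).interpolant hL v)) atTop
      (𝓝 (energy v)) := by
  have hp := v.memH2_y.2.1
  have hq := v.memH1_b.1
  have t1 := tendsto_integral_norm_sq (fun n => ((T n).interpolant hL v).memH2_y.2.1) hp
    (tendsto_DD_interpolant hL hT hh v)
  have t2 := tendsto_integral_norm_sq (fun n => (T n).memLp_avgFun (D L (D L v.y))) hp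
    (tendsto_avgFun hT hh hp)
  have t3 := tendsto_integral_Qbar (fun n => (T n).memLp_avgFun (D L (D L v.y)))
    (fun n => ((T n).interpolant hL v).memH1_b.1) hp hq (tendsto_avgFun hT hh hp)
    (tendsto_D_interpolant_b hL hT hh v)
  have t4 : Tendsto (fun n => 3 / 2 * (cuni * δ n) * L) atTop (𝓝 0) := by
    simpa using ((hδ0.const_mul cuni).const_mul (3 / 2)).mul_const L
  have t5 := ((t1.sub t2).const_mul (1 / 2)).add t3
  rw [sub_self, mul_zero, zero_add, ← energy_eq hL.le] at t5
  have t6 : Tendsto (fun n => (T n).elastic reg (δ n) ((T n).interpolant hL v)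
      - ((1 / 2) * ((∫ x, ‖D L (D L ((T n).interpolant hL v).y) x‖ ^ 2 ∂(mu L))
        - ∫ x, ‖(T n).avgFun (D L (D L v.y)) x‖ ^ 2 ∂(mu L))
      + ∫ x, Qbar ‖(T n).avgFun (D L (D L v.y)) x‖ ‖D L ((T n).interpolant hL v).b x‖ ∂(mu L)))
      atTop (𝓝 0) := by
    refine squeeze_zero_norm (fun n => ?_) t4
    have := (T n).abs_elastic_sub_le hreg (hδ n) ((T n).interpolant hL v)
      ((T n).isSpline_linInterp hL v.memH1_b)
    rw [(T n).avgFun_interpolant] at this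
    exact this
  simpa using t6.add t5

/-- The frame need not be unsheared here, as required for fixed ε₂. The error splits into 𝓜_h y' ⬝
(𝒜_h b' - b'), small by convergence of averages, and (𝓜_h y' - y') ⬝ b', small by Hölder continuity.
-/
theorem tendsto_shearPenalty_interpolant (hL : 0 < L) (hT : ∀ n j, (T n).len j ≤ h n)
    (hh : Tendsto h atTop (𝓝 0)) {v : RibbonSpace L} (hv : IsAdmissibleFrame Lbc lbc v) :
    Tendsto (fun n => (T n).shearPenalty ((T n).interpolant hL v)) atTop
      (𝓝 (∫ x, ⟪D L v.y x, D L v.b x⟫ ^ 2 ∂(mu L))) := by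
  have hq := v.memH1_b.1
  have hr : MemLp (D L v.y) 2 (mu L) := v.memH2_y.1.1
  have hr1 : ∀ᵐ x ∂(mu L), ‖D L v.y x‖ ≤ 1 := by
    filter_upwards [ae_mem_Ioc L] with x hx
    exact (hv.forall_mem hL (Set.Ioc_subset_Icc_self hx)).1.le
  have hn := fun n => (T n).norm_D_y_node_le hL hv
  simp_rw [fun n => (T n).shearPenalty_interpolant hL hv]
  have hsq : ∀ a : ℝ, a ^ 2 = ‖a‖ ^ 2 := fun a => by rw [Real.norm_eq_abs, sq_abs]
  simp_rw [fun n x => hsq ⟪(T n).midFun (D L v.y) x, (T n).avgFun (D L v.b) x⟫,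
    fun x => hsq ⟪D L v.y x, D L v.b x⟫]
  have hm := fun n => (T n).memLp_inner_midFun (hn n) ((T n).memLp_avgFun (D L v.b))
  have hm0 := memLp_inner_of_norm_le_one hr.1 hr1 hq
  refine tendsto_integral_norm_sq hm hm0 ?_
  set K := ∫ x, ‖D L (D L v.y) x‖ ^ 2 ∂(mu L)
  set B := ∫ x, ‖D L v.b x‖ ^ 2 ∂(mu L)
  have hlim : Tendsto (fun n => 2 * (∫ x, ‖(T n).avgFun (D L v.b) x - D L v.b x‖ ^ 2 ∂(mu L))
      + 2 * (h n * K) * B) atTop (𝓝 0) := by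
    have := ((tendsto_avgFun hT hh hq).const_mul 2).add
      (((hh.mul_const K).const_mul 2).mul_const B)
    simpa using this
  refine squeeze_zero (fun n => integral_nonneg fun _ => sq_nonneg _) (fun n => ?_) hlim
  have i1 : Integrable (fun x => 2 * ‖(T n).avgFun (D L v.b) x - D L v.b x‖ ^ 2) (mu L) :=
    (memLp_integrable_sq (((T n).memLp_avgFun _).sub hq)).const_mul 2
  have i2 : Integrable (fun x => 2 * (h n * K) * ‖D L v.b x‖ ^ 2) (mu L) :=
    (memLp_integrable_sq hq).const_mul _
  rw [← integral_const_mul, ← integral_const_mul, ← integral_add i1 i2]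
  refine integral_mono_ae (memLp_integrable_sq ((hm n).sub hm0)) (i1.add i2) ?_
  filter_upwards [ae_mem_Ioc L] with x hx
  have hh0 : 0 ≤ h n := by
    obtain ⟨j, -⟩ := (T n).exists_mem_element hx
    exact ((T n).len_pos j).le.trans (hT n j)
  have hK : 0 ≤ h n * K := mul_nonneg hh0 (integral_nonneg fun _ => sq_nonneg _)
  set m := (T n).midFun (D L v.y) x
  set a := (T n).avgFun (D L v.b) x
  have h1 : ‖m‖ ≤ 1 := (T n).norm_midFun_le_one (hn n) hx
  have h2 : ‖m - D L v.y x‖ ≤ √(h n * K) := (T n).norm_midFun_sub_le v.memH2_y.2 (hT n) hx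
  have h3 : ⟪m, a⟫ - ⟪D L v.y x, D L v.b x⟫ = ⟪m, a - D L v.b x⟫ + ⟪m - D L v.y x, D L v.b x⟫ := by
    rw [inner_sub_right, inner_sub_left]; ring
  have h4 := (abs_real_inner_le_norm m (a - D L v.b x)).trans
    (mul_le_of_le_one_left (norm_nonneg _) h1)
  have h5 := (abs_real_inner_le_norm (m - D L v.y x) (D L v.b x)).trans
    (mul_le_mul_of_nonneg_right h2 (norm_nonneg _))
  have h6 := pow_le_pow_left₀ (abs_nonneg _) h4 2
  have h7 := pow_le_pow_left₀ (abs_nonneg _) h5 2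
  rw [sq_abs] at h6
  rw [sq_abs, mul_pow, Real.sq_sqrt hK] at h7
  change ‖⟪m, a⟫ - ⟪D L v.y x, D L v.b x⟫‖ ^ 2 ≤
    2 * ‖a - D L v.b x‖ ^ 2 + 2 * (h n * K) * ‖D L v.b x‖ ^ 2
  rw [Real.norm_eq_abs, sq_abs, h3]
  nlinarith [sq_nonneg (⟪m, a - D L v.b x⟫ - ⟪m - D L v.y x, D L v.b x⟫)]

theorem tendsto_energyQuad_interpolant_pen (hL : 0 < L) {reg : ℝ → ℝ → ℝ} {c₀ c₁ c₂ cuni : ℝ}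
    (hreg : IsRegularizedModulus reg c₀ c₁ c₂ cuni) (hT : ∀ n j, (T n).len j ≤ h n)
    (hh : Tendsto h atTop (𝓝 0)) {δ : ℕ → ℝ} (hδ : ∀ n, 0 ≤ δ n) (hδ0 : Tendsto δ atTop (𝓝 0))
    (ε₁ : ℕ → ℝ) (ε₂ : ℝ) {v : RibbonSpace L} (hv : IsAdmissibleFrame Lbc lbc v) :
    Tendsto (fun n => (T n).energyQuad reg (δ n) (ε₁ n) ε₂ ((T n).interpolant hL v)) atTop
      (𝓝 (energyPen ε₂ v)) := by
  simp_rw [Mesh.energyQuad_eq, fun n => (T n).nodalPenalty_interpolant hL hv, mul_zero, add_zero,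
    energyPen_eq hL.le]
  exact (tendsto_elastic_interpolant hL hreg hT hh hδ hδ0 v).add
    ((tendsto_shearPenalty_interpolant hL hT hh hv).const_mul _)

/-- For an unsheared frame the weighted shear penalty is at most ½ ‖y''‖² ‖b'‖² h/ε₂, so a regular
approximation of the frame is not needed. -/
theorem tendsto_energyQuad_interpolant (hL : 0 < L) {reg : ℝ → ℝ → ℝ} {c₀ c₁ c₂ cuni : ℝ}
    (hreg : IsRegularizedModulus reg c₀ c₁ c₂ cuni) (hT : ∀ n j, (T n).len j ≤ h n)
    (hh : Tendsto h atTop (𝓝 0)) {δ : ℕ → ℝ} (hδ : ∀ n, 0 ≤ δ n) (hδ0 : Tendsto δ atTop (𝓝 0))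
    (ε₁ : ℕ → ℝ) {ε₂ : ℕ → ℝ} (hε₂ : ∀ n, 0 < ε₂ n)
    (hhε : Tendsto (fun n => h n / ε₂ n) atTop (𝓝 0)) {v : RibbonSpace L}
    (hv : IsAdmissible Lbc lbc v) :
    Tendsto (fun n => (T n).energyQuad reg (δ n) (ε₁ n) (ε₂ n) ((T n).interpolant hL v)) atTop
      (𝓝 (energy v)) := by
  simp_rw [Mesh.energyQuad_eq, fun n => (T n).nodalPenalty_interpolant hL hv.1, mul_zero, add_zero]
  set K := (∫ x, ‖D L (D L v.y) x‖ ^ 2 ∂(mu L)) * ∫ x, ‖D L v.b x‖ ^ 2 ∂(mu L)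
  have hs : Tendsto (fun n => 1 / (2 * ε₂ n) * (T n).shearPenalty ((T n).interpolant hL v)) atTop
      (𝓝 0) := by
    have hb : Tendsto (fun n => 1 / 2 * K * (h n / ε₂ n)) atTop (𝓝 0) := by
      simpa using hhε.const_mul (1 / 2 * K)
    refine squeeze_zero (fun n => ?_) (fun n => ?_) hb
    · have := hε₂ n
      exact mul_nonneg (by positivity) ((T n).shearPenalty_nonneg _)
    · have := hε₂ n
      refine (mul_le_mul_of_nonneg_left ((T n).shearPenalty_interpolant_le hL hv (hT n))
        (by positivity)).trans_eq ?_
      rw [one_div_mul_eq_div, mul_div_right_comm, mul_comm]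
      simp only [K]
      field_simp
  simpa using (tendsto_elastic_interpolant hL hreg hT hh hδ hδ0 v).add hs

end Limits

end

/-! ### Limits of admissible frames -/

section

variable {L : ℝ} {F : Type*} [NormedAddCommGroup F] [NormedSpace ℝ F]
  {Lbc : (Fin 6 → E3) →L[ℝ] F} {lbc : F}

theorem weakL2_of_eLpNorm (hL : 0 ≤ L) {f g : ℕ → ℝ → E3} {p : ℝ → E3}
    (hf : ∀ n, MemLp (f n) 2 (mu L)) (hp : MemLp p 2 (mu L))
    (hg : ∀ n, g n =ᵐ[mu L] fun x => p x - f n x)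
    (h : Tendsto (fun n => eLpNorm (g n) 2 (mu L)) atTop (𝓝 0)) : WeakL2 L f p := by
  have hm : ∀ n, MemLp (g n) 2 (mu L) := fun n => (memLp_congr_ae (hg n)).2 (hp.sub (hf n))
  refine weakL2_of_tendsto hL hf hp
    (((tendsto_integral_norm_sq_zero_iff hm).2 h).congr fun n => integral_congr_ae ?_)
  filter_upwards [hg n] with x hx
  rw [hx, norm_sub_rev]

theorem weakConv_of_hNorm (hL : 0 < L) {w : ℕ → RibbonSpace L} {v : RibbonSpace L}
    (h2 : Tendsto (fun n => hNorm L 2 (fun x => v.y x - (w n).y x)) atTop (𝓝 0))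
    (h1 : Tendsto (fun n => hNorm L 1 (fun x => v.b x - (w n).b x)) atTop (𝓝 0)) :
    WeakConv w v := by
  rw [tendsto_hNorm_zero_iff] at h1 h2
  constructor
  · intro i hi
    have h := h2 i hi
    interval_cases i
    · exact weakL2_of_eLpNorm hL.le
        (fun n => memLp_of_continuousOn ((w n).memH2_y.1.continuousOn hL))
        (memLp_of_continuousOn (v.memH2_y.1.continuousOn hL)) (fun n => ae_of_all _ fun x => rfl) h
    · exact weakL2_of_eLpNorm hL.le (fun n => (w n).memH2_y.1.1) v.memH2_y.1.1
        (fun n => v.memH2_y.1.ae_D_sub hL (w n).memH2_y.1) h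
    · exact weakL2_of_eLpNorm hL.le (fun n => (w n).memH2_y.2.1) v.memH2_y.2.1
        (fun n => v.memH2_y.ae_DD_sub hL (w n).memH2_y) h
  · intro i hi
    have h := h1 i hi
    interval_cases i
    · exact weakL2_of_eLpNorm hL.le
        (fun n => memLp_of_continuousOn ((w n).memH1_b.continuousOn hL))
        (memLp_of_continuousOn (v.memH1_b.continuousOn hL)) (fun n => ae_of_all _ fun x => rfl) h
    · exact weakL2_of_eLpNorm hL.le (fun n => (w n).memH1_b.1) v.memH1_b.1
        (fun n => v.memH1_b.ae_D_sub hL (w n).memH1_b) h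

theorem memLp_shear (hL : 0 < L) {v : RibbonSpace L} (hv : IsAdmissibleFrame Lbc lbc v) :
    MemLp (fun x => ⟪D L v.y x, D L v.b x⟫) 2 (mu L) := by
  refine memLp_inner_of_norm_le_one v.memH2_y.1.1.1 ?_ v.memH1_b.1
  filter_upwards [ae_mem_Ioc L] with x hx
  exact (hv.forall_mem hL (Set.Ioc_subset_Icc_self hx)).1.le

theorem isUnsheared_of_integral_le_zero (hL : 0 < L) {v : RibbonSpace L}
    (hv : IsAdmissibleFrame Lbc lbc v)
    (h : ∫ x, ⟪D L v.y x, D L v.b x⟫ ^ 2 ∂(mu L) ≤ 0) : IsUnsheared v := by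
  have h4 := (integral_eq_zero_iff_of_nonneg (fun x => sq_nonneg _)
    (memLp_shear hL hv).integrable_sq).1 (le_antisymm h (integral_nonneg fun x => sq_nonneg _))
  filter_upwards [h4] with x hx
  simpa using hx

theorem WeakConv.isAdmissibleFrame (hL : 0 < L) {z : ℕ → RibbonSpace L} {v : RibbonSpace L}
    (h : WeakConv z v) (hz : ∀ n, IsAdmissibleFrame Lbc lbc (z n)) :
    IsAdmissibleFrame Lbc lbc v := by
  refine isAdmissibleFrame_iff.2 ⟨?_, h.boundaryData_eq hL fun n => (hz n).2⟩
  filter_upwards [ae_mem_Ioc L] with x hx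
  have hx' := Set.Ioc_subset_Icc_self hx
  have hy := h.tendsto_D_y hL hx'
  have hb := h.tendsto_b hL hx'
  exact ⟨tendsto_nhds_unique hy.norm
      (tendsto_const_nhds.congr fun n => ((hz n).forall_mem hL hx').1.symm),
    tendsto_nhds_unique hb.norm
      (tendsto_const_nhds.congr fun n => ((hz n).forall_mem hL hx').2.1.symm),
    tendsto_nhds_unique (hy.inner hb)
      (tendsto_const_nhds.congr fun n => ((hz n).forall_mem hL hx').2.2.symm)⟩

theorem WeakConv.isUnsheared (hL : 0 < L) {z : ℕ → RibbonSpace L} {v : RibbonSpace L}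
    (h : WeakConv z v) (hz : ∀ n, IsAdmissibleFrame Lbc lbc (z n))
    (hs : Tendsto (fun n => eLpNorm (fun x => ⟪D L (z n).y x, D L (z n).b x⟫) 2 (mu L))
      atTop (𝓝 0)) : IsUnsheared v := by
  have hv := h.isAdmissibleFrame hL hz
  have hg := memLp_shear hL hv
  have hzs := fun n => memLp_shear hL (hz n)
  have hone : ∀ {u : RibbonSpace L}, IsAdmissibleFrame Lbc lbc u →
      ∀ᵐ x ∂(mu L), ‖D L u.y x‖ ≤ 1 := fun hu => by
    filter_upwards [ae_mem_Ioc L] with x hx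
    exact (hu.forall_mem hL (Set.Ioc_subset_Icc_self hx)).1.le
  -- The shears of the approximations are tested with the shear g of the limit: the weak-strong
  -- limit is ∫ g², whereas Cauchy–Schwarz yields the limit 0.
  have t1 := tendsto_integral_mul_inner hL.le hg (fun n => (z n).memH2_y.1.1.1) v.memH2_y.1.1.1
    (fun n => hone (hz n)) (hone hv) (by
      filter_upwards [ae_mem_Ioc L] with x hx
      exact h.tendsto_D_y hL (Set.Ioc_subset_Icc_self hx)) (fun n => (z n).memH1_b.1)
    (h.2 1 le_rfl)
  have t2 : Tendsto (fun n => ∫ x, ⟪D L v.y x, D L v.b x⟫ * ⟪D L (z n).y x, D L (z n).b x⟫ ∂(mu L))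
      atTop (𝓝 0) := by
    have hs' := ((ENNReal.tendsto_toReal ENNReal.zero_ne_top).comp hs).const_mul ‖hg.toLp‖
    simp only [ENNReal.toReal_zero, mul_zero] at hs'
    refine squeeze_zero_norm (fun n => ?_) hs'
    have := abs_real_inner_le_norm (hg.toLp) ((hzs n).toLp)
    rw [inner_toLp, Lp.norm_toLp _ (hzs n)] at this
    simpa [mul_comm] using this
  refine isUnsheared_of_integral_le_zero hL hv (le_of_eq ?_)
  have := tendsto_nhds_unique t1 t2
  simp_rw [sq]
  exact this

/-- Limits of smooth approximations are admissible. -/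
theorem isAdmissible_of_approxCondition (hL : 0 < L) {v : RibbonSpace L} {h ε₁ ε₂ σ : ℕ → ℝ}
    (hh : ∀ n, 0 < h n) (hε₂ : ∀ n, 0 < ε₂ n) (hσ : Tendsto σ atTop (𝓝 0))
    (hv : ApproxCondition Lbc lbc v h ε₁ ε₂ σ) : IsAdmissible Lbc lbc v := by
  have hex : ∀ᶠ n in atTop, ∃ z, IsSmoothApprox Lbc lbc v (σ n) z := by
    filter_upwards [hv.eventually (gt_mem_nhds one_pos)] with n hn
    by_contra hne
    push Not at hne
    -- Without an approximation the infimum is infinite, and so is its product with the positive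
    -- coefficient h²/ε₂, contradicting the smallness of the sum in the condition.
    have htop : approxNorm Lbc lbc v (σ n) = ⊤ := by simp [approxNorm, hne]
    have hpos : 0 < h n ^ 2 / ε₂ n := div_pos (pow_pos (hh n) 2) (hε₂ n)
    rw [htop, ENNReal.top_pow two_ne_zero, ENNReal.mul_top (by simpa using hpos), add_top] at hn
    exact absurd hn (by simp)
  obtain ⟨N, hN⟩ := eventually_atTop.1 hex
  choose z hz using fun n => hN (n + N) (Nat.le_add_left N n)
  have hσN : Tendsto (fun n => ENNReal.ofReal (σ (n + N))) atTop (𝓝 0) := by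
    have := (ENNReal.tendsto_ofReal hσ).comp (tendsto_add_atTop_nat N)
    simpa [Function.comp_def] using this
  have hle : ∀ {a : ℕ → ℝ≥0∞}, (∀ n, a n ≤ hNorm L 2 (fun x => v.y x - (z n).y x)
      + hNorm L 1 (fun x => v.b x - (z n).b x)
      + eLpNorm (fun x => ⟪D L (z n).y x, D L (z n).b x⟫) 2 (mu L)) → Tendsto a atTop (𝓝 0) :=
    fun ha => tendsto_of_tendsto_of_tendsto_of_le_of_le tendsto_const_nhds hσN (fun _ => zero_le)
      fun n => (ha n).trans (hz n).2.2.2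
  have hw : WeakConv z v := weakConv_of_hNorm hL
    (hle fun n => le_add_right le_self_add) (hle fun n => le_add_right le_add_self)
  have hf : ∀ n, IsAdmissibleFrame Lbc lbc (z n) := fun n => (hz n).2.2.1
  exact ⟨hw.isAdmissibleFrame hL hf, hw.isUnsheared hL hf (hle fun n => le_add_self)⟩

/-! ### Lower bounds -/

theorem WeakConv.comp {w : ℕ → RibbonSpace L} {v : RibbonSpace L} (h : WeakConv w v)
    {φ : ℕ → ℕ} (hφ : StrictMono φ) : WeakConv (fun n => w (φ n)) v :=
  ⟨fun i hi ψ hψ => (h.1 i hi ψ hψ).comp hφ.tendsto_atTop,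
    fun i hi ψ hψ => (h.2 i hi ψ hψ).comp hφ.tendsto_atTop⟩

/-- Lower bound for sequences that have bounded energy along a subsequence. -/
theorem energyPen_le_of_frequently (hL : 0 < L) {reg : ℝ → ℝ → ℝ} {c₀ c₁ c₂ cuni : ℝ}
    (hreg : IsRegularizedModulus reg c₀ c₁ c₂ cuni) {T : ℕ → Mesh L} {h : ℕ → ℝ}
    (hT : ∀ n j, (T n).len j ≤ h n) (hh : Tendsto h atTop (𝓝 0))
    {δ ε₁ ε₂ : ℕ → ℝ} (hδ : ∀ n, 0 ≤ δ n) (hδ0 : Tendsto δ atTop (𝓝 0))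
    (hε₁ : ∀ n, 0 < ε₁ n) (hε₁0 : Tendsto ε₁ atTop (𝓝 0)) (hε₂ : ∀ n, 0 < ε₂ n)
    {w : ℕ → RibbonSpace L} {v : RibbonSpace L} (hv : WeakConv w v) {C : ℝ}
    (hw : ∃ᶠ n in atTop, (T n).IsDiscreteAdmissible Lbc lbc (w n) ∧
      (T n).energyQuad reg (δ n) (ε₁ n) (ε₂ n) (w n) ≤ C)
    {ε : ℝ} (hε : ∀ᶠ n in atTop, ε₂ n ≤ ε) :
    IsAdmissibleFrame Lbc lbc v ∧ energyPen ε v ≤ C := by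
  obtain ⟨φ, hφ, hφw⟩ := extraction_of_frequently_atTop (hw.and_eventually hε)
  have hε0 : 0 < ε := (hε₂ (φ 0)).trans_le (hφw 0).2
  exact energyPen_le_of_weakConv hL hreg (T := fun n => T (φ n)) (h := fun n => h (φ n))
    (δ := fun n => δ (φ n)) (ε₁ := fun n => ε₁ (φ n)) (fun n => hT (φ n))
    (hh.comp hφ.tendsto_atTop) (fun n => hδ (φ n)) (hδ0.comp hφ.tendsto_atTop)
    (fun n => hε₁ (φ n)) (hε₁0.comp hφ.tendsto_atTop) hε0 (fun n => (hφw n).1.1) (hv.comp hφ)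
    fun n => ((T (φ n)).energyQuad_anti (hε₂ _) (hφw n).2 _).trans (hφw n).1.2

/-- Eventually ε₂ ≤ ε for any fixed ε > 0, so the penalized limit energy is bounded by C for every
ε; a nonzero shear would make it unbounded as ε → 0. -/
theorem energy_le_of_frequently (hL : 0 < L) {reg : ℝ → ℝ → ℝ} {c₀ c₁ c₂ cuni : ℝ}
    (hreg : IsRegularizedModulus reg c₀ c₁ c₂ cuni) {T : ℕ → Mesh L} {h : ℕ → ℝ}
    (hT : ∀ n j, (T n).len j ≤ h n) (hh : Tendsto h atTop (𝓝 0))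
    {δ ε₁ ε₂ : ℕ → ℝ} (hδ : ∀ n, 0 ≤ δ n) (hδ0 : Tendsto δ atTop (𝓝 0))
    (hε₁ : ∀ n, 0 < ε₁ n) (hε₁0 : Tendsto ε₁ atTop (𝓝 0)) (hε₂ : ∀ n, 0 < ε₂ n)
    (hε₂0 : Tendsto ε₂ atTop (𝓝 0))
    {w : ℕ → RibbonSpace L} {v : RibbonSpace L} (hv : WeakConv w v) {C : ℝ}
    (hw : ∃ᶠ n in atTop, (T n).IsDiscreteAdmissible Lbc lbc (w n) ∧
      (T n).energyQuad reg (δ n) (ε₁ n) (ε₂ n) (w n) ≤ C) :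
    IsAdmissible Lbc lbc v ∧ energy v ≤ C := by
  have key : ∀ ε : ℝ, 0 < ε → IsAdmissibleFrame Lbc lbc v ∧ energyPen ε v ≤ C := fun ε hε =>
    energyPen_le_of_frequently hL hreg hT hh hδ hδ0 hε₁ hε₁0 hε₂ hv hw
      ((hε₂0.eventually (gt_mem_nhds hε)).mono fun _ h => h.le)
  have hfr := (key 1 one_pos).1
  set I := ∫ x, ⟪D L v.y x, D L v.b x⟫ ^ 2 ∂(mu L) with hI
  have hI0 : 0 ≤ I := integral_nonneg fun x => sq_nonneg _
  have hle : ∀ ε : ℝ, 0 < ε → energy v + 1 / (2 * ε) * I ≤ C := fun ε hε => by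
    rw [hI, ← energyPen_eq hL.le]
    exact (key ε hε).2
  have hE : energy v ≤ C := by
    have := hle 1 one_pos
    have : 0 ≤ 1 / (2 * 1) * I := by positivity
    linarith
  refine ⟨⟨hfr, isUnsheared_of_integral_le_zero hL hfr ?_⟩, hE⟩
  by_contra hpos
  rw [not_le, ← hI] at hpos
  -- For this ε the penalty term equals C - E + 1, which exceeds the available C - E.
  have h1 := hle (I / (2 * (C - energy v + 1))) (by
    have : 0 < C - energy v + 1 := by linarith
    positivity)
  have h2 : 1 / (2 * (I / (2 * (C - energy v + 1)))) * I = C - energy v + 1 := by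
    have : C - energy v + 1 ≠ 0 := by linarith
    field_simp
  linarith

end

/-! ### Auxiliary facts on lower limits and on the parameters. -/

theorem frequently_of_liminf_lt {f : ℕ → EReal} {C : ℝ} (h : liminf f atTop < (C : EReal)) :
    ∃ᶠ n in atTop, f n < (C : EReal) :=
  frequently_lt_of_liminf_lt (by isBoundedDefault) h

theorem tendsto_div_of_tendsto_sqrt_div {h ε₁ ε₂ : ℕ → ℝ} (hh : ∀ n, 0 < h n)
    (hε₁ : ∀ n, 0 < ε₁ n) (hε₂ : ∀ n, 0 < ε₂ n)
    (hc : Tendsto (fun n => h n / ε₁ n + √(h n) / √(ε₂ n)) atTop (𝓝 0)) :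
    Tendsto (fun n => h n / ε₂ n) atTop (𝓝 0) := by
  have h1 : Tendsto (fun n => √(h n) / √(ε₂ n)) atTop (𝓝 0) :=
    squeeze_zero (fun n => by positivity)
      (fun n => le_add_of_nonneg_left (div_pos (hh n) (hε₁ n)).le) hc
  have h2 := h1.pow 2
  rw [zero_pow two_ne_zero] at h2
  refine h2.congr fun n => ?_
  rw [div_pow, Real.sq_sqrt (hh n).le, Real.sq_sqrt (hε₂ n).le]

end

/-! ### The main theorem. -/

theorem proposition4p6
    {L : ℝ} (hL : 0 < L)
    {F : Type*} [NormedAddCommGroup F] [NormedSpace ℝ F]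
    (Lbc : (Fin 6 → E3) →L[ℝ] F) (lbc : F)
    (reg : ℝ → ℝ → ℝ) (c₀ c₁ c₂ cuni : ℝ)
    (hc₀ : 0 < c₀) (hc₁ : 0 < c₁) (hc₂ : 0 < c₂) (hcuni : 0 < cuni)
    (hreg : IsRegularizedModulus reg c₀ c₁ c₂ cuni)
    -- quasiuniform partitionings with mesh-size `h → 0`
    (T : ℕ → Mesh L) (h : ℕ → ℝ) (hh : ∀ n, h n = (T n).meshSize)
    (hh0 : Tendsto h atTop (𝓝 0))
    (hqu : ∃ c : ℝ, 0 < c ∧ ∀ n j, c * h n ≤ (T n).len j)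
    -- parameters `δ → 0` and `ε₁ → 0`
    (δ ε₁ : ℕ → ℝ) (hδ : ∀ n, 0 ≤ δ n) (hδ0 : Tendsto δ atTop (𝓝 0))
    (hε₁ : ∀ n, 0 < ε₁ n) (hε₁0 : Tendsto ε₁ atTop (𝓝 0)) :
    -- the results for `ε₂ → 0`
    (∀ ε₂ : ℕ → ℝ, (∀ n, 0 < ε₂ n) → Tendsto ε₂ atTop (𝓝 0) →
      -- (ii) lower bound
      (∀ (v : RibbonSpace L) (w : ℕ → RibbonSpace L),
        (∀ n, (T n).IsDiscreteAdmissible Lbc lbc (w n)) → WeakConv w v →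
          ((∀ x ∈ Set.Icc 0 L, ‖D L v.y x‖ ^ 2 = 1 ∧ ‖v.b x‖ ^ 2 = 1) ∧
            Lbc (boundaryData v) = lbc) ∧
          (liminf (fun n => ((T n).energyQuad reg (δ n) (ε₁ n) (ε₂ n) (w n) : EReal)) atTop < ⊤ →
            IsAdmissible Lbc lbc v) ∧
          (energy v : EReal) ≤
            liminf (fun n => ((T n).energyQuad reg (δ n) (ε₁ n) (ε₂ n) (w n) : EReal)) atTop) ∧
      -- the other results, under the additional condition
      (Tendsto (fun n => h n / ε₁ n + √(h n) / √(ε₂ n)) atTop (𝓝 0) →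
        -- (i) attainment
        (∀ (v : RibbonSpace L) (σ : ℕ → ℝ), (∀ n, 0 < σ n) → Tendsto σ atTop (𝓝 0) →
          ApproxCondition Lbc lbc v h ε₁ ε₂ σ →
          ∃ w : ℕ → RibbonSpace L,
            (∀ n, (T n).IsDiscreteAdmissible Lbc lbc (w n)) ∧ StrongConv w v ∧
            Tendsto (fun n => (T n).energyQuad reg (δ n) (ε₁ n) (ε₂ n) (w n)) atTop
              (𝓝 (energy v))) ∧
        -- approximation of regular minimizers by discrete almost-minimizers
        (∀ (w : ℕ → RibbonSpace L) (tol : ℕ → ℝ), (∀ n, 0 ≤ tol n) → Tendsto tol atTop (𝓝 0) →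
          (∀ n, (T n).IsDiscreteAdmissible Lbc lbc (w n) ∧
            ∀ z : RibbonSpace L, (T n).IsDiscreteAdmissible Lbc lbc z →
              (T n).energyQuad reg (δ n) (ε₁ n) (ε₂ n) (w n) ≤
                (T n).energyQuad reg (δ n) (ε₁ n) (ε₂ n) z + tol n) →
          (∃ v : RibbonSpace L, (IsWeakAccPt w v ∨ IsMinimizer Lbc lbc v) ∧
            ∃ σ : ℕ → ℝ, (∀ n, 0 < σ n) ∧ Tendsto σ atTop (𝓝 0) ∧
              ApproxCondition Lbc lbc v h ε₁ ε₂ σ) →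
          ∀ v : RibbonSpace L, IsWeakAccPt w v → IsMinimizer Lbc lbc v) ∧
        -- `Γ`-convergence to `E` if smooth unsheared frames are dense
        ((∀ v : RibbonSpace L, IsAdmissible Lbc lbc v → ∀ σ : ℝ, 0 < σ →
            ∃ z : RibbonSpace L, IsSmoothApprox Lbc lbc v σ z ∧ IsUnsheared z) →
          Tendsto (fun n => h n ^ 2 / ε₁ n + h n ^ 2 / ε₂ n) atTop (𝓝 0) →
          GammaConverges
            (fun n => (T n).constrainedEnergyQuad Lbc lbc reg (δ n) (ε₁ n) (ε₂ n))
            (constrainedEnergy Lbc lbc)))) ∧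
    -- `Γ`-convergence to the penalized functional for fixed `ε₂`
    (∀ ε₂ : ℝ, 0 < ε₂ →
      Tendsto (fun n => h n / ε₁ n + √(h n) / √ε₂) atTop (𝓝 0) →
      Tendsto (fun n => h n ^ 2 / ε₁ n) atTop (𝓝 0) →
      GammaConverges
        (fun n => (T n).constrainedEnergyQuad Lbc lbc reg (δ n) (ε₁ n) ε₂)
        (constrainedEnergyPen Lbc lbc ε₂)) := by
  have hT : ∀ n j, (T n).len j ≤ h n := fun n j => hh n ▸ (T n).len_le_meshSize j
  have hhpos : ∀ n, 0 < h n := fun n => by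
    obtain ⟨j, -⟩ := (T n).exists_mem_element (x := L) ⟨hL, le_rfl⟩
    exact ((T n).len_pos j).trans_le (hT n j)
  have hlt : ∀ (n : ℕ) (ε₂ C : ℝ) (z : RibbonSpace L),
      (T n).constrainedEnergyQuad Lbc lbc reg (δ n) (ε₁ n) ε₂ z < (C : EReal) →
        (T n).IsDiscreteAdmissible Lbc lbc z ∧
          (T n).energyQuad reg (δ n) (ε₁ n) ε₂ z ≤ C := fun n ε₂ C z hz => by
    rw [Mesh.constrainedEnergyQuad] at hz
    split_ifs at hz with hadm
    · exact ⟨hadm, (EReal.coe_lt_coe_iff.1 hz).le⟩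
    · exact absurd hz (by simp)
  refine ⟨fun ε₂ hε₂ hε₂0 => ⟨fun v w hw hv => ?_, fun hcond => ?_⟩,
    fun ε₂ hε₂ _ _ => ⟨fun v w hv => ?_, fun v => ?_⟩⟩
  · have hlow : ∀ C : ℝ,
        liminf (fun n => ((T n).energyQuad reg (δ n) (ε₁ n) (ε₂ n) (w n) : EReal)) atTop < C →
          IsAdmissible Lbc lbc v ∧ energy v ≤ C := fun C hC =>
      energy_le_of_frequently hL hreg hT hh0 hδ hδ0 hε₁ hε₁0 hε₂ hε₂0 hv
        ((frequently_of_liminf_lt hC).mono fun n hn => ⟨hw n, (EReal.coe_lt_coe_iff.1 hn).le⟩)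
    refine ⟨⟨fun x hx => ?_, hv.boundaryData_eq hL fun n => (hw n).2.2.2⟩, fun hfin => ?_, ?_⟩
    · obtain ⟨h1, h2⟩ := hv.norm_eq_one hL hT hh0 hw hx
      rw [h1, h2]
      norm_num
    · obtain ⟨C, hC, -⟩ := EReal.lt_iff_exists_real_btwn.1 hfin
      exact (hlow C hC).1
    · by_contra hcon
      -- A real level C strictly between the lower limit and E[y, b] is undercut infinitely often,
      -- so the lower bound at level C applies along a subsequence.
      obtain ⟨C, hC, hC'⟩ := EReal.lt_iff_exists_real_btwn.1 (not_le.1 hcon)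
      exact absurd (hlow C hC).2 (not_le.2 (EReal.coe_lt_coe_iff.1 hC'))
  · have hhε := tendsto_div_of_tendsto_sqrt_div hhpos hε₁ hε₂ hcond
    have hrec : ∀ {v : RibbonSpace L}, IsAdmissible Lbc lbc v →
        Tendsto (fun n => (T n).energyQuad reg (δ n) (ε₁ n) (ε₂ n) ((T n).interpolant hL v)) atTop
          (𝓝 (energy v)) := fun hv =>
      tendsto_energyQuad_interpolant hL hreg hT hh0 hδ hδ0 ε₁ hε₂ hhε hv
    refine ⟨fun v σ _ hσ hv => ?_, fun w tol _ htol hw hex v hvacc => ?_,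
      fun _ _ => ⟨fun v w hv => ?_, fun v => ?_⟩⟩
    · have hadm := isAdmissible_of_approxCondition hL hhpos hε₂ hσ hv
      exact ⟨fun n => (T n).interpolant hL v,
        fun n => (T n).isDiscreteAdmissible_interpolant hL hadm.1,
        strongConv_interpolant hL hT hh0 v, hrec hadm⟩
    · obtain ⟨v₀, -, σ, -, hσ, hv₀⟩ := hex
      have hadm₀ := isAdmissible_of_approxCondition hL hhpos hε₂ hσ hv₀
      obtain ⟨φ, hφ, hvφ⟩ := hvacc
      have key : ∀ u : RibbonSpace L, IsAdmissible Lbc lbc u → ∀ η : ℝ, 0 < η →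
          IsAdmissible Lbc lbc v ∧ energy v ≤ energy u + η := fun u hu η hη => by
        have hlim := (hrec hu).add htol
        rw [add_zero] at hlim
        have hev := (hlim.comp hφ.tendsto_atTop).eventually
          (gt_mem_nhds (lt_add_of_pos_right (energy u) hη))
        refine energy_le_of_frequently hL hreg (T := fun n => T (φ n)) (h := fun n => h (φ n))
          (δ := fun n => δ (φ n)) (ε₁ := fun n => ε₁ (φ n)) (ε₂ := fun n => ε₂ (φ n))
          (fun n => hT (φ n)) (hh0.comp hφ.tendsto_atTop) (fun n => hδ (φ n))
          (hδ0.comp hφ.tendsto_atTop) (fun n => hε₁ (φ n)) (hε₁0.comp hφ.tendsto_atTop)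
          (fun n => hε₂ (φ n)) (hε₂0.comp hφ.tendsto_atTop) hvφ
          (hev.mono fun n hn => ⟨(hw (φ n)).1, ?_⟩).frequently
        exact ((hw (φ n)).2 _ ((T (φ n)).isDiscreteAdmissible_interpolant hL hu.1)).trans hn.le
      exact ⟨(key v₀ hadm₀ 1 one_pos).1, fun u hu =>
        le_of_forall_pos_le_add fun η hη => (key u hu η hη).2⟩
    · by_contra hcon
      obtain ⟨C, hC, hC'⟩ := EReal.lt_iff_exists_real_btwn.1 (not_le.1 hcon)
      obtain ⟨h1, h2⟩ := energy_le_of_frequently hL hreg hT hh0 hδ hδ0 hε₁ hε₁0 hε₂ hε₂0 hv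
        ((frequently_of_liminf_lt hC).mono fun n hn => hlt n _ C _ hn)
      rw [constrainedEnergy, if_pos h1] at hC'
      exact absurd h2 (not_le.2 (EReal.coe_lt_coe_iff.1 hC'))
    · refine ⟨fun n => (T n).interpolant hL v, strongConv_interpolant hL hT hh0 v, ?_⟩
      rw [constrainedEnergy]
      split_ifs with hv
      · refine le_of_eq (Tendsto.limsup_eq ?_)
        exact ((continuous_coe_real_ereal.tendsto _).comp (hrec hv)).congr fun n =>
          (if_pos ((T n).isDiscreteAdmissible_interpolant hL hv.1)).symm
      · exact le_top
  · by_contra hcon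
    obtain ⟨C, hC, hC'⟩ := EReal.lt_iff_exists_real_btwn.1 (not_le.1 hcon)
    obtain ⟨h1, h2⟩ := energyPen_le_of_frequently hL hreg hT hh0 hδ hδ0 hε₁ hε₁0
      (ε₂ := fun _ => ε₂) (fun _ => hε₂) hv
      ((frequently_of_liminf_lt hC).mono fun n hn => hlt n _ C _ hn)
      (ε := ε₂) (Eventually.of_forall fun _ => le_rfl)
    rw [constrainedEnergyPen, if_pos h1] at hC'
    exact absurd h2 (not_le.2 (EReal.coe_lt_coe_iff.1 hC'))
  · refine ⟨fun n => (T n).interpolant hL v, strongConv_interpolant hL hT hh0 v, ?_⟩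
    rw [constrainedEnergyPen]
    split_ifs with hv
    · refine le_of_eq (Tendsto.limsup_eq ?_)
      exact ((continuous_coe_real_ereal.tendsto _).comp
        (tendsto_energyQuad_interpolant_pen hL hreg hT hh0 hδ hδ0 ε₁ ε₂ hv)).congr fun n =>
          (if_pos ((T n).isDiscreteAdmissible_interpolant hL hv)).symm
    · exact le_top
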